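/- **Theorem 1.2.** Let $\theta\in(0,1)$ and $k>1$. There is $\delta_0>0$, depending only on $\theta$ and $k$, such that the following holds for every $\delta\in(0,\delta_0)$ and every $b\in C^2([0,\infty)\times\mathbf R)$ with $$|\partial_t^\alpha\partial_x^\beta b(t,x)|\le \frac{\delta}{(1+t)^{k+\alpha}}\qquad(\alpha,\beta\in\{0,1\},\ t\ge 0,\ x\in\mathbf R).$$ Put $a(t,x)=\frac{2}{1+t}+b(t,x)$. Then there is $h\in C^2([0,\infty)\times\mathbf R)$ satisfying on $[0,\infty)\times\mathbf R$ $$h_{tt}-h_{xx}-b\,h_t-\Big(\frac{b}{1+t}+b_t\Big)(1+h)=0,\qquad |h|\le\frac{\theta}{(1+t)^{k-1}},\qquad |h_t|,|h_x|\le\frac{C}{(1+t)^k}\qquad(*)$$ for some constant $C>0$. Moreover, let $h$ be any such function, $g(t,x)=(1+t)(1+h(t,x))$, $1<p\le 3$, and let $(u_0,u_1)\in H^1(\mathbf R)\times L^2(\mathbf R)$ satisfy $$\liminf_{R\to\infty}\int_{-R}^{R}\Big(\big(-g_t(0,x)+g(0,x)a(0,x)\big)u_0(x)+g(0,x)u_1(x)\Big)dx>0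 .$$ Then the local solution $u$ of $$u_{tt}-u_{xx}+a(t,x)u_t=|u|^p\ \text{ in }(0,\infty)\times\mathbf R,\qquad (u,u_t)(0,x)=(u_0,u_1)(x),$$ blows up in finite time: there are $T^*\in(0,\infty)$ and a solution $u$ on $[0,T^*)$ such that every solution on any interval $[0,T)$, $0<T\le\infty$, satisfies $T\le T^*$ and is the restriction of $u$ to $[0,T)$, and $$\lim_{t\to T^*-0}\|(u,u_t)(t)\|_{H^1\times L^2}=+\infty .$$ Here, for $T\in(0,\infty]$, a solution on $[0,T)$ is a function $u\in C([0,T);H^1(\mathbf R))\cap C^1([0,T);L^2(\mathbf R))$ such that $$\int_{[0,T)\times\mathbf R}u\,\big(\psi_{tt}-\psi_{xx}-(a\psi)_t\big)\,dx\,dt=\int_{\mathbf R}\big\{(a(0,x)u_0(x)+u_1(x))\psi(0,x)-u_0(x)\psi_t(0,x)\big\}dx+\int_{[0,T)\times\mathbf R}|u|^p\psi\,dx\,dt$$ for every $\psi\in C^2_0([0,T)\times\mathbf R)$, i.e. every $C^2$ function $\psi$ on $[0,T)\times\mathbf R$ with compact support in $[0,T)\times\mathbf R$. -/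

import Mathlib

open MeasureTheory Set Filter Topology
open scoped ContDiff

namespace DampedWave

noncomputable section

/-! ## Function spaces -/

/-- The real Hilbert space `L²(ℝ)`. -/
abbrev L2 : Type := Lp ℝ 2 (volume : Measure ℝ)

/-- `g` is the weak derivative of `f` on `ℝ`, tested against `C_c^∞(ℝ)`. -/
def IsWeakDeriv (f g : L2) : Prop :=
  ∀ φ : ℝ → ℝ, ContDiff ℝ ∞ φ → HasCompactSupport φ →
    ∫ x, f x * deriv φ x = -∫ x, g x * φ x

theorem integrable_mul_test (f : L2) {φ : ℝ → ℝ} (hφ : Continuous φ)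
    (hc : HasCompactSupport φ) : Integrable (fun x => f x * φ x) :=
  (Lp.memLp f).integrable_mul (q := 2) (hφ.memLp_of_hasCompactSupport hc)

theorem IsWeakDeriv.zero : IsWeakDeriv 0 0 := by
  intro φ _ _
  have h : ∀ ψ : ℝ → ℝ, ∫ x, (0 : L2) x * ψ x = 0 := fun ψ => by
    rw [← integral_zero ℝ ℝ (μ := volume)]
    refine integral_congr_ae ?_
    filter_upwards [Lp.coeFn_zero ℝ 2 (volume : Measure ℝ)] with x hx
    simp only [hx, Pi.zero_apply, zero_mul]
  rw [h, h, neg_zero]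

theorem IsWeakDeriv.add {f g f' g' : L2} (h : IsWeakDeriv f g) (h' : IsWeakDeriv f' g') :
    IsWeakDeriv (f + f') (g + g') := by
  intro φ hφ hc
  have key : ∀ (F G : L2) (ψ : ℝ → ℝ), Continuous ψ → HasCompactSupport ψ →
      ∫ x, (F + G : L2) x * ψ x = (∫ x, F x * ψ x) + ∫ x, G x * ψ x := fun F G ψ h1 h2 => by
    rw [← integral_add (integrable_mul_test F h1 h2) (integrable_mul_test G h1 h2)]
    refine integral_congr_ae ?_
    filter_upwards [Lp.coeFn_add F G] with x hx
    simp only [hx, Pi.add_apply, add_mul]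
  rw [key _ _ _ (hφ.continuous_deriv (by simp)) hc.deriv, key _ _ _ hφ.continuous hc,
    h φ hφ hc, h' φ hφ hc]
  ring

theorem IsWeakDeriv.smul {f g : L2} (c : ℝ) (h : IsWeakDeriv f g) :
    IsWeakDeriv (c • f) (c • g) := by
  intro φ hφ hc
  have key : ∀ (F : L2) (ψ : ℝ → ℝ), ∫ x, (c • F : L2) x * ψ x = c * ∫ x, F x * ψ x :=
    fun F ψ => by
      rw [← integral_const_mul]
      refine integral_congr_ae ?_
      filter_upwards [Lp.coeFn_smul c F] with x hx
      simp only [hx, Pi.smul_apply, smul_eq_mul, mul_assoc]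
  rw [key, key, h φ hφ hc]
  ring

/-- The Sobolev space `H¹(ℝ)`, as the space of pairs `(f, f')` with `f ∈ L²(ℝ)` and weak
derivative `f' ∈ L²(ℝ)`; its norm is `(‖f‖² + ‖f'‖²)^{1/2}`. -/
def H1 : Submodule ℝ (WithLp 2 (L2 × L2)) where
  carrier := {w | IsWeakDeriv w.fst w.snd}
  zero_mem' := IsWeakDeriv.zero
  add_mem' := fun h h' => IsWeakDeriv.add h h'
  smul_mem' := fun c _ h => IsWeakDeriv.smul c h

/-- The inclusion `H¹(ℝ) → L²(ℝ)`. -/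
def toL2 (w : H1) : L2 := (w : WithLp 2 (L2 × L2)).fst

/-! ## Functions on the half plane `[0,∞) × ℝ` -/

/-- `∂ₜ f (t, x)` for `f` defined on `[0,∞) × ℝ` (one-sided at `t = 0`). -/
def dt (f : ℝ → ℝ → ℝ) (t x : ℝ) : ℝ := derivWithin (fun s => f s x) (Ici 0) t

/-- `∂ₓ f (t, x)`. -/
def dx (f : ℝ → ℝ → ℝ) (t x : ℝ) : ℝ := deriv (fun y => f t y) x

/-- The interval `[0, T)`, for `T ∈ (0, ∞]`. -/
def timeInterval (T : EReal) : Set ℝ := {t | 0 ≤ t ∧ (t : EReal) < T}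

/-- `f ∈ C²([0,∞) × ℝ)`. -/
def IsC2 (f : ℝ → ℝ → ℝ) : Prop :=
  ContDiffOn ℝ 2 (fun z : ℝ × ℝ => f z.1 z.2) (Ici 0 ×ˢ univ)

/-- `|∂ₜ^α ∂ₓ^β b(t, x)| ≤ δ (1 + t)^{-(k + α)}` for `α, β ∈ {0, 1}`. -/
def DecayBound (k δ : ℝ) (b : ℝ → ℝ → ℝ) : Prop :=
  ∀ t x : ℝ, 0 ≤ t →
    |b t x| ≤ δ / (1 + t) ^ k ∧
    |dx b t x| ≤ δ / (1 + t) ^ k ∧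
    |dt b t x| ≤ δ / (1 + t) ^ (k + 1) ∧
    |dt (dx b) t x| ≤ δ / (1 + t) ^ (k + 1)

/-- The damping coefficient `a(t, x) = 2 / (1 + t) + b(t, x)`. -/
def damping (b : ℝ → ℝ → ℝ) (t x : ℝ) : ℝ := 2 / (1 + t) + b t x

/-- `h ∈ C²([0,∞) × ℝ)` solves
`h_tt - h_xx - b h_t - (b / (1 + t) + b_t) (1 + h) = 0` on `[0,∞) × ℝ`, with
`|h| ≤ θ (1 + t)^{-(k - 1)}` and `|h_t|, |h_x| ≤ C (1 + t)^{-k}` for some `C`. -/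
structure IsCorrector (θ k : ℝ) (b h : ℝ → ℝ → ℝ) : Prop where
  isC2 : IsC2 h
  eqn : ∀ t x : ℝ, 0 ≤ t →
    dt (dt h) t x - dx (dx h) t x - b t x * dt h t x
      - (b t x / (1 + t) + dt b t x) * (1 + h t x) = 0
  bound : ∀ t x : ℝ, 0 ≤ t → |h t x| ≤ θ / (1 + t) ^ (k - 1)
  deriv_bound : ∃ C : ℝ, 0 < C ∧ ∀ t x : ℝ, 0 ≤ t →
    |dt h t x| ≤ C / (1 + t) ^ k ∧ |dx h t x| ≤ C / (1 + t) ^ k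

/-- The multiplier `g(t, x) = (1 + t) (1 + h(t, x))`. -/
def multiplier (h : ℝ → ℝ → ℝ) (t x : ℝ) : ℝ := (1 + t) * (1 + h t x)

/-- `liminf_{R → ∞} ∫_{-R}^{R} ((-g_t(0,x) + g(0,x) a(0,x)) u₀(x) + g(0,x) u₁(x)) dx > 0`,
the lower limit being taken in `[-∞, ∞]`. -/
def DataCondition (g a : ℝ → ℝ → ℝ) (u₀ : H1) (u₁ : L2) : Prop :=
  (0 : EReal) < liminf (fun R : ℝ =>
    ((∫ x in (-R)..R, ((-dt g 0 x + g 0 x * a 0 x) * toL2 u₀ x + g 0 x * u₁ x) : ℝ) : EReal))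
    atTop

/-! ## Solutions of `u_tt - u_xx + a u_t = |u|^p` -/

/-- `ψ ∈ C₀²([0, T) × ℝ)`: `ψ` is `C²` and its support is contained in a compact subset of
`[0, T) × ℝ` (so `ψ` need not vanish at `t = 0`). -/
def IsTestFunction (T : EReal) (ψ : ℝ → ℝ → ℝ) : Prop :=
  ContDiffOn ℝ 2 (fun z : ℝ × ℝ => ψ z.1 z.2) (timeInterval T ×ˢ univ) ∧
  ∃ K : Set (ℝ × ℝ), IsCompact K ∧ K ⊆ timeInterval T ×ˢ univ ∧
    ∀ t x : ℝ, t ∈ timeInterval T → (t, x) ∉ K → ψ t x = 0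

/-- `u ∈ C([0, T); H¹(ℝ)) ∩ C¹([0, T); L²(ℝ))`, with time derivative `ut` in `L²(ℝ)`
(one-sided at `t = 0`). -/
structure MemX (T : EReal) (u : ℝ → H1) (ut : ℝ → L2) : Prop where
  continuousOn : ContinuousOn u (timeInterval T)
  hasDeriv : ∀ t ∈ timeInterval T,
    HasDerivWithinAt (fun s => toL2 (u s)) (ut t) (timeInterval T) t
  continuousOn_deriv : ContinuousOn ut (timeInterval T)

/-- `u`, with time derivative `ut`, is a solution on `[0, T)`, `T ∈ (0, ∞]`, of
`u_tt - u_xx + a u_t = |u|^p`, `(u, u_t)(0) = (u₀, u₁)`, in the weak sense.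
Each integral over `[0, T) × ℝ` is written as an iterated integral: for every `t` the function
`u(t, ·)` is an element of `L²(ℝ)`, so that the inner integral does not depend on the choice of
representatives. -/
structure IsSolution (a : ℝ → ℝ → ℝ) (p : ℝ) (u₀ : H1) (u₁ : L2) (T : EReal)
    (u : ℝ → H1) (ut : ℝ → L2) : Prop where
  pos : 0 < T
  memX : MemX T u ut
  weak : ∀ ψ : ℝ → ℝ → ℝ, IsTestFunction T ψ →
    ∫ t in timeInterval T, ∫ x, toL2 (u t) x *
        (dt (dt ψ) t x - dx (dx ψ) t x - dt (fun s y => a s y * ψ s y) t x)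
      = (∫ x, ((a 0 x * toL2 u₀ x + u₁ x) * ψ 0 x - toL2 u₀ x * dt ψ 0 x))
        + ∫ t in timeInterval T, ∫ x, |toL2 (u t) x| ^ p * ψ t x

/-- The local solution of the initial value problem blows up in finite time: for some
`T* ∈ (0, ∞)` there is a solution `u` on `[0, T*)`, every solution on any `[0, T)`,
`T ∈ (0, ∞]`, is a restriction of it (in particular `T ≤ T*`), and
`‖(u, u_t)(t)‖_{H¹ × L²} → ∞` as `t ↑ T*`. -/
def BlowsUpInFiniteTime (a : ℝ → ℝ → ℝ) (p : ℝ) (u₀ : H1) (u₁ : L2) : Prop :=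
  ∃ Tstar : ℝ, 0 < Tstar ∧ ∃ (u : ℝ → H1) (ut : ℝ → L2),
    IsSolution a p u₀ u₁ Tstar u ut ∧
    (∀ (T : EReal) (v : ℝ → H1) (vt : ℝ → L2), IsSolution a p u₀ u₁ T v vt →
      T ≤ Tstar ∧ ∀ t ∈ timeInterval T, v t = u t ∧ vt t = ut t) ∧
    Tendsto (fun t => ‖u t‖ + ‖ut t‖) (𝓝[<] Tstar) atTop

end

end DampedWave

open DampedWave

/-! The blow-up comes from a test function weighted by a positive solution of the adjoint equation.
For b = 0 the function 1 + t solves g_tt - g_xx - (a g)_t = 0. With g = (1 + t)(1 + h), the adjoint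
expression for general b equals (1 + t) times the left-hand side of the corrector equation. A
corrector with |h| ≤ θ < 1 therefore gives an exact adjoint solution comparable to 1 + t, with g_t,
g_x and a g bounded (`IsCorrector.isMultiplier`).

Existence of h. The equation reads h_tt - h_xx = F with F = b h_t + c (1 + h) and c = b/(1+t) + b_t
= O(δ (1+t)^{-(k+1)}). It is solved from t = ∞ by integrating F along both families of forward
characteristics (`backwardWave`). Each integration costs one power of 1 + t, so a source decaying
like (1+t)^{-(k+1)} with k > 1 is admissible. For small δ the map sending F to the new right-hand
side is a contraction in the weight (1+t)^{k+1}. By `charInt_charInt_eq`, h is C² as soon as F and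
F_x are continuous, so the contraction is run on the pair (F, F_x) (`Coeffs.exists_source`).

Absence of global solutions. Test the equation with g φ_R, where φ_R is a cutoff at scale R in both
t and x. Because g solves the adjoint equation exactly, only terms with derivatives of φ_R survive.
They are O(1/R) and live where t or |x| is of order R. Young's inequality bounds their pairing with
u by l ∫ |u|^p g φ_R over the transition region plus l^{-1/(p-1)} times a remainder, and p ≤ 3 makes
this remainder bounded in R. The data condition supplies a constant c > 0 on the other side
(`IsSolution.exists_energy_le`). At p = 3 the remainder does not tend to zero, so two passes are
made. Taking l = 1/2 shows that |u|^p g is integrable on the half plane. The transition integral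
then vanishes as R → ∞, leaving c ≤ D l^{-1/(p-1)} for every l, which is absurd as l → ∞
(`not_isSolution_top`).

From nonexistence to blow-up. Let S(t) be the wave group given by d'Alembert's formula (`wave`). For
a solution u, the curve V(t) = S(-t)(u, u_t)(t) solves the ordinary differential equation V' =
S(-t)(0, |u|^p - a u_t) in H¹ × L². Its field is locally Lipschitz because H¹ embeds in L^∞. The
Picard existence time depends only on the norm, so a maximal curve that is not global has norm
tending to infinity (`LocallyLipschitzField.exists_blowup`). Integral curves are weak solutions
(`NonlinearFlow.isSolution`). Conversely every weak solution is an integral curve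
(`IsSolution.exists_nonlinearFlow`). This rests on uniqueness for the weak linear wave equation,
proved by duality with `backwardWave` of a product η(t) φ(x).

Calculus in H¹ is carried out through the translation group: g is the weak derivative of f exactly
when s ↦ f(· + s) is differentiable in L² with derivative g at s = 0. -/

namespace DampedWave

noncomputable section

/-! ## Translations of `L²(ℝ)` and test functions as elements of `L²(ℝ)` -/

/-- The translation `f ↦ f (· + s)` of `L²(ℝ)`. -/
def shift (s : ℝ) : L2 →ₗᵢ[ℝ] L2 where
  toFun f := DomAddAct.mk s +ᵥ f
  map_add' f g := DomAddAct.vadd_Lp_add _ f g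
  map_smul' c f := by
    obtain ⟨⟨_⟩, _⟩ := f
    rfl
  norm_map' f := DomAddAct.norm_vadd_Lp _ f

theorem shift_apply (s : ℝ) (f : L2) : shift s f = DomAddAct.mk s +ᵥ f := rfl

theorem shift_coeFn (s : ℝ) (f : L2) : shift s f =ᵐ[volume] fun x => f (s + x) :=
  DomAddAct.vadd_Lp_ae_eq (DomAddAct.mk s) f

@[simp] theorem shift_zero (f : L2) : shift 0 f = f := by
  rw [shift_apply, DomAddAct.mk_zero, zero_vadd]

theorem shift_shift (s t : ℝ) (f : L2) : shift s (shift t f) = shift (s + t) f := by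
  rw [shift_apply, shift_apply, shift_apply, vadd_vadd, ← DomAddAct.mk_add, add_comm t s]

theorem continuous_shift : Continuous fun z : ℝ × L2 => shift z.1 z.2 := by
  have h : Continuous fun z : ℝ × L2 => (DomAddAct.mk z.1 : DomAddAct ℝ) := by
    exact DomAddAct.continuous_mk.comp continuous_fst
  -- Translations are strongly continuous on Lᵖ only for finite exponents.
  have : Fact ((2 : ENNReal) ≠ ⊤) := ⟨by simp⟩
  exact h.vadd continuous_snd

theorem continuous_shift_left (f : L2) : Continuous fun s => shift s f :=
  continuous_shift.comp (continuous_id.prodMk continuous_const)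

theorem inner_eq_integral (f g : L2) : inner ℝ f g = ∫ x, f x * g x := by
  rw [L2.inner_def]
  refine integral_congr_ae (Eventually.of_forall fun x => ?_)
  simp [mul_comm]

theorem inner_shift_shift (s : ℝ) (f g : L2) : inner ℝ (shift s f) (shift s g) = inner ℝ f g :=
  (shift s).inner_map_map f g

theorem inner_shift_left (s : ℝ) (f g : L2) :
    inner ℝ (shift s f) g = inner ℝ f (shift (-s) g) := by
  rw [← inner_shift_shift (-s) (shift s f) g, shift_shift, neg_add_cancel, shift_zero]

open Classical in
/-- The class in `L²(ℝ)` of a square integrable function (and `0` otherwise). -/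
def ofFun (φ : ℝ → ℝ) : L2 := if h : MemLp φ 2 volume then h.toLp φ else 0

theorem ofFun_coeFn {φ : ℝ → ℝ} (h : MemLp φ 2 volume) : ofFun φ =ᵐ[volume] φ := by
  rw [ofFun, dif_pos h]
  exact h.coeFn_toLp

theorem ofFun_coe (f : L2) : ofFun f = f := by
  rw [ofFun, dif_pos (Lp.memLp f), Lp.toLp_coeFn]

theorem ofFun_congr {φ ψ : ℝ → ℝ} (h : MemLp φ 2 volume) (h' : φ =ᵐ[volume] ψ) :
    ofFun φ = ofFun ψ := by
  rw [ofFun, ofFun, dif_pos h, dif_pos (h.ae_eq h')]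
  exact (MemLp.toLp_eq_toLp_iff _ _).2 h'

theorem eq_ofFun {f : L2} {φ : ℝ → ℝ} (h : f =ᵐ[volume] φ) : f = ofFun φ := by
  rw [← ofFun_coe f]
  exact ofFun_congr (Lp.memLp f) h

theorem ofFun_const_mul (c : ℝ) {φ : ℝ → ℝ} (h : MemLp φ 2 volume) :
    ofFun (fun x => c * φ x) = c • ofFun φ := by
  refine (eq_ofFun ?_).symm
  filter_upwards [Lp.coeFn_smul c (ofFun φ), ofFun_coeFn h] with x h1 h2
  rw [h1, Pi.smul_apply, h2, smul_eq_mul]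

theorem ofFun_sub {φ ψ : ℝ → ℝ} (h : MemLp φ 2 volume) (h' : MemLp ψ 2 volume) :
    ofFun (fun x => φ x - ψ x) = ofFun φ - ofFun ψ := by
  refine (eq_ofFun ?_).symm
  filter_upwards [Lp.coeFn_sub (ofFun φ) (ofFun ψ), ofFun_coeFn h, ofFun_coeFn h'] with x h1 h2 h3
  rw [h1, Pi.sub_apply, h2, h3]

theorem inner_ofFun (f : L2) {φ : ℝ → ℝ} (h : MemLp φ 2 volume) :
    inner ℝ f (ofFun φ) = ∫ x, f x * φ x := by
  rw [inner_eq_integral]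
  refine integral_congr_ae ?_
  filter_upwards [ofFun_coeFn h] with x h1
  rw [h1]

theorem shift_ofFun (s : ℝ) {φ : ℝ → ℝ} (h : MemLp φ 2 volume) :
    shift s (ofFun φ) = ofFun fun x => φ (s + x) := by
  refine eq_ofFun ((shift_coeFn s _).trans ?_)
  exact (measurePreserving_add_left volume s).quasiMeasurePreserving.ae_eq_comp (ofFun_coeFn h)

theorem memLp_of_bound {φ : ℝ → ℝ} {M C : ℝ} (hm : AEStronglyMeasurable φ volume)
    (hs : ∀ x, M < |x| → φ x = 0) (hb : ∀ x, |x| ≤ M → |φ x| ≤ C) : MemLp φ 2 volume := by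
  have h1 : MemLp (indicator (Icc (-M) M) fun _ => C) 2 (volume : Measure ℝ) :=
    memLp_indicator_const 2 measurableSet_Icc C (Or.inr (by simp))
  refine h1.mono hm (Eventually.of_forall fun x => ?_)
  by_cases hx : |x| ≤ M
  · rw [indicator_of_mem (by rwa [mem_Icc, ← abs_le])]
    exact (hb x hx).trans (le_abs_self C)
  · rw [hs x (not_le.1 hx), norm_zero]
    exact norm_nonneg _

theorem memLp_of_continuous {φ : ℝ → ℝ} {M : ℝ} (hφ : Continuous φ)
    (hs : ∀ x, M < |x| → φ x = 0) : MemLp φ 2 volume := by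
  refine hφ.memLp_of_hasCompactSupport
    (HasCompactSupport.intro (K := Icc (-M) M) isCompact_Icc fun x hx => ?_)
  refine hs x ?_
  rw [mem_Icc, ← abs_le] at hx
  exact not_le.1 hx

/-- Support in a fixed interval turns a sup bound into an L² bound. In this way uniform estimates on
test functions become estimates in L²(ℝ). -/
theorem norm_ofFun_le {φ : ℝ → ℝ} {M C : ℝ} (hm : AEStronglyMeasurable φ volume) (hM : 0 ≤ M)
    (hC : 0 ≤ C) (hs : ∀ x, M < |x| → φ x = 0) (hb : ∀ x, |x| ≤ M → |φ x| ≤ C) :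
    ‖ofFun φ‖ ≤ Real.sqrt (2 * M) * C := by
  have hL := memLp_of_bound hm hs hb
  have h2 : ‖ofFun φ‖ ^ 2 ≤ 2 * M * C ^ 2 := by
    rw [← real_inner_self_eq_norm_sq, inner_ofFun _ hL]
    have e : ∫ x, (ofFun φ) x * φ x = ∫ x, φ x ^ 2 := by
      refine integral_congr_ae ?_
      filter_upwards [ofFun_coeFn hL] with x hx
      rw [hx, sq]
    rw [e]
    calc ∫ x, φ x ^ 2 ≤ ∫ x, indicator (Icc (-M) M) (fun _ => C ^ 2) x := by
          refine integral_mono_of_nonneg (Eventually.of_forall fun x => sq_nonneg _)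
            ((integrable_indicator_iff measurableSet_Icc).2 (by simp))
            (Eventually.of_forall fun x => ?_)
          by_cases hx : |x| ≤ M
          · simp only
            rw [indicator_of_mem (by rwa [mem_Icc, ← abs_le]), ← sq_abs]
            exact pow_le_pow_left₀ (abs_nonneg _) (hb x hx) 2
          · simp only [hs x (not_le.1 hx)]
            rw [zero_pow two_ne_zero]
            exact indicator_nonneg (fun _ _ => sq_nonneg C) x
      _ = 2 * M * C ^ 2 := by
          rw [integral_indicator measurableSet_Icc, setIntegral_const]
          simp only [Measure.real, Real.volume_Icc, smul_eq_mul]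
          rw [ENNReal.toReal_ofReal (by linarith)]
          ring
  refine le_of_sq_le_sq ?_ (by positivity) 
  rw [mul_pow, Real.sq_sqrt (by positivity)]
  exact h2

variable {Ψ Ψ' : ℝ → ℝ → ℝ} {s : Set ℝ} {M : ℝ}

theorem continuousOn_ofFun (hM : 0 ≤ M)
    (hc : ContinuousOn (fun z : ℝ × ℝ => Ψ z.1 z.2) (s ×ˢ univ))
    (hs : ∀ t ∈ s, ∀ x, M < |x| → Ψ t x = 0) : ContinuousOn (fun t => ofFun (Ψ t)) s := by
  intro t₀ ht₀
  have hct : ∀ t ∈ s, Continuous (Ψ t) := fun t ht => by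
    have := hc.comp_continuous (f := fun x : ℝ => (t, x)) (by fun_prop) fun x => ⟨ht, mem_univ x⟩
    exact this
  have hL : ∀ t ∈ s, MemLp (Ψ t) 2 volume := fun t ht => memLp_of_continuous (hct t ht) (hs t ht)
  rw [ContinuousWithinAt, Metric.tendsto_nhds]
  intro ε hε
  have hK : IsCompact (Icc (-M) M) := isCompact_Icc
  -- Joint continuity and compactness of [-M, M] make Ψ(t, ·) close to Ψ(t₀, ·) uniformly in x. The
  -- summand 1 in the denominator of the tolerance keeps it meaningful when M = 0.
  obtain ⟨v, hv, hv'⟩ := hK.mem_uniformity_of_prod (f := Ψ)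
    (hc.mono (prod_mono_right (subset_univ _))) ht₀
    (Metric.dist_mem_uniformity (show 0 < ε / (Real.sqrt (2 * M) + 1) by positivity))
  filter_upwards [hv, self_mem_nhdsWithin] with t h1 h2
  rw [dist_eq_norm, ← ofFun_sub (hL t h2) (hL t₀ ht₀)]
  refine (norm_ofFun_le (C := ε / (Real.sqrt (2 * M) + 1))
    (φ := fun x => Ψ t x - Ψ t₀ x) ((hct t h2).sub (hct t₀ ht₀)).aestronglyMeasurable hM (by positivity) ?_ ?_).trans_lt ?_
  · intro x hx
    simp only [hs t h2 x hx, hs t₀ ht₀ x hx, sub_zero]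
  · intro x hx
    exact (hv' t h1 x (abs_le.1 hx)).le
  · rw [mul_div_assoc', div_lt_iff₀ (by positivity)]
    nlinarith [Real.sqrt_nonneg (2 * M)]

theorem hasDerivWithinAt_ofFun (hM : 0 ≤ M) (hconv : Convex ℝ s)
    (hd : ∀ t ∈ s, ∀ x, HasDerivWithinAt (fun r => Ψ r x) (Ψ' t x) s t)
    (hct : ∀ t ∈ s, Continuous (Ψ t))
    (hc : ContinuousOn (fun z : ℝ × ℝ => Ψ' z.1 z.2) (s ×ˢ univ))
    (hs : ∀ t ∈ s, ∀ x, M < |x| → Ψ t x = 0) (hs' : ∀ t ∈ s, ∀ x, M < |x| → Ψ' t x = 0)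
    {t₀ : ℝ} (ht₀ : t₀ ∈ s) :
    HasDerivWithinAt (fun t => ofFun (Ψ t)) (ofFun (Ψ' t₀)) s t₀ := by
  have hct' : ∀ t ∈ s, Continuous (Ψ' t) := fun t ht => by
    have := hc.comp_continuous (f := fun x : ℝ => (t, x)) (by fun_prop) fun x => ⟨ht, mem_univ x⟩
    exact this
  have hL : ∀ t ∈ s, MemLp (Ψ t) 2 volume := fun t ht => memLp_of_continuous (hct t ht) (hs t ht)
  have hL' : MemLp (Ψ' t₀) 2 volume := memLp_of_continuous (hct' t₀ ht₀) (hs' t₀ ht₀)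
  rw [hasDerivWithinAt_iff_isLittleO, Asymptotics.isLittleO_iff]
  intro ε hε
  set ε' := ε / (Real.sqrt (2 * M) + 1) with hε'
  have hε0 : 0 < ε' := by positivity
  have hK : IsCompact (Icc (-M) M) := isCompact_Icc
  obtain ⟨v, hv, hv'⟩ := hK.mem_uniformity_of_prod (f := Ψ')
    (hc.mono (prod_mono_right (subset_univ _))) ht₀ (Metric.dist_mem_uniformity hε0)
  obtain ⟨δ, hδ, hδv⟩ := Metric.mem_nhdsWithin_iff.1 hv
  filter_upwards [self_mem_nhdsWithin, mem_nhdsWithin_of_mem_nhds (Metric.ball_mem_nhds t₀ hδ)]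
    with t h1 h2
  rw [← ofFun_sub (hL t h1) (hL t₀ ht₀), ← ofFun_const_mul _ hL',
    ← ofFun_sub (φ := fun x => Ψ t x - Ψ t₀ x) ((hL t h1).sub (hL t₀ ht₀)) (hL'.const_mul _)]
  refine (norm_ofFun_le (C := ε' * ‖t - t₀‖) ?_ hM (by positivity) ?_ ?_).trans ?_
  · exact (((hct t h1).sub (hct t₀ ht₀)).sub (continuous_const.mul (hct' t₀ ht₀))).aestronglyMeasurable
  · intro x hx
    rw [hs t h1 x hx, hs t₀ ht₀ x hx, hs' t₀ ht₀ x hx]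
    ring
  · intro x hx
    have hcv : Convex ℝ (Metric.ball t₀ δ ∩ s) := (convex_ball t₀ δ).inter hconv
    -- Mean value inequality for r ↦ Ψ(r, x) - r Ψ'(t₀, x): its derivative is at most ε' near t₀,
    -- uniformly in |x| ≤ M, so the first-order remainder is at most ε' |t - t₀|.
    have key := hcv.norm_image_sub_le_of_norm_hasDerivWithin_le
      (f := fun r => Ψ r x - r * Ψ' t₀ x) (f' := fun r => Ψ' r x - 1 * Ψ' t₀ x) (C := ε')
      (x := t₀) (y := t)
      (fun r hr => ((hd r hr.2 x).mono inter_subset_right).sub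
        ((hasDerivWithinAt_id r _).mul_const (Ψ' t₀ x)))
      (fun r hr => by
        have := hv' r (hδv hr) x (abs_le.1 hx)
        rw [one_mul]
        exact this.le)
      ⟨Metric.mem_ball_self hδ, ht₀⟩ ⟨h2, h1⟩
    rw [Real.norm_eq_abs] at key
    convert key using 2
    ring
  · rw [hε', ← mul_assoc]
    refine mul_le_mul_of_nonneg_right ?_ (norm_nonneg _)
    rw [mul_div_assoc', div_le_iff₀ (by positivity)]
    nlinarith [Real.sqrt_nonneg (2 * M)]

theorem memLp_of_test {φ : ℝ → ℝ} (h : Continuous φ) (hc : HasCompactSupport φ) :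
    MemLp φ 2 volume :=
  h.memLp_of_hasCompactSupport hc

theorem eq_zero_of_inner_test {f : L2}
    (h : ∀ φ : ℝ → ℝ, ContDiff ℝ ∞ φ → HasCompactSupport φ → inner ℝ f (ofFun φ) = 0) :
    f = 0 := by
  have hli : LocallyIntegrable f volume := (Lp.memLp f).locallyIntegrable (by norm_num)
  have := ae_eq_zero_of_integral_contDiff_smul_eq_zero hli fun φ hφ hc => by
    have := h φ hφ hc
    rw [inner_ofFun _ (memLp_of_test hφ.continuous hc)] at this
    simpa [mul_comm] using this
  exact (Lp.eq_zero_iff_ae_eq_zero).2 this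

theorem eq_of_inner_test {f g : L2}
    (h : ∀ φ : ℝ → ℝ, ContDiff ℝ ∞ φ → HasCompactSupport φ →
      inner ℝ f (ofFun φ) = inner ℝ g (ofFun φ)) : f = g := by
  refine sub_eq_zero.1 (eq_zero_of_inner_test fun φ hφ hc => ?_)
  rw [inner_sub_left, h φ hφ hc, sub_self]

/-! ## Weak derivatives as derivatives of the translation group -/

theorem hasDerivAt_shift_ofFun {φ : ℝ → ℝ} (hφ : ContDiff ℝ 1 φ) (hc : HasCompactSupport φ)
    (s : ℝ) :
    HasDerivAt (fun r => shift r (ofFun φ)) (shift s (ofFun (deriv φ))) s := by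
  have hd : Continuous (deriv φ) := hφ.continuous_deriv le_rfl
  obtain ⟨K, hK⟩ := hc.isCompact.isBounded.exists_norm_le
  have hz : ∀ x, K < |x| → φ x = 0 := fun x hx => by
    by_contra h
    exact absurd (hK x (subset_tsupport _ h)) (not_le.2 hx)
  have hz' : ∀ x, K < |x| → deriv φ x = 0 := fun x hx => by
    by_contra h
    exact absurd (hK x (support_deriv_subset h)) (not_le.2 hx)
  have e1 : ∀ r, shift r (ofFun φ) = ofFun fun x => φ (r + x) := fun r =>
    shift_ofFun r (memLp_of_test hφ.continuous hc)
  rw [shift_ofFun s (memLp_of_test hd hc.deriv)]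
  simp only [e1]
  have hfar : ∀ r ∈ Icc (s - 1) (s + 1), ∀ x, |K| + |s| + 1 < |x| → K < |r + x| := by
    intro r hr x hx
    have h1 : |r| ≤ |s| + 1 := by
      rw [abs_le]
      constructor <;> linarith [hr.1, hr.2, le_abs_self s, neg_abs_le s]
    have h2 : |x| ≤ |r + x| + |r| := by
      have := abs_sub (r + x) r
      rwa [add_sub_cancel_left] at this
    linarith [le_abs_self K]
  refine (hasDerivWithinAt_ofFun (Ψ := fun r x => φ (r + x)) (Ψ' := fun r x => deriv φ (r + x))
    (s := Icc (s - 1) (s + 1)) (M := |K| + |s| + 1) (by positivity) (convex_Icc _ _) ?_ ?_ ?_ ?_ ?_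
    (t₀ := s) ⟨by linarith, by linarith⟩).hasDerivAt (Icc_mem_nhds (by linarith) (by linarith))
  · intro t _ x
    have h1 : HasDerivAt φ (deriv φ (t + x)) (t + x) :=
      (hφ.differentiable one_ne_zero).differentiableAt.hasDerivAt
    exact (h1.comp_add_const t x).hasDerivWithinAt
  · intro t _
    exact hφ.continuous.comp (by fun_prop)
  · exact (hd.comp (by fun_prop : Continuous fun z : ℝ × ℝ => z.1 + z.2)).continuousOn
  · exact fun r hr x hx => hz _ (hfar r hr x hx)
  · exact fun r hr x hx => hz' _ (hfar r hr x hx)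

/-- Translations are isometries, so r ↦ ⟨f(· + r), φ(· + r)⟩ is constant. The vanishing of its
derivative at r = 0 is integration by parts. -/
theorem integral_mul_deriv_of_hasDerivAt_shift {f g : L2}
    (h : HasDerivAt (fun r => shift r f) g 0) {φ : ℝ → ℝ} (hφ : ContDiff ℝ 1 φ)
    (hc : HasCompactSupport φ) : ∫ x, f x * deriv φ x = -∫ x, g x * φ x := by
  have h1 := h.inner ℝ (hasDerivAt_shift_ofFun hφ hc 0)
  simp only [inner_shift_shift, shift_zero] at h1
  have h2 := (hasDerivAt_const (0 : ℝ) (inner ℝ f (ofFun φ))).unique h1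
  rw [inner_ofFun _ (memLp_of_test (hφ.continuous_deriv le_rfl) hc.deriv),
    inner_ofFun _ (memLp_of_test hφ.continuous hc)] at h2
  linarith

theorem hasDerivAt_integral_shift (g : L2) (s : ℝ) :
    HasDerivAt (fun r => ∫ q in (0 : ℝ)..r, shift q g) (shift s g) s :=
  (continuous_shift_left g).integral_hasStrictDerivAt 0 s |>.hasDerivAt

/-- Paired with a test function, f(· + r) - f - ∫₀ʳ g(· + q) dq has zero derivative in r: move the
translation onto the test function and use the weak derivative there. Hence f(· + r) is a primitive
of the continuous curve q ↦ g(· + q). -/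
theorem IsWeakDeriv.hasDerivAt_shift {f g : L2} (h : IsWeakDeriv f g) (s : ℝ) :
    HasDerivAt (fun r => shift r f) (shift s g) s := by
  have key : ∀ s, shift s f = f + ∫ q in (0 : ℝ)..s, shift q g := by
    intro s
    refine eq_of_inner_test fun φ hφ hc => ?_
    have hφ1 : ContDiff ℝ 1 φ := hφ.of_le (by exact_mod_cast le_top)
    have hd : ∀ r, HasDerivAt
        (fun r => inner ℝ (shift r f - (f + ∫ q in (0 : ℝ)..r, shift q g)) (ofFun φ)) 0 r := by
      intro r
      have e : ∀ r, inner ℝ (shift r f - (f + ∫ q in (0 : ℝ)..r, shift q g)) (ofFun φ)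
          = inner ℝ f (shift (-r) (ofFun φ))
            - inner ℝ (f + ∫ q in (0 : ℝ)..r, shift q g) (ofFun φ) := by
        intro r
        rw [inner_sub_left, inner_shift_left]
      simp only [e]
      have h1 : HasDerivAt (fun r => shift (-r) (ofFun φ)) (-(shift (-r) (ofFun (deriv φ)))) r := by
        have := (hasDerivAt_shift_ofFun hφ1 hc (-r)).scomp r (hasDerivAt_neg r)
        rw [neg_one_smul] at this
        exact this
      have h2 := (hasDerivAt_const r f).inner ℝ h1
      have h3 := ((hasDerivAt_integral_shift g r).const_add f).inner ℝ (hasDerivAt_const r (ofFun φ))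
      refine (h2.sub h3).congr_deriv ?_
      have h4 : ContDiff ℝ ∞ fun x => φ (-r + x) := hφ.comp (contDiff_const.add contDiff_id)
      have h5 : HasCompactSupport fun x => φ (-r + x) :=
        hc.comp_homeomorph (Homeomorph.addLeft (-r))
      have h6 := h _ h4 h5
      have h7 : deriv (fun x => φ (-r + x)) = fun x => deriv φ (-r + x) := by
        ext x
        rw [deriv_comp_const_add]
      have hdc : Continuous (deriv φ) := hφ1.continuous_deriv le_rfl
      have h8 : inner ℝ f (shift (-r) (ofFun (deriv φ))) = -inner ℝ (shift r g) (ofFun φ) := by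
        rw [inner_shift_left, shift_ofFun _ (memLp_of_test hdc hc.deriv),
          shift_ofFun _ (memLp_of_test hφ.continuous hc), inner_ofFun, inner_ofFun]
        · rw [← h6, h7]
        · exact memLp_of_test h4.continuous h5
        · rw [← h7]
          exact memLp_of_test (h4.continuous_deriv (by simp)) h5.deriv
      simp only [inner_neg_right, h8, inner_zero_left, inner_zero_right]
      ring
    have h0 := is_const_of_deriv_eq_zero (fun r => (hd r).differentiableAt)
      (fun r => (hd r).deriv) s 0
    simp only [shift_zero, intervalIntegral.integral_same, add_zero, sub_self,
      inner_zero_left] at h0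
    rw [inner_sub_left] at h0
    linarith
  rw [show (fun r => shift r f) = fun r => f + ∫ q in (0 : ℝ)..r, shift q g from funext key]
  exact (hasDerivAt_integral_shift g s).const_add f

theorem isWeakDeriv_of_hasDerivAt_shift {f g : L2} (h : HasDerivAt (fun r => shift r f) g 0) :
    IsWeakDeriv f g := fun _ hφ hc =>
  integral_mul_deriv_of_hasDerivAt_shift h (hφ.of_le (by exact_mod_cast le_top)) hc

/-- Passing through the translation group enlarges the class of test functions from C_c^∞ to C¹ with
compact support. The slices of C² space-time test functions require this. -/
theorem IsWeakDeriv.integral_mul_deriv {f g : L2} (h : IsWeakDeriv f g) {φ : ℝ → ℝ}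
    (hφ : ContDiff ℝ 1 φ) (hc : HasCompactSupport φ) :
    ∫ x, f x * deriv φ x = -∫ x, g x * φ x := by
  refine integral_mul_deriv_of_hasDerivAt_shift ?_ hφ hc
  have := h.hasDerivAt_shift 0
  rwa [shift_zero] at this

theorem IsWeakDeriv.unique {f g g' : L2} (h : IsWeakDeriv f g) (h' : IsWeakDeriv f g') :
    g = g' := by
  have := (h.hasDerivAt_shift 0).unique (h'.hasDerivAt_shift 0)
  rwa [shift_zero, shift_zero] at this

theorem IsWeakDeriv.shift {f g : L2} (h : IsWeakDeriv f g) (s : ℝ) :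
    IsWeakDeriv (shift s f) (DampedWave.shift s g) := by
  refine isWeakDeriv_of_hasDerivAt_shift ?_
  simp only [shift_shift]
  have := (h.hasDerivAt_shift (0 + s))
  rw [zero_add] at this
  exact HasDerivAt.comp_add_const 0 s (by rwa [zero_add])

/-- This is why the velocity term of d'Alembert's formula lies in H¹ for v merely in L²: translating
the integral only moves its endpoints. -/
theorem IsWeakDeriv.integral_shift (v : L2) (a b : ℝ) :
    IsWeakDeriv (∫ q in a..b, DampedWave.shift q v)
      (DampedWave.shift b v - DampedWave.shift a v) := by
  refine isWeakDeriv_of_hasDerivAt_shift ?_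
  have hi : ∀ a b : ℝ, IntervalIntegrable (fun q => DampedWave.shift q v) volume a b := fun a b =>
    (continuous_shift_left v).intervalIntegrable a b
  have e : ∀ r, DampedWave.shift r (∫ q in a..b, DampedWave.shift q v)
      = (∫ q in (0 : ℝ)..(b + r), DampedWave.shift q v)
        - ∫ q in (0 : ℝ)..(a + r), DampedWave.shift q v := by
    intro r
    have h1 := (DampedWave.shift r).toContinuousLinearMap.intervalIntegral_comp_comm (hi a b)
    simp only [LinearIsometry.coe_toContinuousLinearMap, shift_shift] at h1
    rw [← h1, intervalIntegral.integral_interval_sub_left (hi _ _) (hi _ _),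
      ← intervalIntegral.integral_comp_add_right]
    simp only [add_comm]
  simp only [e]
  have h1 := HasDerivAt.comp_const_add b 0 (f := fun r => ∫ q in (0 : ℝ)..r, DampedWave.shift q v)
    (hasDerivAt_integral_shift v (b + 0))
  have h2 := HasDerivAt.comp_const_add a 0 (f := fun r => ∫ q in (0 : ℝ)..r, DampedWave.shift q v)
    (hasDerivAt_integral_shift v (a + 0))
  rw [add_zero] at h1 h2
  exact h1.sub h2

/-! ## The space `H¹(ℝ)` -/

/-- The inclusion `H¹(ℝ) → L²(ℝ)` as a continuous linear map. -/
def incl : H1 →L[ℝ] L2 := (WithLp.fstL 2 ℝ L2 L2).comp H1.subtypeL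

/-- The weak derivative `H¹(ℝ) → L²(ℝ)`. -/
def grad : H1 →L[ℝ] L2 := (WithLp.sndL 2 ℝ L2 L2).comp H1.subtypeL

theorem incl_apply (w : H1) : incl w = toL2 w := rfl

theorem isWeakDeriv_grad (w : H1) : IsWeakDeriv (toL2 w) (grad w) := w.2

theorem H1.norm_sq (w : H1) : ‖w‖ ^ 2 = ‖toL2 w‖ ^ 2 + ‖grad w‖ ^ 2 :=
  WithLp.prod_norm_sq_eq_of_L2 (w : WithLp 2 (L2 × L2))

theorem norm_toL2_le (w : H1) : ‖toL2 w‖ ≤ ‖w‖ :=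
  le_of_sq_le_sq (by rw [H1.norm_sq w]; linarith [sq_nonneg ‖grad w‖]) (norm_nonneg _)

theorem norm_grad_le (w : H1) : ‖grad w‖ ≤ ‖w‖ :=
  le_of_sq_le_sq (by rw [H1.norm_sq w]; linarith [sq_nonneg ‖toL2 w‖]) (norm_nonneg _)

theorem H1.norm_le (w : H1) : ‖w‖ ≤ ‖toL2 w‖ + ‖grad w‖ := by
  refine le_of_sq_le_sq ?_ (by positivity)
  rw [H1.norm_sq w]
  nlinarith [norm_nonneg (toL2 w), norm_nonneg (grad w)]

/-- The element of `H¹(ℝ)` with given weak derivative. -/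
def H1.mk (f g : L2) (h : IsWeakDeriv f g) : H1 := ⟨WithLp.toLp 2 (f, g), h⟩

theorem H1.ext' {w w' : H1} (h : toL2 w = toL2 w') (h' : grad w = grad w') : w = w' := by
  refine sub_eq_zero.1 (norm_le_zero_iff.1 ((H1.norm_le _).trans ?_))
  rw [← incl_apply, map_sub, map_sub, incl_apply, incl_apply, h, h']
  simp

theorem toL2_injective {w w' : H1} (h : toL2 w = toL2 w') : w = w' :=
  H1.ext' h ((isWeakDeriv_grad w).unique (by rw [h]; exact isWeakDeriv_grad w'))

theorem continuousOn_H1 {X : Type*} [TopologicalSpace X] {s : Set X} {u : X → H1}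
    (h : ContinuousOn (fun t => toL2 (u t)) s) (h' : ContinuousOn (fun t => grad (u t)) s) :
    ContinuousOn u s := by
  rw [continuousOn_iff_continuous_domRestrict] at *
  refine Continuous.subtype_mk ?_ _
  exact (WithLp.prod_continuous_toLp 2 L2 L2).comp (h.prodMk h')

theorem isClosed_H1 : IsClosed (H1 : Set (WithLp 2 (L2 × L2))) := by
  have e : (H1 : Set (WithLp 2 (L2 × L2))) = ⋂ (φ : ℝ → ℝ) (_ : ContDiff ℝ ∞ φ)
      (_ : HasCompactSupport φ), {w | inner ℝ (WithLp.fstL 2 ℝ L2 L2 w) (ofFun (deriv φ))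
        = -inner ℝ (WithLp.sndL 2 ℝ L2 L2 w) (ofFun φ)} := by
    ext w
    simp only [mem_iInter, mem_ofPred_eq]
    refine forall_congr' fun φ => forall_congr' fun hφ => forall_congr' fun hc => ?_
    rw [inner_ofFun _ (memLp_of_test hφ.continuous hc),
      inner_ofFun _ (memLp_of_test (hφ.continuous_deriv (by simp)) hc.deriv)]
    rfl
  rw [e]
  refine isClosed_iInter fun φ => isClosed_iInter fun _ => isClosed_iInter fun _ =>
    isClosed_eq (by fun_prop) (by fun_prop)

instance : CompleteSpace H1 := isClosed_H1.completeSpace_coe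

/-! ## The continuous representative of an element of `H¹(ℝ)` -/

/-- The function `c · 1_{[0,1]}` as an element of `L²(ℝ)`. -/
def unitCut (c : ℝ → ℝ) : L2 := ofFun (indicator (Icc 0 1) c)

theorem memLp_unitCut {c : ℝ → ℝ} (hc : Continuous c) :
    MemLp (indicator (Icc 0 1) c) 2 (volume : Measure ℝ) := by
  obtain ⟨C, hC⟩ := isCompact_Icc.exists_bound_of_continuousOn (hc.continuousOn (s := Icc 0 1))
  refine memLp_of_bound (M := 1) (C := C)
    (hc.measurable.indicator measurableSet_Icc).aestronglyMeasurable ?_ ?_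
  · intro x hx
    refine indicator_of_notMem (fun h => ?_) _
    rw [abs_of_nonneg h.1] at hx
    exact absurd h.2 (not_le.2 hx)
  · intro x _
    by_cases h : x ∈ Icc (0 : ℝ) 1
    · rw [indicator_of_mem h]
      exact hC x h
    · rw [indicator_of_notMem h, abs_zero]
      exact (norm_nonneg _).trans (hC 0 ⟨le_rfl, zero_le_one⟩)

theorem inner_shift_unitCut (f : L2) {c : ℝ → ℝ} (hc : Continuous c) (x : ℝ) :
    inner ℝ (shift x f) (unitCut c) = ∫ y in Ioc (0 : ℝ) 1, f (x + y) * c y := by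
  rw [unitCut, inner_ofFun _ (memLp_unitCut hc), ← integral_Icc_eq_integral_Ioc,
    ← integral_indicator measurableSet_Icc]
  refine integral_congr_ae ?_
  filter_upwards [shift_coeFn x f] with y hy
  rw [hy]
  by_cases h : y ∈ Icc (0 : ℝ) 1
  · rw [indicator_of_mem h, indicator_of_mem h]
  · rw [indicator_of_notMem h, indicator_of_notMem h, mul_zero]

theorem shift_coeFn' (s : ℝ) (f : L2) : shift s f =ᵐ[volume] fun x => f (x + s) := by
  simpa only [add_comm] using shift_coeFn s f

theorem integral_norm_mul_le (f : L2) {φ : ℝ → ℝ} (hφ : MemLp φ 2 volume) :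
    ∫ x, |f x| * |φ x| ≤ ‖f‖ * ‖ofFun φ‖ := by
  have h := real_inner_le_norm |f| |ofFun φ|
  rw [norm_abs_eq_norm, norm_abs_eq_norm, inner_eq_integral] at h
  refine le_trans (le_of_eq (integral_congr_ae ?_)) h
  filter_upwards [Lp.coeFn_abs f, Lp.coeFn_abs (ofFun φ), ofFun_coeFn hφ] with x h1 h2 h3
  rw [h1, h2, h3]

theorem integrable_shift_mul_prod (f : L2) {c φ : ℝ → ℝ} (hc : Continuous c) (hφ : Continuous φ)
    (hφc : HasCompactSupport φ) :
    Integrable (fun z : ℝ × ℝ => f (z.1 + z.2) * c z.2 * φ z.1)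
      (volume.prod (volume.restrict (Ioc (0 : ℝ) 1))) := by
  have hm : AEStronglyMeasurable (fun z : ℝ × ℝ => f (z.1 + z.2) * c z.2 * φ z.1)
      (volume.prod (volume.restrict (Ioc (0 : ℝ) 1))) := by
    refine StronglyMeasurable.aestronglyMeasurable ?_
    refine StronglyMeasurable.mul (StronglyMeasurable.mul ?_ ?_) ?_
    · exact (Lp.stronglyMeasurable f).comp_measurable (by fun_prop)
    · exact (hc.comp continuous_snd).stronglyMeasurable
    · exact (hφ.comp continuous_fst).stronglyMeasurable
  obtain ⟨C, hC⟩ := isCompact_Icc.exists_bound_of_continuousOn (hc.continuousOn (s := Icc 0 1))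
  have hi : ∀ y, Integrable fun x => f (x + y) * φ x := fun y => by
    refine (integrable_mul_test (shift y f) hφ hφc).congr ?_
    filter_upwards [shift_coeFn' y f] with x hx
    rw [hx]
  rw [integrable_prod_iff' hm]
  constructor
  · refine Eventually.of_forall fun y => ?_
    refine ((hi y).const_mul (c y)).congr (Eventually.of_forall fun x => ?_)
    ring
  · refine Integrable.mono' (g := fun _ => C * (‖f‖ * ‖ofFun φ‖)) (integrable_const _)
      hm.norm.prod_swap.integral_prod_right' ?_
    -- For fixed y, Cauchy–Schwarz and translation invariance bound the integral over x by |c(y)|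
    -- ‖f‖ ‖φ‖, uniformly in y ∈ (0, 1].
    filter_upwards [ae_restrict_mem measurableSet_Ioc] with y hy
    have e : ∫ x, ‖f (x + y) * c y * φ x‖ = |c y| * ∫ x, |shift y f x| * |φ x| := by
      rw [← integral_const_mul]
      refine integral_congr_ae ?_
      filter_upwards [shift_coeFn' y f] with x hx
      rw [hx, norm_mul, norm_mul, Real.norm_eq_abs, Real.norm_eq_abs, Real.norm_eq_abs]
      ring
    have h0 : 0 ≤ ∫ x, |shift y f x| * |φ x| :=
      integral_nonneg fun x => mul_nonneg (abs_nonneg _) (abs_nonneg _)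
    rw [e, Real.norm_of_nonneg (mul_nonneg (abs_nonneg _) h0)]
    have h1 := integral_norm_mul_le (shift y f) (memLp_of_test hφ hφc)
    rw [LinearIsometry.norm_map] at h1
    exact mul_le_mul (hC y ⟨hy.1.le, hy.2⟩) h1 h0
      ((norm_nonneg _).trans (hC y ⟨hy.1.le, hy.2⟩))

theorem integral_inner_shift_unitCut (f : L2) {c φ : ℝ → ℝ} (hc : Continuous c)
    (hφ : Continuous φ) (hφc : HasCompactSupport φ) :
    ∫ x, inner ℝ (shift x f) (unitCut c) * φ x
      = ∫ y in (0 : ℝ)..1, c y * inner ℝ (shift y f) (ofFun φ) := by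
  have e1 : ∀ x, inner ℝ (shift x f) (unitCut c) * φ x
      = ∫ y in Ioc (0 : ℝ) 1, f (x + y) * c y * φ x := fun x => by
    rw [inner_shift_unitCut f hc, integral_mul_const]
  simp only [e1]
  rw [integral_integral_swap (f := fun x y => f (x + y) * c y * φ x)
    (integrable_shift_mul_prod f hc hφ hφc), intervalIntegral.integral_of_le zero_le_one]
  refine integral_congr_ae (Eventually.of_forall fun y => ?_)
  simp only
  rw [inner_ofFun _ (memLp_of_test hφ hφc), ← integral_const_mul]
  refine integral_congr_ae ?_
  filter_upwards [shift_coeFn' y f] with x hx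
  rw [hx]
  ring

/-- The continuous representative of an element of `H¹(ℝ)`, as
`∫₀¹ f(x + y) dy - ∫₀¹ (1 - y) f'(x + y) dy`. -/
def rep (w : H1) (x : ℝ) : ℝ :=
  inner ℝ (shift x (toL2 w)) (unitCut fun _ => 1)
    - inner ℝ (shift x (grad w)) (unitCut fun y => 1 - y)

theorem continuous_rep : Continuous fun z : H1 × ℝ => rep z.1 z.2 := by
  have h1 : Continuous fun z : H1 × ℝ => shift z.2 (toL2 z.1) :=
    continuous_shift.comp (continuous_snd.prodMk (incl.continuous.comp continuous_fst))
  have h2 : Continuous fun z : H1 × ℝ => shift z.2 (grad z.1) :=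
    continuous_shift.comp (continuous_snd.prodMk (grad.continuous.comp continuous_fst))
  have h3 : ∀ k : L2, Continuous fun z : H1 × ℝ => inner ℝ (shift z.2 (toL2 z.1)) k :=
    fun k => h1.inner continuous_const
  have h4 : ∀ k : L2, Continuous fun z : H1 × ℝ => inner ℝ (shift z.2 (grad z.1)) k :=
    fun k => h2.inner continuous_const
  exact (h3 _).sub (h4 _)

theorem continuous_rep_right (w : H1) : Continuous (rep w) := by
  have h : ∀ f k : L2, Continuous fun x => inner ℝ (shift x f) k := fun f k =>
    (continuous_shift_left f).inner continuous_const
  exact (h _ _).sub (h _ _)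

/-- Integrate the derivative of y ↦ (y - 1) ⟨f(· + y), φ⟩ over [0, 1]. The endpoint y = 1
contributes nothing and y = 0 gives ⟨f, φ⟩, so both functions agree against every test function. -/
theorem rep_ae_eq (w : H1) : toL2 w =ᵐ[volume] rep w := by
  have hcont := continuous_rep_right w
  have hli : LocallyIntegrable (toL2 w) volume := (Lp.memLp _).locallyIntegrable (by norm_num)
  refine ae_eq_of_integral_contDiff_smul_eq hli hcont.locallyIntegrable fun φ hφ hφc => ?_
  have hφ' := hφ.continuous
  have c1 : Continuous fun y : ℝ => 1 - y := by fun_prop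
  have hs : ∀ (f : L2) (c : ℝ → ℝ), Continuous c →
      Integrable fun x => inner ℝ (shift x f) (unitCut c) * φ x := fun f c _ =>
    (((continuous_shift_left f).inner continuous_const).mul hφ').integrable_of_hasCompactSupport
      hφc.mul_left
  have e : ∫ x, φ x • rep w x
      = (∫ y in (0 : ℝ)..1, (1 : ℝ) * inner ℝ (shift y (toL2 w)) (ofFun φ))
        - ∫ y in (0 : ℝ)..1, (1 - y) * inner ℝ (shift y (grad w)) (ofFun φ) := by
    rw [← integral_inner_shift_unitCut _ continuous_const hφ' hφc,
      ← integral_inner_shift_unitCut _ c1 hφ' hφc,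
      ← integral_sub (hs _ _ continuous_const) (hs _ _ c1)]
    refine integral_congr_ae (Eventually.of_forall fun x => ?_)
    simp only [rep, smul_eq_mul]
    ring
  have hc0 : ∀ f : L2, Continuous fun y => inner ℝ (shift y f) (ofFun φ) := fun f =>
    (continuous_shift_left f).inner continuous_const
  have hd : ∀ y ∈ uIcc (0 : ℝ) 1,
      HasDerivAt (fun y => (y - 1) * inner ℝ (shift y (toL2 w)) (ofFun φ))
        (1 * inner ℝ (shift y (toL2 w)) (ofFun φ)
          - (1 - y) * inner ℝ (shift y (grad w)) (ofFun φ)) y := by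
    intro y _
    have h1 := ((isWeakDeriv_grad w).hasDerivAt_shift y).inner ℝ (hasDerivAt_const y (ofFun φ))
    refine (((hasDerivAt_id y).sub_const 1).mul h1).congr_deriv ?_
    simp only [id_eq, inner_zero_right, zero_add]
    ring
  have hj1 : Continuous fun y : ℝ => (1 : ℝ) * inner ℝ (shift y (toL2 w)) (ofFun φ) :=
    continuous_const.mul (hc0 _)
  have hj2 : Continuous fun y : ℝ => (1 - y) * inner ℝ (shift y (grad w)) (ofFun φ) :=
    c1.mul (hc0 _)
  have hI := intervalIntegral.integral_eq_sub_of_hasDerivAt hd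
    ((hj1.sub hj2).intervalIntegrable _ _)
  rw [e, ← intervalIntegral.integral_sub (hj1.intervalIntegrable _ _)
    (hj2.intervalIntegrable _ _), hI]
  simp only [shift_zero, sub_self, zero_mul, zero_sub]
  rw [inner_ofFun _ (memLp_of_test hφ' hφc)]
  simp only [smul_eq_mul, mul_comm]
  ring

/-- The embedding of H¹(ℝ) in L^∞(ℝ): Cauchy–Schwarz for the two inner products defining `rep`, each
against a fixed function of norm at most 2. -/
theorem abs_rep_le (w : H1) (x : ℝ) : |rep w x| ≤ 4 * ‖w‖ := by
  have hk : ∀ c : ℝ → ℝ, Continuous c → (∀ y ∈ Icc (0 : ℝ) 1, |c y| ≤ 1) → ‖unitCut c‖ ≤ 2 := by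
    intro c hc h1
    refine (norm_ofFun_le (M := 1) (C := 1)
      (hc.measurable.indicator measurableSet_Icc).aestronglyMeasurable zero_le_one zero_le_one
      ?_ ?_).trans ?_
    · intro x hx
      refine indicator_of_notMem (fun h => ?_) _
      rw [abs_of_nonneg h.1] at hx
      exact absurd h.2 (not_le.2 hx)
    · intro x _
      by_cases h : x ∈ Icc (0 : ℝ) 1
      · rw [indicator_of_mem h]
        exact h1 x h
      · rw [indicator_of_notMem h, abs_zero]
        exact zero_le_one
    · rw [mul_one, mul_one, Real.sqrt_le_left (by norm_num)]
      norm_num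
  have h1 := abs_real_inner_le_norm (shift x (toL2 w)) (unitCut fun _ => 1)
  have h2 := abs_real_inner_le_norm (shift x (grad w)) (unitCut fun y => 1 - y)
  rw [LinearIsometry.norm_map] at h1 h2
  have h3 := hk (fun _ => 1) continuous_const (by simp)
  have h4 := hk (fun y => 1 - y) (by fun_prop) fun y hy => by
    rw [abs_le]
    constructor <;> linarith [hy.1, hy.2]
  have h5 := abs_sub (inner ℝ (shift x (toL2 w)) (unitCut fun _ => 1))
    (inner ℝ (shift x (grad w)) (unitCut fun y => 1 - y))
  have h6 := mul_le_mul (norm_toL2_le w) h3 (norm_nonneg _) (norm_nonneg _)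
  have h7 := mul_le_mul (norm_grad_le w) h4 (norm_nonneg _) (norm_nonneg _)
  rw [rep]
  linarith

/-! ## The nonlinearity -/

/-- The nonlinearity `|w|^p` as an element of `L²(ℝ)`. -/
def absPow (p : ℝ) (w : H1) : L2 := ofFun fun x => |toL2 w x| ^ p

theorem abs_rpow_sub_le {p M a b : ℝ} (hp : 1 < p) (ha : |a| ≤ M) (hb : |b| ≤ M) :
    |(|a| ^ p) - |b| ^ p| ≤ p * M ^ (p - 1) * |a - b| := by
  have h := (convex_Icc (0 : ℝ) M).norm_image_sub_le_of_norm_hasDerivWithin_le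
    (f := fun x => x ^ p) (f' := fun x => p * x ^ (p - 1)) (C := p * M ^ (p - 1))
    (x := |b|) (y := |a|)
    (fun x _ => (Real.hasDerivAt_rpow_const (Or.inr hp.le)).hasDerivWithinAt)
    (fun x hx => by
      rw [Real.norm_of_nonneg (mul_nonneg (by linarith) (Real.rpow_nonneg hx.1 _))]
      exact mul_le_mul_of_nonneg_left (Real.rpow_le_rpow hx.1 hx.2 (by linarith)) (by linarith))
    ⟨abs_nonneg _, hb⟩ ⟨abs_nonneg _, ha⟩
  rw [Real.norm_eq_abs, Real.norm_eq_abs] at h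
  have hM : 0 ≤ M := (abs_nonneg a).trans ha
  exact h.trans (mul_le_mul_of_nonneg_left (abs_abs_sub_abs_le a b)
    (mul_nonneg (by linarith) (Real.rpow_nonneg hM _)))

theorem ae_abs_toL2_le (w : H1) : ∀ᵐ x, |toL2 w x| ≤ 4 * ‖w‖ := by
  filter_upwards [rep_ae_eq w] with x hx
  rw [hx]
  exact abs_rep_le w x

theorem memLp_absPow {p : ℝ} (hp : 1 < p) (w : H1) :
    MemLp (fun x => |toL2 w x| ^ p) 2 volume := by
  refine MemLp.of_le_mul (c := p * (4 * ‖w‖) ^ (p - 1)) (Lp.memLp (toL2 w)) ?_ ?_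
  · exact ((continuous_abs.comp_aestronglyMeasurable
      (Lp.aestronglyMeasurable (toL2 w))).aemeasurable.pow_const p).aestronglyMeasurable
  · filter_upwards [ae_abs_toL2_le w] with x hx
    have h := abs_rpow_sub_le (b := 0) hp hx (by simp)
    rw [abs_zero, Real.zero_rpow (by linarith), sub_zero, sub_zero] at h
    exact h

theorem absPow_coeFn {p : ℝ} (hp : 1 < p) (w : H1) :
    absPow p w =ᵐ[volume] fun x => |toL2 w x| ^ p := ofFun_coeFn (memLp_absPow hp w)

/-- Elements of a ball of H¹ take values in a bounded interval, on which s ↦ |s|^p is Lipschitz. No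
upper bound on p is needed in one space dimension. -/
theorem norm_absPow_sub_le {p M : ℝ} (hp : 1 < p) {w w' : H1} (h : ‖w‖ ≤ M) (h' : ‖w'‖ ≤ M) :
    ‖absPow p w - absPow p w'‖ ≤ p * (4 * M) ^ (p - 1) * ‖w - w'‖ := by
  have hM : 0 ≤ M := (norm_nonneg w).trans h
  have hC : 0 ≤ p * (4 * M) ^ (p - 1) := mul_nonneg (by linarith) (by positivity)
  refine (Lp.norm_le_mul_norm_of_ae_le_mul (g := toL2 w - toL2 w') (c := p * (4 * M) ^ (p - 1))
    ?_).trans (mul_le_mul_of_nonneg_left ?_ hC)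
  · filter_upwards [Lp.coeFn_sub (absPow p w) (absPow p w'), Lp.coeFn_sub (toL2 w) (toL2 w'),
      absPow_coeFn hp w, absPow_coeFn hp w', ae_abs_toL2_le w, ae_abs_toL2_le w']
      with x h1 h2 h3 h4 h5 h6
    rw [h1, h2, Pi.sub_apply, Pi.sub_apply, h3, h4]
    exact abs_rpow_sub_le hp (h5.trans (by linarith)) (h6.trans (by linarith))
  · have e : toL2 w - toL2 w' = toL2 (w - w') := rfl
    rw [e]
    exact norm_toL2_le _

theorem continuous_absPow {p : ℝ} (hp : 1 < p) : Continuous (absPow p) := by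
  rw [continuous_iff_continuousAt]
  intro w
  rw [ContinuousAt, tendsto_iff_norm_sub_tendsto_zero]
  have h1 : ∀ᶠ v in 𝓝 w, ‖absPow p v - absPow p w‖
      ≤ p * (4 * (‖w‖ + 1)) ^ (p - 1) * ‖v - w‖ := by
    filter_upwards [Metric.ball_mem_nhds w one_pos] with v hv
    refine norm_absPow_sub_le hp ?_ (by linarith)
    have := norm_le_norm_add_norm_sub' v w
    rw [Metric.mem_ball, dist_eq_norm] at hv
    linarith
  refine squeeze_zero' (Eventually.of_forall fun _ => norm_nonneg _) h1 ?_
  have h2 : Continuous fun v : H1 => p * (4 * (‖w‖ + 1)) ^ (p - 1) * ‖v - w‖ := by fun_prop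
  simpa using h2.tendsto w

/-! ## The wave group on `H¹(ℝ) × L²(ℝ)` -/

/-- The integral `∫_{-t}^{t} v(· + q) dq`. -/
def shiftIntegral (t : ℝ) : L2 →ₗ[ℝ] L2 where
  toFun v := ∫ q in (-t)..t, shift q v
  map_add' v w := by
    simp only [map_add]
    exact intervalIntegral.integral_add ((continuous_shift_left v).intervalIntegrable _ _)
      ((continuous_shift_left w).intervalIntegrable _ _)
  map_smul' c v := by
    simp only [map_smul, RingHom.id_apply]
    exact intervalIntegral.integral_smul c _

theorem shiftIntegral_apply (t : ℝ) (v : L2) :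
    shiftIntegral t v = ∫ q in (-t)..t, shift q v := rfl

theorem norm_shiftIntegral_le (t : ℝ) (v : L2) : ‖shiftIntegral t v‖ ≤ 2 * |t| * ‖v‖ := by
  have h := intervalIntegral.norm_integral_le_of_norm_le_const (a := -t) (b := t)
    (f := fun q => shift q v) (C := ‖v‖) fun q _ => (LinearIsometry.norm_map _ _).le
  rw [sub_neg_eq_add, ← two_mul, abs_mul, abs_two] at h
  rw [shiftIntegral_apply]
  linarith

theorem hasDerivAt_shiftIntegral (v : L2) (t : ℝ) :
    HasDerivAt (fun t => shiftIntegral t v) (shift t v + shift (-t) v) t := by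
  have hi : ∀ a b : ℝ, IntervalIntegrable (fun q => shift q v) volume a b := fun a b =>
    (continuous_shift_left v).intervalIntegrable a b
  have e : ∀ t, shiftIntegral t v
      = (∫ q in (0 : ℝ)..t, shift q v) - ∫ q in (0 : ℝ)..(-t), shift q v := fun t => by
    rw [intervalIntegral.integral_interval_sub_left (hi _ _) (hi _ _), shiftIntegral_apply]
  simp only [e]
  have h2 := (hasDerivAt_integral_shift v (-t)).scomp t (hasDerivAt_neg t)
  rw [neg_one_smul] at h2
  refine ((hasDerivAt_integral_shift v t).sub h2).congr_deriv ?_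
  rw [sub_neg_eq_add]

theorem shift_shiftIntegral (s t : ℝ) (v : L2) :
    shift s (shiftIntegral t v) = shiftIntegral t (shift s v) := by
  have h1 := (shift s).toContinuousLinearMap.intervalIntegral_comp_comm
    ((continuous_shift_left v).intervalIntegrable (μ := volume) (-t) t)
  simp only [LinearIsometry.coe_toContinuousLinearMap, shift_shift] at h1
  rw [shiftIntegral_apply, shiftIntegral_apply, ← h1]
  simp only [shift_shift, add_comm]

theorem shiftIntegral_neg (t : ℝ) (v : L2) : shiftIntegral (-t) v = -shiftIntegral t v := by
  rw [shiftIntegral_apply, shiftIntegral_apply, neg_neg, intervalIntegral.integral_symm]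

theorem IsWeakDeriv.shiftIntegral_eq {f g : L2} (h : IsWeakDeriv f g) (t : ℝ) :
    shiftIntegral t g = DampedWave.shift t f - DampedWave.shift (-t) f :=
  intervalIntegral.integral_eq_sub_of_hasDerivAt (fun q _ => h.hasDerivAt_shift q)
    ((continuous_shift_left g).intervalIntegrable _ _)

theorem continuous_shiftIntegral : Continuous fun z : ℝ × L2 => shiftIntegral z.1 z.2 := by
  rw [continuous_iff_continuousAt]
  rintro ⟨t₀, v₀⟩
  rw [ContinuousAt, tendsto_iff_norm_sub_tendsto_zero]
  have h1 : ∀ z : ℝ × L2, ‖shiftIntegral z.1 z.2 - shiftIntegral t₀ v₀‖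
      ≤ 2 * |z.1| * ‖z.2 - v₀‖ + ‖shiftIntegral z.1 v₀ - shiftIntegral t₀ v₀‖ := fun z => by
    have e : shiftIntegral z.1 z.2 - shiftIntegral t₀ v₀
        = shiftIntegral z.1 (z.2 - v₀) + (shiftIntegral z.1 v₀ - shiftIntegral t₀ v₀) := by
      rw [map_sub]
      abel
    rw [e]
    exact (norm_add_le _ _).trans (add_le_add_left (norm_shiftIntegral_le _ _) _)
  refine squeeze_zero (fun _ => norm_nonneg _) h1 ?_
  have hc : Continuous fun t => shiftIntegral t v₀ :=
    continuous_iff_continuousAt.2 fun t => (hasDerivAt_shiftIntegral v₀ t).continuousAt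
  have h2 : Continuous fun z : ℝ × L2 =>
      2 * |z.1| * ‖z.2 - v₀‖ + ‖shiftIntegral z.1 v₀ - shiftIntegral t₀ v₀‖ := by
    have := hc.comp (continuous_fst : Continuous fun z : ℝ × L2 => z.1)
    exact (by fun_prop : Continuous fun z : ℝ × L2 => 2 * |z.1| * ‖z.2 - v₀‖).add
      (this.sub continuous_const).norm
  simpa using h2.tendsto (t₀, v₀)

/-- The solution operator of the wave equation `u_tt = u_xx` on `H¹(ℝ) × L²(ℝ)`, given by
d'Alembert's formula. -/
def wave (t : ℝ) (V : H1 × L2) : H1 × L2 :=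
  (H1.mk ((1 / 2 : ℝ) • (shift t (toL2 V.1) + shift (-t) (toL2 V.1))
      + (1 / 2 : ℝ) • shiftIntegral t V.2)
    ((1 / 2 : ℝ) • (shift t (grad V.1) + shift (-t) (grad V.1))
      + (1 / 2 : ℝ) • (shift t V.2 - shift (-t) V.2))
    (((((isWeakDeriv_grad V.1).shift t).add ((isWeakDeriv_grad V.1).shift (-t))).smul _).add
      ((IsWeakDeriv.integral_shift V.2 (-t) t).smul _)),
   (1 / 2 : ℝ) • (shift t (grad V.1) - shift (-t) (grad V.1))
      + (1 / 2 : ℝ) • (shift t V.2 + shift (-t) V.2))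

theorem toL2_wave (t : ℝ) (V : H1 × L2) : toL2 (wave t V).1 =
    (1 / 2 : ℝ) • (shift t (toL2 V.1) + shift (-t) (toL2 V.1))
      + (1 / 2 : ℝ) • shiftIntegral t V.2 := rfl

theorem grad_wave (t : ℝ) (V : H1 × L2) : grad (wave t V).1 =
    (1 / 2 : ℝ) • (shift t (grad V.1) + shift (-t) (grad V.1))
      + (1 / 2 : ℝ) • (shift t V.2 - shift (-t) V.2) := rfl

theorem wave_snd (t : ℝ) (V : H1 × L2) : (wave t V).2 =
    (1 / 2 : ℝ) • (shift t (grad V.1) - shift (-t) (grad V.1))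
      + (1 / 2 : ℝ) • (shift t V.2 + shift (-t) V.2) := rfl

theorem grad_sub (w w' : H1) : grad (w - w') = grad w - grad w' := map_sub grad w w'

theorem toL2_sub (w w' : H1) : toL2 (w - w') = toL2 w - toL2 w' := rfl

theorem toL2_zero : toL2 0 = 0 := rfl

theorem wave_sub (t : ℝ) (V W : H1 × L2) : wave t (V - W) = wave t V - wave t W := by
  refine Prod.ext (H1.ext' ?_ ?_) ?_
  · rw [Prod.fst_sub, toL2_sub, toL2_wave, toL2_wave, toL2_wave, Prod.fst_sub, Prod.snd_sub,
      toL2_sub, map_sub, map_sub, map_sub]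
    module
  · rw [Prod.fst_sub, grad_sub, grad_wave, grad_wave, grad_wave, Prod.fst_sub, Prod.snd_sub,
      grad_sub, map_sub, map_sub, map_sub, map_sub]
    module
  · rw [Prod.snd_sub, wave_snd, wave_snd, wave_snd, Prod.fst_sub, Prod.snd_sub, grad_sub,
      map_sub, map_sub, map_sub, map_sub]
    module

theorem wave_zero (V : H1 × L2) : wave 0 V = V := by
  refine Prod.ext (toL2_injective ?_) ?_
  · rw [toL2_wave, neg_zero, shift_zero, shiftIntegral_apply, neg_zero,
      intervalIntegral.integral_same]
    module
  · rw [wave_snd, neg_zero, shift_zero, shift_zero]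
    module

/-- This special case of the group law is enough to recover V from S(t) V, and so to carry the
blow-up of V over to (u, u_t). -/
theorem wave_neg_wave (t : ℝ) (V : H1 × L2) : wave (-t) (wave t V) = V := by
  -- The integral of f' over the translations from -t to t telescopes, so the first component closes
  -- up in terms of f alone.
  have hJ := (isWeakDeriv_grad V.1).shiftIntegral_eq t
  refine Prod.ext (toL2_injective ?_) ?_
  · rw [toL2_wave, toL2_wave, wave_snd, shiftIntegral_neg]
    simp only [neg_neg, map_add, map_sub, map_smul, shift_shift, shift_shiftIntegral,
      ← shift_shiftIntegral _ t (grad V.1), hJ, add_neg_cancel, neg_add_cancel, shift_zero]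
    module
  · rw [wave_snd, wave_snd, grad_wave]
    simp only [neg_neg, map_add, map_sub, map_smul, shift_shift, add_neg_cancel, neg_add_cancel,
      shift_zero]
    module

theorem _root_.Continuous.shift {X : Type*} [TopologicalSpace X] {a : X → ℝ} {f : X → L2}
    (ha : Continuous a) (hf : Continuous f) : Continuous fun x => shift (a x) (f x) :=
  continuous_shift.comp (ha.prodMk hf)

theorem norm_half_smul_add_le (a b : L2) : ‖(1 / 2 : ℝ) • (a + b)‖ ≤ (‖a‖ + ‖b‖) / 2 := by
  rw [norm_smul, Real.norm_of_nonneg (by norm_num)]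
  linarith [norm_add_le a b]

theorem norm_half_smul_sub_le (a b : L2) : ‖(1 / 2 : ℝ) • (a - b)‖ ≤ (‖a‖ + ‖b‖) / 2 := by
  rw [norm_smul, Real.norm_of_nonneg (by norm_num)]
  linarith [norm_sub_le a b]

/-- The factor |t| comes only from the L² norm of the integrated velocity. The 3 collects one unit
for the translated position and two for its gradient. -/
theorem norm_wave_le (t : ℝ) (V : H1 × L2) : ‖wave t V‖ ≤ (3 + |t|) * ‖V‖ := by
  have h1 : ‖toL2 V.1‖ ≤ ‖V‖ := (norm_toL2_le _).trans (norm_fst_le V)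
  have h2 : ‖grad V.1‖ ≤ ‖V‖ := (norm_grad_le _).trans (norm_fst_le V)
  have h3 : ‖V.2‖ ≤ ‖V‖ := norm_snd_le V
  have h4 := norm_half_smul_add_le (shift t (toL2 V.1)) (shift (-t) (toL2 V.1))
  have h5 := norm_half_smul_add_le (shift t (grad V.1)) (shift (-t) (grad V.1))
  have h6 := norm_half_smul_sub_le (shift t V.2) (shift (-t) V.2)
  have h7 := norm_half_smul_sub_le (shift t (grad V.1)) (shift (-t) (grad V.1))
  have h8 := norm_half_smul_add_le (shift t V.2) (shift (-t) V.2)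
  simp only [LinearIsometry.norm_map] at h4 h5 h6 h7 h8
  have h9 : ‖(1 / 2 : ℝ) • shiftIntegral t V.2‖ ≤ |t| * ‖V‖ := by
    rw [norm_smul, Real.norm_of_nonneg (by norm_num)]
    have := mul_le_mul_of_nonneg_left h3 (abs_nonneg t)
    linarith [norm_shiftIntegral_le t V.2]
  have h0 := mul_nonneg (abs_nonneg t) (norm_nonneg V)
  refine (Prod.norm_def _).le.trans (max_le ((H1.norm_le _).trans ?_) ?_)
  · rw [toL2_wave, grad_wave]
    refine (add_le_add (norm_add_le _ _) (norm_add_le _ _)).trans ?_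
    linarith
  · rw [wave_snd]
    refine (norm_add_le _ _).trans ?_
    linarith [norm_nonneg V]

theorem continuous_wave : Continuous fun z : ℝ × (H1 × L2) => wave z.1 z.2 := by
  have c1 : Continuous fun z : ℝ × (H1 × L2) => toL2 z.2.1 :=
    incl.continuous.comp (continuous_fst.comp continuous_snd)
  have c2 : Continuous fun z : ℝ × (H1 × L2) => grad z.2.1 :=
    grad.continuous.comp (continuous_fst.comp continuous_snd)
  have c3 : Continuous fun z : ℝ × (H1 × L2) => z.2.2 := continuous_snd.comp continuous_snd
  have hs : ∀ {f : ℝ × (H1 × L2) → L2}, Continuous f → Continuous fun z => shift z.1 (f z) :=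
    fun hf => continuous_fst.shift hf
  have hs' : ∀ {f : ℝ × (H1 × L2) → L2}, Continuous f → Continuous fun z => shift (-z.1) (f z) :=
    fun hf => (continuous_neg.comp continuous_fst).shift hf
  have c4 : Continuous fun z : ℝ × (H1 × L2) => shiftIntegral z.1 z.2.2 :=
    continuous_shiftIntegral.comp (continuous_fst.prodMk c3)
  have d1 : Continuous fun z : ℝ × (H1 × L2) => toL2 (wave z.1 z.2).1 :=
    (((hs c1).add (hs' c1)).const_smul (1 / 2 : ℝ)).add (c4.const_smul (1 / 2 : ℝ))
  have d2 : Continuous fun z : ℝ × (H1 × L2) => grad (wave z.1 z.2).1 :=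
    (((hs c2).add (hs' c2)).const_smul (1 / 2 : ℝ)).add
      (((hs c3).sub (hs' c3)).const_smul (1 / 2 : ℝ))
  have d3 : Continuous fun z : ℝ × (H1 × L2) => (wave z.1 z.2).2 :=
    (((hs c2).sub (hs' c2)).const_smul (1 / 2 : ℝ)).add
      (((hs c3).add (hs' c3)).const_smul (1 / 2 : ℝ))
  exact (continuousOn_univ.1 (continuousOn_H1 d1.continuousOn d2.continuousOn)).prodMk d3

/-- Differentiation of `t ↦ B t (y t)` for a strongly continuous family of linear maps. -/
theorem hasDerivWithinAt_family {B : ℝ → L2 →ₗ[ℝ] L2} (hB : Continuous fun z : ℝ × L2 => B z.1 z.2)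
    {y : ℝ → L2} {y' d : L2} {s : Set ℝ} {t₀ : ℝ} (hy : HasDerivWithinAt y y' s t₀)
    (hd : HasDerivAt (fun t => B t (y t₀)) d t₀) :
    HasDerivWithinAt (fun t => B t (y t)) (d + B t₀ y') s t₀ := by
  have h1 := hd.hasDerivWithinAt (s := s)
  rw [hasDerivWithinAt_iff_tendsto_slope] at hy h1 ⊢
  have h2 : Tendsto (fun t => B t (slope y t₀ t)) (𝓝[s \ {t₀}] t₀) (𝓝 (B t₀ y')) := by
    have ht : Tendsto (fun t : ℝ => t) (𝓝[s \ {t₀}] t₀) (𝓝 t₀) := tendsto_id.mono_left inf_le_left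
    exact (hB.tendsto (t₀, y')).comp (ht.prodMk_nhds hy)
  refine (h1.add h2).congr fun t => ?_
  simp only [slope_def_module, map_smul, map_sub]
  module

/-! ## Calculus on `[0, T) × ℝ` -/

theorem isOpen_coe_lt (T : EReal) : IsOpen {t : ℝ | (t : EReal) < T} :=
  isOpen_lt continuous_coe_real_ereal continuous_const

@[simp] theorem timeInterval_top : timeInterval ⊤ = Ici 0 := by
  ext t
  simp [timeInterval, EReal.coe_lt_top]

theorem timeInterval_coe (T : ℝ) : timeInterval T = Ico 0 T := by
  ext t
  simp [timeInterval, EReal.coe_lt_coe_iff]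

theorem timeInterval_mono {T T' : EReal} (h : T ≤ T') : timeInterval T ⊆ timeInterval T' :=
  fun _ ht => ⟨ht.1, ht.2.trans_le h⟩

theorem mem_timeInterval_of_le {T : EReal} {s t : ℝ} (ht : t ∈ timeInterval T) (h0 : 0 ≤ s)
    (h : s ≤ t) : s ∈ timeInterval T :=
  ⟨h0, (EReal.coe_le_coe_iff.2 h).trans_lt ht.2⟩

theorem Icc_subset_timeInterval {T : EReal} {t : ℝ} (ht : t ∈ timeInterval T) :
    Icc 0 t ⊆ timeInterval T := fun _ hs => mem_timeInterval_of_le ht hs.1 hs.2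

theorem zero_mem_timeInterval {T : EReal} (hT : 0 < T) : (0 : ℝ) ∈ timeInterval T :=
  ⟨le_rfl, by exact_mod_cast hT⟩

theorem convex_timeInterval (T : EReal) : Convex ℝ (timeInterval T) := by
  rw [Real.convex_iff_isPreconnected, isPreconnected_iff_ordConnected, ordConnected_iff]
  exact fun x hx y hy _ z hz => mem_timeInterval_of_le hy (hx.1.trans hz.1) hz.2

theorem timeInterval_mem_nhdsWithin {T : EReal} {t : ℝ} (ht : t ∈ timeInterval T) :
    timeInterval T ∈ 𝓝[Ici 0] t :=
  inter_mem self_mem_nhdsWithin (mem_nhdsWithin_of_mem_nhds ((isOpen_coe_lt T).mem_nhds ht.2))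

theorem nhdsWithin_timeInterval {T : EReal} {t : ℝ} (ht : t ∈ timeInterval T) :
    𝓝[timeInterval T] t = 𝓝[Ici 0] t :=
  le_antisymm (nhdsWithin_mono _ fun _ h => h.1)
    (nhdsWithin_le_of_mem (timeInterval_mem_nhdsWithin ht))

theorem timeInterval_mem_nhds {T : EReal} {t : ℝ} (ht : t ∈ timeInterval T) (h0 : 0 < t) :
    timeInterval T ∈ 𝓝 t := by
  have := timeInterval_mem_nhdsWithin ht
  rwa [nhdsWithin_eq_nhds.2 (Ici_mem_nhds h0)] at this

theorem uniqueDiffOn_timeInterval (T : EReal) : UniqueDiffOn ℝ (timeInterval T) :=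
  (uniqueDiffOn_Ici 0).inter (isOpen_coe_lt T)

theorem exists_gt_mem_timeInterval {T : EReal} {t : ℝ} (ht : t ∈ timeInterval T) :
    ∃ t', t < t' ∧ t' ∈ timeInterval T := by
  obtain ⟨t', h1, h2⟩ := EReal.exists_between_coe_real ht.2
  rw [EReal.coe_lt_coe_iff] at h1
  exact ⟨t', h1, ht.1.trans h1.le, h2⟩

theorem hasDerivWithinAt_timeInterval_iff {E : Type*} [NormedAddCommGroup E] [NormedSpace ℝ E]
    {T : EReal} {t : ℝ} (ht : t ∈ timeInterval T) {f : ℝ → E} {f' : E} :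
    HasDerivWithinAt f f' (timeInterval T) t ↔ HasDerivWithinAt f f' (Ici 0) t := by
  rw [HasDerivWithinAt, HasDerivWithinAt, HasDerivAtFilter, HasDerivAtFilter,
    nhdsWithin_timeInterval ht]

/-- The strip `[0, T) × ℝ`. -/
def strip (T : EReal) : Set (ℝ × ℝ) := timeInterval T ×ˢ univ

theorem uniqueDiffOn_strip (T : EReal) : UniqueDiffOn ℝ (strip T) :=
  (uniqueDiffOn_timeInterval T).prod uniqueDiffOn_univ

theorem mem_strip {T : EReal} {t : ℝ} (ht : t ∈ timeInterval T) (x : ℝ) : (t, x) ∈ strip T :=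
  ⟨ht, mem_univ x⟩

/-- `f ∈ Cⁿ([0, T) × ℝ)`. -/
def CnOn (n : WithTop ℕ∞) (T : EReal) (f : ℝ → ℝ → ℝ) : Prop :=
  ContDiffOn ℝ n (fun z : ℝ × ℝ => f z.1 z.2) (strip T)

theorem IsC2.cnOn {f : ℝ → ℝ → ℝ} (h : IsC2 f) : CnOn 2 ⊤ f := by
  rwa [CnOn, strip, timeInterval_top]

section

variable {n : WithTop ℕ∞} {T : EReal} {f g : ℝ → ℝ → ℝ} {t x : ℝ}

theorem CnOn.mono {T' : EReal} (h : CnOn n T f) (hT : T' ≤ T) : CnOn n T' f :=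
  ContDiffOn.mono h (prod_mono_left (timeInterval_mono hT))

theorem CnOn.of_le {m : WithTop ℕ∞} (h : CnOn n T f) (hm : m ≤ n) : CnOn m T f :=
  ContDiffOn.of_le h hm

theorem CnOn.continuousOn (h : CnOn n T f) :
    ContinuousOn (fun z : ℝ × ℝ => f z.1 z.2) (strip T) := ContDiffOn.continuousOn h

theorem CnOn.continuous_right (h : CnOn n T f) (ht : t ∈ timeInterval T) : Continuous (f t) :=
  h.continuousOn.comp_continuous (f := fun x : ℝ => (t, x)) (by fun_prop) fun x => mem_strip ht x

theorem CnOn.hasFDerivWithinAt (h : CnOn 1 T f) (ht : t ∈ timeInterval T) (x : ℝ) :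
    HasFDerivWithinAt (fun z : ℝ × ℝ => f z.1 z.2)
      (fderivWithin ℝ (fun z : ℝ × ℝ => f z.1 z.2) (strip T) (t, x)) (strip T) (t, x) :=
  (ContDiffOn.differentiableOn h one_ne_zero (t, x) (mem_strip ht x)).hasFDerivWithinAt

theorem CnOn.hasDerivWithinAt_aux (h : CnOn 1 T f) (ht : t ∈ timeInterval T) (x : ℝ) :
    HasDerivWithinAt (fun s => f s x)
      (fderivWithin ℝ (fun z : ℝ × ℝ => f z.1 z.2) (strip T) (t, x) (1, 0)) (Ici 0) t := by
  rw [← hasDerivWithinAt_timeInterval_iff ht]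
  exact (h.hasFDerivWithinAt ht x).comp_hasDerivWithinAt (f := fun s : ℝ => (s, x)) t
    ((hasDerivWithinAt_id t _).prodMk (hasDerivWithinAt_const t _ x)) fun s hs => mem_strip hs x

theorem CnOn.hasDerivAt_aux (h : CnOn 1 T f) (ht : t ∈ timeInterval T) (x : ℝ) :
    HasDerivAt (fun y => f t y)
      (fderivWithin ℝ (fun z : ℝ × ℝ => f z.1 z.2) (strip T) (t, x) (0, 1)) x := by
  rw [← hasDerivWithinAt_univ]
  exact (h.hasFDerivWithinAt ht x).comp_hasDerivWithinAt (f := fun y : ℝ => (t, y)) x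
    ((hasDerivWithinAt_const x _ t).prodMk (hasDerivWithinAt_id x _)) fun y _ => mem_strip ht y

theorem dt_eq_of_hasDerivWithinAt {f' : ℝ} (h0 : 0 ≤ t)
    (h : HasDerivWithinAt (fun s => f s x) f' (Ici 0) t) : dt f t x = f' :=
  h.derivWithin (uniqueDiffOn_Ici 0 t h0)

theorem dx_eq_of_hasDerivAt {f' : ℝ} (h : HasDerivAt (fun y => f t y) f' x) : dx f t x = f' :=
  h.deriv

theorem CnOn.dt_eq (h : CnOn 1 T f) (ht : t ∈ timeInterval T) (x : ℝ) :
    dt f t x = fderivWithin ℝ (fun z : ℝ × ℝ => f z.1 z.2) (strip T) (t, x) (1, 0) :=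
  dt_eq_of_hasDerivWithinAt ht.1 (h.hasDerivWithinAt_aux ht x)

theorem CnOn.dx_eq (h : CnOn 1 T f) (ht : t ∈ timeInterval T) (x : ℝ) :
    dx f t x = fderivWithin ℝ (fun z : ℝ × ℝ => f z.1 z.2) (strip T) (t, x) (0, 1) :=
  dx_eq_of_hasDerivAt (h.hasDerivAt_aux ht x)

theorem CnOn.hasDerivWithinAt (h : CnOn 1 T f) (ht : t ∈ timeInterval T) (x : ℝ) :
    HasDerivWithinAt (fun s => f s x) (dt f t x) (Ici 0) t := by
  rw [h.dt_eq ht]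
  exact h.hasDerivWithinAt_aux ht x

theorem CnOn.hasDerivAt (h : CnOn 1 T f) (ht : t ∈ timeInterval T) (x : ℝ) :
    HasDerivAt (fun y => f t y) (dx f t x) x := by
  rw [h.dx_eq ht]
  exact h.hasDerivAt_aux ht x

theorem CnOn.dt (h : CnOn (n + 1) T f) : CnOn n T (dt f) := by
  have h1 : ContDiffOn ℝ n
      (fderivWithin ℝ (fun z : ℝ × ℝ => f z.1 z.2) (strip T)) (strip T) :=
    ContDiffOn.fderivWithin h (uniqueDiffOn_strip T) le_rfl
  refine (h1.clm_apply (contDiffOn_const (c := ((1 : ℝ), (0 : ℝ))))).congr fun z hz => ?_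
  exact (h.of_le (by simp)).dt_eq hz.1 z.2

theorem CnOn.dx (h : CnOn (n + 1) T f) : CnOn n T (dx f) := by
  have h1 : ContDiffOn ℝ n
      (fderivWithin ℝ (fun z : ℝ × ℝ => f z.1 z.2) (strip T)) (strip T) :=
    ContDiffOn.fderivWithin h (uniqueDiffOn_strip T) le_rfl
  refine (h1.clm_apply (contDiffOn_const (c := ((0 : ℝ), (1 : ℝ))))).congr fun z hz => ?_
  exact (h.of_le (by simp)).dx_eq hz.1 z.2

theorem CnOn.dt_two (h : CnOn 2 T f) : CnOn 1 T (DampedWave.dt f) := CnOn.dt (n := 1) h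

theorem CnOn.dx_two (h : CnOn 2 T f) : CnOn 1 T (DampedWave.dx f) := CnOn.dx (n := 1) h

theorem CnOn.dt_one (h : CnOn 1 T f) : CnOn 0 T (DampedWave.dt f) := CnOn.dt (n := 0) h

theorem CnOn.dx_one (h : CnOn 1 T f) : CnOn 0 T (DampedWave.dx f) := CnOn.dx (n := 0) h

theorem CnOn.mul (h : CnOn n T f) (h' : CnOn n T g) : CnOn n T fun t x => f t x * g t x :=
  ContDiffOn.mul h h'

/-- Mixed derivatives commute also on the boundary line t = 0, because the strip lies in the closure
of its interior. -/
theorem CnOn.dx_dt_eq (h : CnOn 2 T f) (ht : t ∈ timeInterval T) (x : ℝ) :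
    DampedWave.dx (DampedWave.dt f) t x = DampedWave.dt (DampedWave.dx f) t x := by
  set F := fun z : ℝ × ℝ => f z.1 z.2 with hF
  have h1 : CnOn 1 T f := h.of_le (by norm_num)
  have hD : ContDiffOn ℝ 1 (fderivWithin ℝ F (strip T)) (strip T) :=
    ContDiffOn.fderivWithin h (uniqueDiffOn_strip T) (by norm_num)
  have hD' := (hD.differentiableOn one_ne_zero (t, x) (mem_strip ht x)).hasFDerivWithinAt
  have hsymm : IsSymmSndFDerivWithinAt ℝ F (strip T) (t, x) := by
    refine ContDiffWithinAt.isSymmSndFDerivWithinAt (n := 2) (h (t, x) (mem_strip ht x)) (by simp)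
      (uniqueDiffOn_strip T) ?_ (mem_strip ht x)
    rw [strip, interior_prod_eq, interior_univ, closure_prod_eq, closure_univ]
    refine ⟨?_, mem_univ _⟩
    obtain ⟨t', htt', ht'⟩ := exists_gt_mem_timeInterval ht
    have h2 : Ioo t t' ⊆ interior (timeInterval T) :=
      interior_maximal (fun s hs => mem_timeInterval_of_le ht' (ht.1.trans hs.1.le) hs.2.le)
        isOpen_Ioo
    refine closure_mono h2 ?_
    rw [closure_Ioo htt'.ne]
    exact ⟨le_rfl, htt'.le⟩
  have e1 : DampedWave.dx (DampedWave.dt f) t x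
      = fderivWithin ℝ (fderivWithin ℝ F (strip T)) (strip T) (t, x) (0, 1) (1, 0) := by
    refine dx_eq_of_hasDerivAt ?_
    have e : (fun y => DampedWave.dt f t y)
        = fun y => fderivWithin ℝ F (strip T) (t, y) (1, 0) := funext fun y => h1.dt_eq ht y
    rw [e, ← hasDerivWithinAt_univ]
    have h3 := hD'.comp_hasDerivWithinAt (f := fun y : ℝ => (t, y)) (s := univ) x
      ((hasDerivWithinAt_const x _ t).prodMk (hasDerivWithinAt_id x _)) fun y _ => mem_strip ht y
    simpa using h3.clm_apply (hasDerivWithinAt_const x univ ((1 : ℝ), (0 : ℝ)))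
  have e2 : DampedWave.dt (DampedWave.dx f) t x
      = fderivWithin ℝ (fderivWithin ℝ F (strip T)) (strip T) (t, x) (1, 0) (0, 1) := by
    refine dt_eq_of_hasDerivWithinAt ht.1 ((hasDerivWithinAt_timeInterval_iff ht).1 ?_)
    have h3 := hD'.comp_hasDerivWithinAt (f := fun s : ℝ => (s, x)) (s := timeInterval T) t
      ((hasDerivWithinAt_id t _).prodMk (hasDerivWithinAt_const t _ x)) fun s hs => mem_strip hs x
    have h4 := h3.clm_apply (hasDerivWithinAt_const t (timeInterval T) ((0 : ℝ), (1 : ℝ)))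
    refine HasDerivWithinAt.congr (f := fun s => fderivWithin ℝ F (strip T) (s, x) (0, 1))
      (by simpa using h4) (fun s hs => h1.dx_eq hs x) (h1.dx_eq ht x)
  rw [e1, e2]
  exact hsymm _ _

end

/-- A function with continuously differentiable partial derivatives. -/
theorem contDiff_succ_of_partial {n : ℕ} {f p q : ℝ → ℝ → ℝ}
    (hp : ∀ t x, HasDerivAt (fun s => f s x) (p t x) t)
    (hq : ∀ t x, HasDerivAt (fun y => f t y) (q t x) x)
    (cp : ContDiff ℝ n fun z : ℝ × ℝ => p z.1 z.2)
    (cq : ContDiff ℝ n fun z : ℝ × ℝ => q z.1 z.2) :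
    ContDiff ℝ (n + 1) fun z : ℝ × ℝ => f z.1 z.2 := by
  have hder : ∀ z : ℝ × ℝ, HasFDerivAt (fun z : ℝ × ℝ => f z.1 z.2)
      (p z.1 z.2 • ContinuousLinearMap.fst ℝ ℝ ℝ + q z.1 z.2 • ContinuousLinearMap.snd ℝ ℝ ℝ) z := by
    intro z
    have h := hasStrictFDerivAt_uncurry_coprod (𝕜 := ℝ) (u := z) (f := f)
      (f₁ := fun t x => ContinuousLinearMap.toSpanSingleton ℝ (p t x))
      (f₂ := fun t x => ContinuousLinearMap.toSpanSingleton ℝ (q t x))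
      (Eventually.of_forall fun v => (hp v.1 v.2).hasFDerivAt)
      (Eventually.of_forall fun v => (hq v.1 v.2).hasFDerivAt)
      (((ContinuousLinearMap.toSpanSingletonCLE (𝕜 := ℝ) (E := ℝ)).continuous.comp
        cp.continuous).continuousAt)
      (((ContinuousLinearMap.toSpanSingletonCLE (𝕜 := ℝ) (E := ℝ)).continuous.comp
        cq.continuous).continuousAt)
    refine h.hasFDerivAt.congr_fderiv ?_
    ext <;> simp [Function.HasUncurry.uncurry]
  rw [contDiff_succ_iff_hasFDerivAt (n := n)]
  refine ⟨_, ?_, hder⟩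
  exact (cp.smul contDiff_const).add (cq.smul contDiff_const)

/-! ## Integration along characteristics -/

/-- `|F(s, x)| ≤ C (1 + s)^{-q}` for `s ≥ 0`. -/
def Decays (q C : ℝ) (F : ℝ → ℝ → ℝ) : Prop := ∀ s, 0 ≤ s → ∀ x, |F s x| ≤ C / (1 + s) ^ q

theorem integrableOn_decay {q t : ℝ} (hq : 1 < q) (ht : 0 ≤ t) (C : ℝ) :
    IntegrableOn (fun s : ℝ => C / (1 + s) ^ q) (Ioi t) := by
  have h : IntegrableOn (fun s : ℝ => C * (s + 1) ^ (-q)) (Ioi t) :=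
    (integrableOn_add_rpow_Ioi_of_lt (a := -q) (c := t) (m := 1) (by linarith)
      (by linarith)).const_mul C
  refine h.congr_fun (fun s hs => ?_) measurableSet_Ioi
  have hs' : 0 < 1 + s := by linarith [mem_Ioi.1 hs]
  simp only
  rw [add_comm s 1, Real.rpow_neg hs'.le, div_eq_mul_inv]

theorem integral_decay {q t : ℝ} (hq : 1 < q) (ht : 0 ≤ t) (C : ℝ) :
    ∫ s in Ioi t, C / (1 + s) ^ q = C / (q - 1) / (1 + t) ^ (q - 1) := by
  have hq' : q - 1 ≠ 0 := by linarith
  have hd : ∀ s ∈ Ici t, HasDerivAt (fun s : ℝ => -(C / (q - 1)) * (1 + s) ^ (-(q - 1)))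
      (C / (1 + s) ^ q) s := by
    intro s hs
    have hs' : 0 < 1 + s := by linarith [mem_Ici.1 hs]
    have h1 := (((hasDerivAt_id s).const_add 1).rpow_const (p := -(q - 1))
      (Or.inl hs'.ne')).const_mul (-(C / (q - 1)))
    refine h1.congr_deriv ?_
    simp only [id_eq]
    rw [show -(q - 1) - 1 = -q by ring, Real.rpow_neg hs'.le]
    field_simp
  have ht' : Tendsto (fun s : ℝ => -(C / (q - 1)) * (1 + s) ^ (-(q - 1))) atTop (𝓝 0) := by
    have h1 : Tendsto (fun s : ℝ => 1 + s) atTop atTop := tendsto_atTop_add_const_left _ _ tendsto_id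
    have h2 := ((tendsto_rpow_neg_atTop (y := q - 1) (by linarith)).comp h1).const_mul
      (-(C / (q - 1)))
    simpa using h2
  rw [integral_Ioi_of_hasDerivAt_of_tendsto' hd (integrableOn_decay hq ht C) ht',
    Real.rpow_neg (by linarith)]
  field_simp
  ring

/-- `∫_t^∞ F(s, ξ + ε s) ds`, written so as to make sense for functions that are only controlled
for positive times. -/
def tailInt (ε : ℝ) (F : ℝ → ℝ → ℝ) (t ξ : ℝ) : ℝ :=
  (∫ s in Ioi (0 : ℝ), F s (ξ + ε * s)) - ∫ s in (0 : ℝ)..t, F s (ξ + ε * s)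

/-- The integral of `F` over the forward characteristic of speed `ε` issued from `(t, x)`. -/
def charInt (ε : ℝ) (F : ℝ → ℝ → ℝ) (t x : ℝ) : ℝ := tailInt ε F t (x - ε * t)

section

variable {ε q C C' : ℝ} {F G : ℝ → ℝ → ℝ}

theorem continuous_along (hF : Continuous fun z : ℝ × ℝ => F z.1 z.2) (ε ξ : ℝ) :
    Continuous fun s => F s (ξ + ε * s) :=
  hF.comp (by fun_prop : Continuous fun s : ℝ => (s, ξ + ε * s))

theorem integrableOn_along (hq : 1 < q) (hF : Continuous fun z : ℝ × ℝ => F z.1 z.2)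
    (hd : Decays q C F) {t : ℝ} (ht : 0 ≤ t) (ε ξ : ℝ) :
    IntegrableOn (fun s => F s (ξ + ε * s)) (Ioi t) := by
  refine Integrable.mono' (integrableOn_decay hq ht C)
    (continuous_along hF ε ξ).aestronglyMeasurable ?_
  filter_upwards [ae_restrict_mem measurableSet_Ioi] with s hs
  exact hd s (ht.trans (mem_Ioi.1 hs).le) _

theorem tailInt_eq (hq : 1 < q) (hF : Continuous fun z : ℝ × ℝ => F z.1 z.2)
    (hd : Decays q C F) {t : ℝ} (ht : 0 ≤ t) (ξ : ℝ) :
    tailInt ε F t ξ = ∫ s in Ioi t, F s (ξ + ε * s) := by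
  rw [tailInt, sub_eq_iff_eq_add, intervalIntegral.integral_of_le ht, add_comm,
    ← setIntegral_union (Ioc_disjoint_Ioi le_rfl) measurableSet_Ioi
      ((continuous_along hF ε ξ).integrableOn_Ioc) (integrableOn_along hq hF hd ht ε ξ),
    Ioc_union_Ioi_eq_Ioi ht]

theorem decays_charInt (hq : 1 < q) (hF : Continuous fun z : ℝ × ℝ => F z.1 z.2)
    (hd : Decays q C F) : Decays (q - 1) (C / (q - 1)) (charInt ε F) := by
  intro t ht x
  rw [charInt, tailInt_eq hq hF hd ht, ← integral_decay hq ht]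
  refine norm_integral_le_of_norm_le (f := fun s => F s (x - ε * t + ε * s))
    (integrableOn_decay hq ht C) ?_
  filter_upwards [ae_restrict_mem measurableSet_Ioi] with s hs
  exact hd s (ht.trans (mem_Ioi.1 hs).le) _

theorem continuous_tailInt (hq : 1 < q) (hF : Continuous fun z : ℝ × ℝ => F z.1 z.2)
    (hd : Decays q C F) : Continuous fun z : ℝ × ℝ => tailInt ε F z.1 z.2 := by
  refine Continuous.sub ?_ ?_
  · refine continuous_of_dominated (μ := volume.restrict (Ioi (0 : ℝ))) (G := ℝ)
      (F := fun (z : ℝ × ℝ) s => F s (z.2 + ε * s))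
      (bound := fun s => C / (1 + s) ^ q)
      (fun z => (continuous_along hF ε z.2).aestronglyMeasurable) (fun z => ?_)
      (integrableOn_decay hq le_rfl C) (Eventually.of_forall fun s => ?_)
    · filter_upwards [ae_restrict_mem measurableSet_Ioi] with s hs
      exact hd s (mem_Ioi.1 hs).le _
    · exact hF.comp (by fun_prop : Continuous fun z : ℝ × ℝ => (s, z.2 + ε * s))
  · exact intervalIntegral.continuous_parametric_intervalIntegral_of_continuous
      (f := fun (z : ℝ × ℝ) s => F s (z.2 + ε * s))
      (hF.comp (by fun_prop : Continuous fun w : (ℝ × ℝ) × ℝ => (w.2, w.1.2 + ε * w.2)))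
      continuous_fst

theorem continuous_charInt (hq : 1 < q) (hF : Continuous fun z : ℝ × ℝ => F z.1 z.2)
    (hd : Decays q C F) : Continuous fun z : ℝ × ℝ => charInt ε F z.1 z.2 :=
  (continuous_tailInt hq hF hd).comp
    (by fun_prop : Continuous fun z : ℝ × ℝ => (z.1, z.2 - ε * z.1))

theorem hasDerivAt_tailInt_left (hF : Continuous fun z : ℝ × ℝ => F z.1 z.2) (t ξ : ℝ) :
    HasDerivAt (fun t => tailInt ε F t ξ) (-F t (ξ + ε * t)) t := by
  have h1 := ((continuous_along hF ε ξ).integral_hasStrictDerivAt 0 t).hasDerivAt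
  exact (h1.const_sub _)

theorem hasDerivAt_tailInt_right (hq : 1 < q) (hF : Continuous fun z : ℝ × ℝ => F z.1 z.2)
    (hG : Continuous fun z : ℝ × ℝ => G z.1 z.2) (hFG : ∀ t x, HasDerivAt (F t) (G t x) x)
    (hd : Decays q C F) (hd' : Decays q C' G) (t ξ : ℝ) :
    HasDerivAt (fun ξ => tailInt ε F t ξ) (tailInt ε G t ξ) ξ := by
  have hdiff : ∀ s ξ, HasDerivAt (fun ξ => F s (ξ + ε * s)) (G s (ξ + ε * s)) ξ := fun s ξ =>
    (hFG s (ξ + ε * s)).comp_add_const ξ (ε * s)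
  refine HasDerivAt.sub ?_ ?_
  · refine (hasDerivAt_integral_of_dominated_loc_of_deriv_le
      (F := fun ξ s => F s (ξ + ε * s)) (F' := fun ξ s => G s (ξ + ε * s))
      (bound := fun s => C' / (1 + s) ^ q) (s := univ) univ_mem
      (Eventually.of_forall fun z => (continuous_along hF ε z).aestronglyMeasurable)
      (integrableOn_along hq hF hd le_rfl ε ξ) (continuous_along hG ε ξ).aestronglyMeasurable
      ?_ (integrableOn_decay hq le_rfl C') (Eventually.of_forall fun s z _ => hdiff s z)).2
    filter_upwards [ae_restrict_mem measurableSet_Ioi] with s hs z _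
    exact hd' s (mem_Ioi.1 hs).le _
  -- Here t may be negative, where decay gives no information. A bound for G on a compact set
  -- dominates the integral over the finite interval instead.
  · obtain ⟨B, hB⟩ := (isCompact_uIcc (a := (0 : ℝ)) (b := t)).prod
      (isCompact_Icc (a := ξ - 1) (b := ξ + 1)) |>.exists_bound_of_continuousOn
      (f := fun z : ℝ × ℝ => G z.1 (z.2 + ε * z.1))
      (hG.comp (by fun_prop : Continuous fun z : ℝ × ℝ => (z.1, z.2 + ε * z.1))).continuousOn
    refine (intervalIntegral.hasDerivAt_integral_of_dominated_loc_of_deriv_le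
      (F := fun ξ s => F s (ξ + ε * s)) (F' := fun ξ s => G s (ξ + ε * s))
      (bound := fun _ => B) (s := Icc (ξ - 1) (ξ + 1))
      (Icc_mem_nhds (by linarith) (by linarith))
      (Eventually.of_forall fun z => (continuous_along hF ε z).aestronglyMeasurable)
      ((continuous_along hF ε ξ).intervalIntegrable _ _)
      (continuous_along hG ε ξ).aestronglyMeasurable
      (Eventually.of_forall fun s hs z hz => hB (s, z) ⟨uIoc_subset_uIcc hs, hz⟩)
      intervalIntegrable_const (Eventually.of_forall fun s _ z _ => hdiff s z)).2

theorem contDiff_tailInt (hq : 1 < q) (hF : Continuous fun z : ℝ × ℝ => F z.1 z.2)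
    (hG : Continuous fun z : ℝ × ℝ => G z.1 z.2) (hFG : ∀ t x, HasDerivAt (F t) (G t x) x)
    (hd : Decays q C F) (hd' : Decays q C' G) :
    ContDiff ℝ 1 fun z : ℝ × ℝ => tailInt ε F z.1 z.2 := by
  refine contDiff_succ_of_partial (n := 0) (p := fun t ξ => -F t (ξ + ε * t))
    (q := fun t ξ => tailInt ε G t ξ) (fun t ξ => hasDerivAt_tailInt_left hF t ξ)
    (fun t ξ => hasDerivAt_tailInt_right hq hF hG hFG hd hd' t ξ) ?_ ?_
  · exact contDiff_zero.2 (hF.comp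
      (by fun_prop : Continuous fun z : ℝ × ℝ => (z.1, z.2 + ε * z.1))).neg
  · exact contDiff_zero.2 (continuous_tailInt hq hG hd')

theorem contDiff_charInt (hq : 1 < q) (hF : Continuous fun z : ℝ × ℝ => F z.1 z.2)
    (hG : Continuous fun z : ℝ × ℝ => G z.1 z.2) (hFG : ∀ t x, HasDerivAt (F t) (G t x) x)
    (hd : Decays q C F) (hd' : Decays q C' G) :
    ContDiff ℝ 1 fun z : ℝ × ℝ => charInt ε F z.1 z.2 :=
  (contDiff_tailInt hq hF hG hFG hd hd').comp
    (contDiff_fst.prodMk (contDiff_snd.sub (contDiff_const.mul contDiff_fst)))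

theorem hasDerivAt_charInt_right (hq : 1 < q) (hF : Continuous fun z : ℝ × ℝ => F z.1 z.2)
    (hG : Continuous fun z : ℝ × ℝ => G z.1 z.2) (hFG : ∀ t x, HasDerivAt (F t) (G t x) x)
    (hd : Decays q C F) (hd' : Decays q C' G) (t x : ℝ) :
    HasDerivAt (fun x => charInt ε F t x) (charInt ε G t x) x :=
  (hasDerivAt_tailInt_right hq hF hG hFG hd hd' t (x - ε * t)).comp_sub_const x (ε * t)

/-- Derivative along the characteristic itself, for a merely continuous integrand. -/
theorem hasDerivAt_charInt_char (hF : Continuous fun z : ℝ × ℝ => F z.1 z.2) (t x s : ℝ) :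
    HasDerivAt (fun s => charInt ε F (t + s) (x + ε * s)) (-F (t + s) (x + ε * s)) s := by
  have h1 := (hasDerivAt_tailInt_left (ε := ε) hF (t + s) (x - ε * t)).comp_const_add t s
  have e : ∀ r, charInt ε F (t + r) (x + ε * r) = tailInt ε F (t + r) (x - ε * t) := fun r => by
    rw [charInt, show x + ε * r - ε * (t + r) = x - ε * t by ring]
  simp only [e]
  rwa [show x - ε * t + ε * (t + s) = x + ε * s by ring] at h1

/-- The value is the transport equation (∂_t + ε ∂_x) I = -F for I = `charInt ε F`. It follows from
the chain rule, `tailInt` being C¹. -/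
theorem hasDerivAt_charInt_left (hq : 1 < q) (hF : Continuous fun z : ℝ × ℝ => F z.1 z.2)
    (hG : Continuous fun z : ℝ × ℝ => G z.1 z.2) (hFG : ∀ t x, HasDerivAt (F t) (G t x) x)
    (hd : Decays q C F) (hd' : Decays q C' G) (t x : ℝ) :
    HasDerivAt (fun t => charInt ε F t x) (-F t x - ε * charInt ε G t x) t := by
  have h0 : HasFDerivAt (fun z : ℝ × ℝ => tailInt ε F z.1 z.2)
      (fderiv ℝ (fun z : ℝ × ℝ => tailInt ε F z.1 z.2) (t, x - ε * t)) (t, x - ε * t) :=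
    ((contDiff_tailInt (ε := ε) hq hF hG hFG hd hd').differentiable one_ne_zero _).hasFDerivAt
  set D := fderiv ℝ (fun z : ℝ × ℝ => tailInt ε F z.1 z.2) (t, x - ε * t)
  have h1 : D (1, 0) = -F t x := by
    have h := (h0.comp_hasDerivAt (f := fun s : ℝ => (s, x - ε * t)) t
      ((hasDerivAt_id t).prodMk (hasDerivAt_const t _))).unique
      (hasDerivAt_tailInt_left hF t (x - ε * t))
    rw [h]
    congr 2
    ring
  have h2 : D (0, 1) = tailInt ε G t (x - ε * t) :=
    (h0.comp_hasDerivAt (f := fun y : ℝ => (t, y)) (x - ε * t)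
      ((hasDerivAt_const _ t).prodMk (hasDerivAt_id _))).unique
      (hasDerivAt_tailInt_right hq hF hG hFG hd hd' t (x - ε * t))
  have h3 := h0.comp_hasDerivAt (f := fun s : ℝ => (s, x - ε * s)) t
    ((hasDerivAt_id t).prodMk (((hasDerivAt_id t).const_mul ε).const_sub x))
  refine h3.congr_deriv ?_
  have e : ((1 : ℝ), -(ε * 1)) = (1 : ℝ) • ((1 : ℝ), (0 : ℝ)) + (-ε) • ((0 : ℝ), (1 : ℝ)) := by
    ext <;> simp
  rw [e, map_add, map_smul, map_smul, h1, h2, charInt]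
  simp only [smul_eq_mul]
  ring

theorem Decays.tendsto (hq : 0 < q) (hd : Decays q C F) (y : ℝ → ℝ) (t : ℝ) :
    Tendsto (fun s => F (t + s) (y s)) atTop (𝓝 0) := by
  have h1 : Tendsto (fun s : ℝ => 1 + (t + s)) atTop atTop :=
    tendsto_atTop_add_const_left _ _ (tendsto_atTop_add_const_left _ _ tendsto_id)
  have h2 : Tendsto (fun s : ℝ => C / (1 + (t + s)) ^ q) atTop (𝓝 0) :=
    ((tendsto_rpow_atTop hq).comp h1).const_div_atTop C
  refine squeeze_zero_norm' ?_ h2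
  filter_upwards [eventually_ge_atTop (-t)] with s hs
  exact hd _ (by linarith) _

/-- The retarded (from `t = ∞`) solution of `h_tt - h_xx = F`. -/
def backwardWave (F : ℝ → ℝ → ℝ) (t x : ℝ) : ℝ := charInt 1 (charInt (-1) F) t x

/-- With G = F_x, the double characteristic integral of G reduces to single integrals of F. Along a
characteristic of speed 1 both sides have derivative -`charInt (-1) G`, so their difference Q is
constant there, and Q decays to 0 at infinity. Since `backwardWave G` is the x-derivative of
`backwardWave F`, this gains a derivative: no time derivative of F is needed for a C² solution. -/
theorem charInt_charInt_eq (hq : 2 < q) (hF : Continuous fun z : ℝ × ℝ => F z.1 z.2)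
    (hG : Continuous fun z : ℝ × ℝ => G z.1 z.2) (hFG : ∀ t x, HasDerivAt (F t) (G t x) x)
    (hd : Decays q C F) (hd' : Decays q C' G) (t x : ℝ) :
    backwardWave G t x = (charInt 1 F t x - charInt (-1) F t x) / 2 := by
  have hq1 : 1 < q := by linarith
  set Q := fun t x => backwardWave G t x - (charInt 1 F t x - charInt (-1) F t x) / 2 with hQ
  have hder : ∀ s, HasDerivAt (fun s => Q (t + s) (x + 1 * s)) 0 s := by
    intro s
    have h1 := hasDerivAt_charInt_char (ε := 1) (continuous_charInt (ε := -1) hq1 hG hd') t x s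
    have h2 := hasDerivAt_charInt_char (ε := 1) hF t x s
    have hc := contDiff_charInt (ε := -1) hq1 hF hG hFG hd hd'
    have h0 : HasFDerivAt (fun z : ℝ × ℝ => charInt (-1) F z.1 z.2)
        (fderiv ℝ (fun z : ℝ × ℝ => charInt (-1) F z.1 z.2) (t + s, x + 1 * s))
        (t + s, x + 1 * s) := (hc.differentiable one_ne_zero _).hasFDerivAt
    set D := fderiv ℝ (fun z : ℝ × ℝ => charInt (-1) F z.1 z.2) (t + s, x + 1 * s)
    have e1 := (h0.comp_hasDerivAt (f := fun r : ℝ => (r, x + 1 * s)) (t + s)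
      ((hasDerivAt_id _).prodMk (hasDerivAt_const _ _))).unique
      (hasDerivAt_charInt_left hq1 hF hG hFG hd hd' (t + s) (x + 1 * s))
    have e2 := (h0.comp_hasDerivAt (f := fun y : ℝ => (t + s, y)) (x + 1 * s)
      ((hasDerivAt_const _ _).prodMk (hasDerivAt_id _))).unique
      (hasDerivAt_charInt_right hq1 hF hG hFG hd hd' (t + s) (x + 1 * s))
    have h3 := h0.comp_hasDerivAt (f := fun s : ℝ => (t + s, x + 1 * s)) s
      (((hasDerivAt_id s).const_add t).prodMk (((hasDerivAt_id s).const_mul 1).const_add x))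
    refine (h1.sub ((h2.sub h3).div_const 2)).congr_deriv ?_
    have e : ((1 : ℝ), (1 : ℝ) * 1) = ((1 : ℝ), (0 : ℝ)) + ((0 : ℝ), (1 : ℝ)) := by
      ext <;> simp
    rw [e, map_add, e1, e2]
    ring
  have hconst : ∀ s, Q (t + s) (x + 1 * s) = Q t x := fun s => by
    have := is_const_of_deriv_eq_zero (fun r => (hder r).differentiableAt)
      (fun r => (hder r).deriv) s 0
    simpa using this
  have hlim : Tendsto (fun s => Q (t + s) (x + 1 * s)) atTop (𝓝 0) := by
    have h1 := (decays_charInt (ε := 1) (by linarith : 1 < q - 1)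
      (continuous_charInt (ε := -1) hq1 hG hd') (decays_charInt hq1 hG hd')).tendsto
      (by linarith) (fun s => x + 1 * s) t
    have h2 := (decays_charInt (ε := 1) hq1 hF hd).tendsto (by linarith) (fun s => x + 1 * s) t
    have h3 := (decays_charInt (ε := -1) hq1 hF hd).tendsto (by linarith) (fun s => x + 1 * s) t
    have h4 := h1.sub ((h2.sub h3).div_const 2)
    rwa [sub_zero, zero_div, sub_zero] at h4
  simp only [hconst] at hlim
  have := tendsto_nhds_unique tendsto_const_nhds hlim
  rw [hQ] at this
  linarith

theorem decays_backwardWave (hq : 2 < q) (hF : Continuous fun z : ℝ × ℝ => F z.1 z.2)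
    (hd : Decays q C F) :
    Decays (q - 1 - 1) (C / (q - 1) / (q - 1 - 1)) (backwardWave F) :=
  decays_charInt (by linarith) (continuous_charInt (by linarith) hF hd)
    (decays_charInt (by linarith) hF hd)

/-- The time derivative of `backwardWave F`. -/
def backwardWaveDt (F : ℝ → ℝ → ℝ) (t x : ℝ) : ℝ := -(charInt 1 F t x + charInt (-1) F t x) / 2

/-- The space derivative of `backwardWave F`. -/
def backwardWaveDx (F : ℝ → ℝ → ℝ) (t x : ℝ) : ℝ := (charInt 1 F t x - charInt (-1) F t x) / 2

theorem Decays.half_combination {F₁ F₂ : ℝ → ℝ → ℝ} (h₁ : Decays q C F₁) (h₂ : Decays q C F₂)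
    (σ : ℝ) (hσ : |σ| = 1) : Decays q C fun t x => (F₁ t x + σ * F₂ t x) / 2 := by
  intro s hs x
  have := abs_add_le (F₁ s x) (σ * F₂ s x)
  rw [abs_mul, hσ, one_mul] at this
  rw [abs_div, abs_two]
  linarith [h₁ s hs x, h₂ s hs x]

theorem decays_backwardWaveDx (hq : 1 < q) (hF : Continuous fun z : ℝ × ℝ => F z.1 z.2)
    (hd : Decays q C F) : Decays (q - 1) (C / (q - 1)) (backwardWaveDx F) := by
  have h := (decays_charInt (ε := 1) hq hF hd).half_combination
    (decays_charInt (ε := -1) hq hF hd) (-1) (by simp)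
  intro s hs x
  have := h s hs x
  simp only at this
  rwa [show charInt 1 F s x + -1 * charInt (-1) F s x = charInt 1 F s x - charInt (-1) F s x by
    ring] at this

theorem decays_backwardWaveDt (hq : 1 < q) (hF : Continuous fun z : ℝ × ℝ => F z.1 z.2)
    (hd : Decays q C F) : Decays (q - 1) (C / (q - 1)) (backwardWaveDt F) := by
  have h := (decays_charInt (ε := 1) hq hF hd).half_combination
    (decays_charInt (ε := -1) hq hF hd) 1 (by simp)
  intro s hs x
  have := h s hs x
  simp only at this
  rw [← abs_neg] at this
  rwa [show -((charInt 1 F s x + 1 * charInt (-1) F s x) / 2)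
    = -(charInt 1 F s x + charInt (-1) F s x) / 2 by ring] at this

theorem hasDerivAt_backwardWave_left (hq : 2 < q) (hF : Continuous fun z : ℝ × ℝ => F z.1 z.2)
    (hG : Continuous fun z : ℝ × ℝ => G z.1 z.2) (hFG : ∀ t x, HasDerivAt (F t) (G t x) x)
    (hd : Decays q C F) (hd' : Decays q C' G) (t x : ℝ) :
    HasDerivAt (fun t => backwardWave F t x) (backwardWaveDt F t x) t := by
  have hq1 : 1 < q := by linarith
  have h := hasDerivAt_charInt_left (ε := 1) (by linarith : 1 < q - 1)
    (continuous_charInt (ε := -1) hq1 hF hd) (continuous_charInt (ε := -1) hq1 hG hd')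
    (hasDerivAt_charInt_right hq1 hF hG hFG hd hd') (decays_charInt hq1 hF hd)
    (decays_charInt hq1 hG hd') t x
  refine h.congr_deriv ?_
  -- The transport equation gives w_t = -`charInt (-1) F` - w_x for w = `backwardWave F`, and w_x =
  -- `backwardWave G` is rewritten by single integrals.
  have e := charInt_charInt_eq hq hF hG hFG hd hd' t x
  rw [backwardWave] at e
  rw [e, backwardWaveDt]
  ring

theorem hasDerivAt_backwardWave_right (hq : 2 < q) (hF : Continuous fun z : ℝ × ℝ => F z.1 z.2)
    (hG : Continuous fun z : ℝ × ℝ => G z.1 z.2) (hFG : ∀ t x, HasDerivAt (F t) (G t x) x)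
    (hd : Decays q C F) (hd' : Decays q C' G) (t x : ℝ) :
    HasDerivAt (fun x => backwardWave F t x) (backwardWaveDx F t x) x := by
  have hq1 : 1 < q := by linarith
  have h := hasDerivAt_charInt_right (ε := 1) (by linarith : 1 < q - 1)
    (continuous_charInt (ε := -1) hq1 hF hd) (continuous_charInt (ε := -1) hq1 hG hd')
    (hasDerivAt_charInt_right hq1 hF hG hFG hd hd') (decays_charInt hq1 hF hd)
    (decays_charInt hq1 hG hd') t x
  refine h.congr_deriv ?_
  exact charInt_charInt_eq hq hF hG hFG hd hd' t x

theorem contDiff_backwardWaveDt (hq : 2 < q) (hF : Continuous fun z : ℝ × ℝ => F z.1 z.2)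
    (hG : Continuous fun z : ℝ × ℝ => G z.1 z.2) (hFG : ∀ t x, HasDerivAt (F t) (G t x) x)
    (hd : Decays q C F) (hd' : Decays q C' G) :
    ContDiff ℝ 1 fun z : ℝ × ℝ => backwardWaveDt F z.1 z.2 :=
  ((contDiff_charInt (by linarith) hF hG hFG hd hd').add
    (contDiff_charInt (by linarith) hF hG hFG hd hd')).neg.div_const 2

theorem contDiff_backwardWaveDx (hq : 2 < q) (hF : Continuous fun z : ℝ × ℝ => F z.1 z.2)
    (hG : Continuous fun z : ℝ × ℝ => G z.1 z.2) (hFG : ∀ t x, HasDerivAt (F t) (G t x) x)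
    (hd : Decays q C F) (hd' : Decays q C' G) :
    ContDiff ℝ 1 fun z : ℝ × ℝ => backwardWaveDx F z.1 z.2 :=
  ((contDiff_charInt (by linarith) hF hG hFG hd hd').sub
    (contDiff_charInt (by linarith) hF hG hFG hd hd')).div_const 2

theorem contDiff_backwardWave (hq : 2 < q) (hF : Continuous fun z : ℝ × ℝ => F z.1 z.2)
    (hG : Continuous fun z : ℝ × ℝ => G z.1 z.2) (hFG : ∀ t x, HasDerivAt (F t) (G t x) x)
    (hd : Decays q C F) (hd' : Decays q C' G) :
    ContDiff ℝ 2 fun z : ℝ × ℝ => backwardWave F z.1 z.2 := by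
  have h := contDiff_succ_of_partial (n := 1)
    (hasDerivAt_backwardWave_left hq hF hG hFG hd hd')
    (hasDerivAt_backwardWave_right hq hF hG hFG hd hd')
    (by exact_mod_cast contDiff_backwardWaveDt hq hF hG hFG hd hd')
    (by exact_mod_cast contDiff_backwardWaveDx hq hF hG hFG hd hd')
  exact h.of_le (by norm_num)

theorem hasDerivAt_backwardWaveDt_left (hq : 2 < q) (hF : Continuous fun z : ℝ × ℝ => F z.1 z.2)
    (hG : Continuous fun z : ℝ × ℝ => G z.1 z.2) (hFG : ∀ t x, HasDerivAt (F t) (G t x) x)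
    (hd : Decays q C F) (hd' : Decays q C' G) (t x : ℝ) :
    HasDerivAt (fun t => backwardWaveDt F t x) (F t x + backwardWaveDx G t x) t := by
  have hq1 : 1 < q := by linarith
  refine (((hasDerivAt_charInt_left hq1 hF hG hFG hd hd' t x).add
    (hasDerivAt_charInt_left hq1 hF hG hFG hd hd' t x)).neg.div_const 2).congr_deriv ?_
  rw [backwardWaveDx]
  ring

theorem hasDerivAt_backwardWaveDx_right (hq : 2 < q) (hF : Continuous fun z : ℝ × ℝ => F z.1 z.2)
    (hG : Continuous fun z : ℝ × ℝ => G z.1 z.2) (hFG : ∀ t x, HasDerivAt (F t) (G t x) x)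
    (hd : Decays q C F) (hd' : Decays q C' G) (t x : ℝ) :
    HasDerivAt (fun x => backwardWaveDx F t x) (backwardWaveDx G t x) x := by
  have hq1 : 1 < q := by linarith
  exact ((hasDerivAt_charInt_right hq1 hF hG hFG hd hd' t x).sub
    (hasDerivAt_charInt_right hq1 hF hG hFG hd hd' t x)).div_const 2

end

/-! ## Existence of the corrector -/

section

variable {ε q q' C C' : ℝ} {F F' G G' : ℝ → ℝ → ℝ}

theorem Decays.add (h : Decays q C F) (h' : Decays q C' G) :
    Decays q (C + C') fun t x => F t x + G t x := fun s hs x => by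
  rw [add_div]
  exact (abs_add_le _ _).trans (add_le_add (h s hs x) (h' s hs x))

theorem Decays.mul (h : Decays q C F) (h' : Decays q' C' G) :
    Decays (q + q') (C * C') fun t x => F t x * G t x := fun s hs x => by
  have h1 : 0 < 1 + s := by linarith
  rw [abs_mul, Real.rpow_add h1, ← div_mul_div_comm]
  exact mul_le_mul (h s hs x) (h' s hs x) (abs_nonneg _) ((abs_nonneg _).trans (h s hs x))

theorem Decays.nonneg (h : Decays q C F) : 0 ≤ C := by
  have := (abs_nonneg _).trans (h 0 le_rfl 0)
  simpa using this

theorem Decays.weaken (h : Decays q C F) (hq : q' ≤ q) (hC : C ≤ C') : Decays q' C' F :=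
  fun s hs x => by
    have h1 : 1 ≤ 1 + s := by linarith
    exact (h s hs x).trans (div_le_div₀ (h.nonneg.trans hC) hC (by positivity)
      (Real.rpow_le_rpow_of_exponent_le h1 hq))

theorem charInt_sub (hq : 1 < q) (hF : Continuous fun z : ℝ × ℝ => F z.1 z.2)
    (hF' : Continuous fun z : ℝ × ℝ => F' z.1 z.2) (hd : Decays q C F) (hd' : Decays q C' F')
    (t x : ℝ) : charInt ε (fun t x => F t x - F' t x) t x = charInt ε F t x - charInt ε F' t x := by
  rw [charInt, charInt, charInt, tailInt, tailInt, tailInt,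
    integral_sub (integrableOn_along hq hF hd le_rfl _ _)
      (integrableOn_along hq hF' hd' le_rfl _ _),
    intervalIntegral.integral_sub ((continuous_along hF _ _).intervalIntegrable _ _)
      ((continuous_along hF' _ _).intervalIntegrable _ _)]
  ring

theorem backwardWaveDt_sub (hq : 1 < q) (hF : Continuous fun z : ℝ × ℝ => F z.1 z.2)
    (hF' : Continuous fun z : ℝ × ℝ => F' z.1 z.2) (hd : Decays q C F) (hd' : Decays q C' F')
    (t x : ℝ) : backwardWaveDt (fun t x => F t x - F' t x) t x
      = backwardWaveDt F t x - backwardWaveDt F' t x := by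
  rw [backwardWaveDt, backwardWaveDt, backwardWaveDt, charInt_sub hq hF hF' hd hd',
    charInt_sub hq hF hF' hd hd']
  ring

theorem backwardWave_sub (hq : 2 < q) (hF : Continuous fun z : ℝ × ℝ => F z.1 z.2)
    (hF' : Continuous fun z : ℝ × ℝ => F' z.1 z.2) (hd : Decays q C F) (hd' : Decays q C' F')
    (t x : ℝ) : backwardWave (fun t x => F t x - F' t x) t x
      = backwardWave F t x - backwardWave F' t x := by
  have hq1 : 1 < q := by linarith
  rw [backwardWave, backwardWave, backwardWave, ← charInt_sub (by linarith : 1 < q - 1)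
    (continuous_charInt hq1 hF hd) (continuous_charInt hq1 hF' hd') (decays_charInt hq1 hF hd)
    (decays_charInt hq1 hF' hd')]
  congr 1
  funext s y
  exact charInt_sub hq1 hF hF' hd hd' s y

end

/-- Coefficients `b`, `b_x`, `c`, `c_x` of the equation `h_tt - h_xx = b h_t + c (1 + h)`. -/
structure Coeffs (k δ : ℝ) (b b₁ c c₁ : ℝ → ℝ → ℝ) : Prop where
  cont_b : ContinuousOn (fun z : ℝ × ℝ => b z.1 z.2) (strip ⊤)
  cont_b₁ : ContinuousOn (fun z : ℝ × ℝ => b₁ z.1 z.2) (strip ⊤)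
  cont_c : ContinuousOn (fun z : ℝ × ℝ => c z.1 z.2) (strip ⊤)
  cont_c₁ : ContinuousOn (fun z : ℝ × ℝ => c₁ z.1 z.2) (strip ⊤)
  deriv_b : ∀ t, 0 ≤ t → ∀ x, HasDerivAt (b t) (b₁ t x) x
  deriv_c : ∀ t, 0 ≤ t → ∀ x, HasDerivAt (c t) (c₁ t x) x
  decays_b : Decays k δ b
  decays_b₁ : Decays k δ b₁
  decays_c : Decays (k + 1) (2 * δ) c
  decays_c₁ : Decays (k + 1) (2 * δ) c₁

theorem coeffs_of_decayBound {k δ : ℝ} {b : ℝ → ℝ → ℝ} (hb : IsC2 b) (hd : DecayBound k δ b) :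
    Coeffs k δ b (dx b) (fun t x => b t x / (1 + t) + dt b t x)
      (fun t x => dx b t x / (1 + t) + dt (dx b) t x) := by
  have h2 := hb.cnOn
  have h1 : CnOn 1 ⊤ b := h2.of_le (by norm_num)
  have hm : ∀ {t : ℝ}, 0 ≤ t → t ∈ timeInterval ⊤ := fun ht => by simpa using ht
  have hne : ∀ z ∈ strip ⊤, 1 + z.1 ≠ 0 := fun z hz => by
    have : 0 ≤ z.1 := hz.1.1
    linarith
  have hcont : ContinuousOn (fun z : ℝ × ℝ => 1 + z.1) (strip ⊤) := by fun_prop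
  have hdiv : ∀ {f : ℝ → ℝ → ℝ}, Decays k δ f →
      Decays (k + 1) δ fun t x => f t x / (1 + t) := fun {f} hf s hs x => by
    have hs' : 0 < 1 + s := by linarith
    rw [abs_div, abs_of_pos hs', Real.rpow_add hs', Real.rpow_one, ← div_div]
    exact div_le_div_of_nonneg_right (hf s hs x) hs'.le
  have d0 : Decays k δ b := fun s hs x => (hd s x hs).1
  have d1 : Decays k δ (dx b) := fun s hs x => (hd s x hs).2.1
  have d2 : Decays (k + 1) δ (dt b) := fun s hs x => (hd s x hs).2.2.1
  have d3 : Decays (k + 1) δ (dt (dx b)) := fun s hs x => (hd s x hs).2.2.2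
  refine ⟨h2.continuousOn, h1.dx_one.continuousOn,
    (h2.continuousOn.div hcont hne).add h1.dt_one.continuousOn,
    (h1.dx_one.continuousOn.div hcont hne).add h2.dx_two.dt_one.continuousOn,
    fun t ht x => h1.hasDerivAt (hm ht) x, fun t ht x => ?_, d0, d1, ?_, ?_⟩
  · refine ((h1.hasDerivAt (hm ht) x).div_const _).add ?_
    -- The hypothesis controls ∂_t ∂_x b, while differentiating c in x produces ∂_x ∂_t b.
    rw [← h2.dx_dt_eq (hm ht)]
    exact h2.dt_two.hasDerivAt (hm ht) x
  · exact ((hdiv d0).add d2).weaken le_rfl (by linarith)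
  · exact ((hdiv d1).add d3).weaken le_rfl (by linarith)

/-- Bounded continuous functions on the plane. -/
abbrev Plane : Type := BoundedContinuousFunction (ℝ × ℝ) ℝ

/-- Division by the weight `(1 + t⁺)^q`. -/
def unweight (q : ℝ) (f : Plane) (t x : ℝ) : ℝ := f (t, x) / (1 + max t 0) ^ q

open Classical in
/-- Multiplication by the weight `(1 + t)^q`, the resulting function being constant in
time for `t < 0`. -/
def reweight (q : ℝ) (u : ℝ → ℝ → ℝ) : Plane :=
  if h : Continuous (fun z : ℝ × ℝ => (1 + max z.1 0) ^ q * u (max z.1 0) z.2) ∧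
      ∃ C, ∀ z : ℝ × ℝ, ‖(1 + max z.1 0) ^ q * u (max z.1 0) z.2‖ ≤ C
  then BoundedContinuousFunction.ofNormedAddCommGroup _ h.1 h.2.choose h.2.choose_spec else 0

section

variable {q C : ℝ} {u : ℝ → ℝ → ℝ}

theorem weight_pos (q t : ℝ) : 0 < (1 + max t 0) ^ q :=
  Real.rpow_pos_of_pos (by linarith [le_max_right t 0]) q

theorem continuous_weight (q : ℝ) : Continuous fun z : ℝ × ℝ => (1 + max z.1 0) ^ q := by
  have h : Continuous fun z : ℝ × ℝ => 1 + max z.1 0 := by fun_prop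
  exact h.rpow_const fun z => Or.inl (by linarith [le_max_right z.1 0])

theorem continuous_unweight (q : ℝ) (f : Plane) :
    Continuous fun z : ℝ × ℝ => unweight q f z.1 z.2 :=
  f.continuous.div (continuous_weight q) fun z => (weight_pos q z.1).ne'

theorem decays_unweight (q : ℝ) (f : Plane) : Decays q ‖f‖ (unweight q f) := fun s hs x => by
  rw [unweight, max_eq_left hs, abs_div, abs_of_pos (by positivity : 0 < (1 + s) ^ q)]
  exact div_le_div_of_nonneg_right (f.norm_coe_le_norm (s, x)) (by positivity)

theorem Decays.norm_weight_mul_le (hd : Decays q C u) (z : ℝ × ℝ) :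
    ‖(1 + max z.1 0) ^ q * u (max z.1 0) z.2‖ ≤ C := by
  have h := hd _ (le_max_right z.1 0) z.2
  rw [norm_mul, Real.norm_of_nonneg (weight_pos q z.1).le, mul_comm]
  exact (le_div_iff₀ (weight_pos q z.1)).1 h

theorem reweight_apply (hu : ContinuousOn (fun z : ℝ × ℝ => u z.1 z.2) (strip ⊤))
    (hd : Decays q C u) (z : ℝ × ℝ) :
    reweight q u z = (1 + max z.1 0) ^ q * u (max z.1 0) z.2 := by
  have h1 : Continuous fun z : ℝ × ℝ => u (max z.1 0) z.2 :=
    hu.comp_continuous (f := fun z : ℝ × ℝ => (max z.1 0, z.2)) (by fun_prop) fun z =>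
      mem_strip (by simp) z.2
  rw [reweight, dif_pos ⟨(continuous_weight q).mul h1, C, hd.norm_weight_mul_le⟩]
  rfl

theorem unweight_reweight (hu : ContinuousOn (fun z : ℝ × ℝ => u z.1 z.2) (strip ⊤))
    (hd : Decays q C u) (t x : ℝ) : unweight q (reweight q u) t x = u (max t 0) x := by
  rw [unweight, reweight_apply hu hd]
  exact mul_div_cancel_left₀ _ (weight_pos q t).ne'

theorem unweight_sub (q : ℝ) (f g : Plane) :
    unweight q (f - g) = fun t x => unweight q f t x - unweight q g t x := by
  funext t x
  rw [unweight, unweight, unweight, BoundedContinuousFunction.sub_apply, sub_div]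

end

/-! ### The fixed point for the source of the corrector equation -/

section

variable {k δ : ℝ} {b b₁ c c₁ : ℝ → ℝ → ℝ}

/-- The right-hand side `b h_t + c h`, where `h` solves the wave equation with source `F`. -/
def linSource (b c F : ℝ → ℝ → ℝ) (t x : ℝ) : ℝ :=
  b t x * backwardWaveDt F t x + c t x * backwardWave F t x

/-- If F decays with exponent k + 1, then h_t decays with exponent k and h with exponent k - 1. Both
products b h_t and c h decay with exponent 2k ≥ k + 1, so the weight is reproduced. The two summands
of 1 + 2/(k - 1) come from b h_t and from c h, using 1/k ≤ 1. -/
theorem decays_linSource (hk : 1 < k) (hb : Decays k δ b) (hc : Decays (k + 1) (2 * δ) c)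
    {F : ℝ → ℝ → ℝ} {N : ℝ} (hF : Continuous fun z : ℝ × ℝ => F z.1 z.2)
    (hd : Decays (k + 1) N F) :
    Decays (k + 1) (δ * (1 + 2 / (k - 1)) * N) (linSource b c F) := by
  have hN := hd.nonneg
  have hδ := hb.nonneg
  have hk0 : 0 < k - 1 := by linarith
  have h1 := hb.mul (decays_backwardWaveDt (by linarith) hF hd)
  have h2 := hc.mul (decays_backwardWave (by linarith) hF hd)
  have e : k + 1 - 1 = k := by ring
  rw [e] at h1 h2
  have a1 : N / k ≤ N := div_le_self hN hk.le
  have h1' := h1.weaken (q' := k + 1) (by linarith) (mul_le_mul_of_nonneg_left a1 hδ)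
  have h2' := h2.weaken (q' := k + 1) (C' := 2 * δ * (N / (k - 1))) (by linarith)
    (mul_le_mul_of_nonneg_left (div_le_div_of_nonneg_right a1 hk0.le) (by linarith))
  refine (h1'.add h2').weaken le_rfl (le_of_eq ?_)
  field_simp

theorem continuousOn_linSource (hk : 1 < k)
    (hb : ContinuousOn (fun z : ℝ × ℝ => b z.1 z.2) (strip ⊤))
    (hc : ContinuousOn (fun z : ℝ × ℝ => c z.1 z.2) (strip ⊤))
    {F : ℝ → ℝ → ℝ} {N : ℝ} (hF : Continuous fun z : ℝ × ℝ => F z.1 z.2)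
    (hd : Decays (k + 1) N F) :
    ContinuousOn (fun z : ℝ × ℝ => linSource b c F z.1 z.2) (strip ⊤) := by
  have hq : 1 < k + 1 := by linarith
  have h1 : Continuous fun z : ℝ × ℝ => backwardWaveDt F z.1 z.2 :=
    ((continuous_charInt hq hF hd).add (continuous_charInt hq hF hd)).neg.div_const 2
  have h2 : Continuous fun z : ℝ × ℝ => backwardWave F z.1 z.2 :=
    continuous_charInt (by linarith : 1 < k + 1 - 1) (continuous_charInt hq hF hd)
      (decays_charInt hq hF hd)
  exact (hb.mul h1.continuousOn).add (hc.mul h2.continuousOn)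

theorem linSource_sub (hk : 1 < k) {F F' : ℝ → ℝ → ℝ} {N N' : ℝ}
    (hF : Continuous fun z : ℝ × ℝ => F z.1 z.2) (hF' : Continuous fun z : ℝ × ℝ => F' z.1 z.2)
    (hd : Decays (k + 1) N F) (hd' : Decays (k + 1) N' F') (t x : ℝ) :
    linSource b c (fun t x => F t x - F' t x) t x
      = linSource b c F t x - linSource b c F' t x := by
  rw [linSource, linSource, linSource, backwardWaveDt_sub (by linarith) hF hF' hd hd',
    backwardWave_sub (by linarith) hF hF' hd hd']
  ring

/-- The source of the corrector equation and its space derivative, in terms of the previous ones. -/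
def sourceMap (k : ℝ) (b b₁ c c₁ : ℝ → ℝ → ℝ) (f : Plane × Plane) : Plane × Plane :=
  (reweight (k + 1) fun t x => linSource b c (unweight (k + 1) f.1) t x + c t x,
   reweight (k + 1) fun t x => linSource b₁ c₁ (unweight (k + 1) f.1) t x
    + linSource b c (unweight (k + 1) f.2) t x + c₁ t x)

theorem Coeffs.decays_fst (hco : Coeffs k δ b b₁ c c₁) (hk : 1 < k) (f : Plane) :
    Decays (k + 1) (δ * (1 + 2 / (k - 1)) * ‖f‖ + 2 * δ)
      fun t x => linSource b c (unweight (k + 1) f) t x + c t x :=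
  (decays_linSource hk hco.decays_b hco.decays_c (continuous_unweight _ f)
    (decays_unweight _ f)).add hco.decays_c

theorem Coeffs.decays_snd (hco : Coeffs k δ b b₁ c c₁) (hk : 1 < k) (f g : Plane) :
    Decays (k + 1) (δ * (1 + 2 / (k - 1)) * ‖f‖ + δ * (1 + 2 / (k - 1)) * ‖g‖ + 2 * δ)
      fun t x => linSource b₁ c₁ (unweight (k + 1) f) t x
        + linSource b c (unweight (k + 1) g) t x + c₁ t x :=
  ((decays_linSource hk hco.decays_b₁ hco.decays_c₁ (continuous_unweight _ f)
    (decays_unweight _ f)).add (decays_linSource hk hco.decays_b hco.decays_c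
      (continuous_unweight _ g) (decays_unweight _ g))).add hco.decays_c₁

theorem Coeffs.continuousOn_fst (hco : Coeffs k δ b b₁ c c₁) (hk : 1 < k) (f : Plane) :
    ContinuousOn (fun z : ℝ × ℝ => linSource b c (unweight (k + 1) f) z.1 z.2 + c z.1 z.2)
      (strip ⊤) :=
  (continuousOn_linSource hk hco.cont_b hco.cont_c (continuous_unweight _ f)
    (decays_unweight _ f)).add hco.cont_c

theorem Coeffs.continuousOn_snd (hco : Coeffs k δ b b₁ c c₁) (hk : 1 < k) (f g : Plane) :
    ContinuousOn (fun z : ℝ × ℝ => linSource b₁ c₁ (unweight (k + 1) f) z.1 z.2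
        + linSource b c (unweight (k + 1) g) z.1 z.2 + c₁ z.1 z.2) (strip ⊤) :=
  ((continuousOn_linSource hk hco.cont_b₁ hco.cont_c₁ (continuous_unweight _ f)
    (decays_unweight _ f)).add (continuousOn_linSource hk hco.cont_b hco.cont_c
      (continuous_unweight _ g) (decays_unweight _ g))).add hco.cont_c₁

/-- One application of `linSource` contracts by 1/4. The component for F_x contains two of them, b_x
h_t + c_x h and b h_{tx} + c h_x, whence the factor 1/2. -/
theorem Coeffs.contracting (hco : Coeffs k δ b b₁ c c₁) (hk : 1 < k) (hδ : δ * (1 + 2 / (k - 1)) ≤ 1 / 4) :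
    ContractingWith (1 / 2) (sourceMap k b b₁ c c₁) := by
  refine ⟨by rw [← NNReal.coe_lt_coe]; norm_num, LipschitzWith.of_dist_le_mul fun f g => ?_⟩
  have hn : 0 ≤ dist f g := dist_nonneg
  have n1 : ‖f.1 - g.1‖ ≤ dist f g := by
    rw [← dist_eq_norm, Prod.dist_eq]
    exact le_max_left _ _
  have n2 : ‖f.2 - g.2‖ ≤ dist f g := by
    rw [← dist_eq_norm, Prod.dist_eq]
    exact le_max_right _ _
  have hbd : ∀ (a b : ℝ → ℝ → ℝ), Decays k δ a → Decays (k + 1) (2 * δ) b → ∀ u v : Plane,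
      ‖u - v‖ ≤ dist f g → ∀ t, 0 ≤ t → ∀ x, (1 + t) ^ (k + 1) *
      |linSource a b (unweight (k + 1) u) t x - linSource a b (unweight (k + 1) v) t x|
        ≤ 1 / 4 * dist f g := by
    intro a b ha hb u v huv t ht x
    have h := decays_linSource hk ha hb (continuous_unweight (k + 1) (u - v))
      (decays_unweight _ (u - v)) t ht x
    rw [unweight_sub, linSource_sub hk (continuous_unweight _ u) (continuous_unweight _ v)
      (decays_unweight _ u) (decays_unweight _ v)] at h
    rw [mul_comm, ← le_div_iff₀ (by positivity)]
    refine h.trans (div_le_div_of_nonneg_right ?_ (by positivity))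
    exact mul_le_mul hδ huv (norm_nonneg _) (by norm_num)
  rw [Prod.dist_eq]
  have e : (((1 / 2 : NNReal) : ℝ)) * dist f g = 1 / 2 * dist f g := by norm_num
  rw [e]
  refine max_le ?_ ?_
  · refine (BoundedContinuousFunction.dist_le (by positivity)).2 fun z => ?_
    rw [sourceMap, sourceMap, reweight_apply (hco.continuousOn_fst hk _) (hco.decays_fst hk _),
      reweight_apply (hco.continuousOn_fst hk _) (hco.decays_fst hk _), Real.dist_eq, ← mul_sub,
      abs_mul, abs_of_pos (weight_pos _ _), add_sub_add_right_eq_sub]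
    have := hbd b c hco.decays_b hco.decays_c f.1 g.1 n1 _ (le_max_right z.1 0) z.2
    linarith
  · refine (BoundedContinuousFunction.dist_le (by positivity)).2 fun z => ?_
    rw [sourceMap, sourceMap, reweight_apply (hco.continuousOn_snd hk _ _) (hco.decays_snd hk _ _),
      reweight_apply (hco.continuousOn_snd hk _ _) (hco.decays_snd hk _ _), Real.dist_eq, ← mul_sub,
      abs_mul, abs_of_pos (weight_pos _ _), add_sub_add_right_eq_sub, add_sub_add_comm]
    have h1 := hbd b₁ c₁ hco.decays_b₁ hco.decays_c₁ f.1 g.1 n1 _ (le_max_right z.1 0) z.2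
    have h2 := hbd b c hco.decays_b hco.decays_c f.2 g.2 n2 _ (le_max_right z.1 0) z.2
    refine (mul_le_mul_of_nonneg_left (abs_add_le _ _) (weight_pos _ _).le).trans ?_
    rw [mul_add]
    linarith

/-- The product rule together with the fact that characteristic integration commutes with ∂_x: the
relation "second component = x-derivative of the first" is preserved by the iteration. -/
theorem Coeffs.hasDerivAt_sourceMap (hco : Coeffs k δ b b₁ c c₁) (hk : 1 < k) {f : Plane × Plane}
    (hf : ∀ t x, HasDerivAt (unweight (k + 1) f.1 t) (unweight (k + 1) f.2 t x) x) (t x : ℝ) :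
    HasDerivAt (unweight (k + 1) (sourceMap k b b₁ c c₁ f).1 t)
      (unweight (k + 1) (sourceMap k b b₁ c c₁ f).2 t x) x := by
  have e1 : unweight (k + 1) (sourceMap k b b₁ c c₁ f).1 t
      = fun x => linSource b c (unweight (k + 1) f.1) (max t 0) x + c (max t 0) x := by
    funext x
    exact unweight_reweight (hco.continuousOn_fst hk _) (hco.decays_fst hk _) t x
  rw [e1, sourceMap, unweight_reweight (hco.continuousOn_snd hk _ _) (hco.decays_snd hk _ _)]
  have ht : 0 ≤ max t 0 := le_max_right _ _
  have hq : 2 < k + 1 := by linarith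
  have c1 := continuous_unweight (k + 1) f.1
  have c2 := continuous_unweight (k + 1) f.2
  have d1 := decays_unweight (k + 1) f.1
  have d2 := decays_unweight (k + 1) f.2
  have hdt : HasDerivAt (fun x => backwardWaveDt (unweight (k + 1) f.1) (max t 0) x)
      (backwardWaveDt (unweight (k + 1) f.2) (max t 0) x) x :=
    ((hasDerivAt_charInt_right (by linarith) c1 c2 hf d1 d2 _ x).add
      (hasDerivAt_charInt_right (by linarith) c1 c2 hf d1 d2 _ x)).neg.div_const 2
  have hw : HasDerivAt (fun x => backwardWave (unweight (k + 1) f.1) (max t 0) x)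
      (backwardWave (unweight (k + 1) f.2) (max t 0) x) x := by
    rw [charInt_charInt_eq hq c1 c2 hf d1 d2]
    exact hasDerivAt_backwardWave_right hq c1 c2 hf d1 d2 _ x
  refine (((hco.deriv_b _ ht x).mul hdt).add ((hco.deriv_c _ ht x).mul hw)).add
    (hco.deriv_c _ ht x) |>.congr_deriv ?_
  simp only [linSource]
  ring

/-- The fixed point equation alone does not say that the second component is the x-derivative of the
first. The Picard iterates from 0 satisfy this relation and converge uniformly in both components,
so the limit inherits it. -/
theorem Coeffs.exists_source (hco : Coeffs k δ b b₁ c c₁) (hk : 1 < k) (hδ : δ * (1 + 2 / (k - 1)) ≤ 1 / 4) :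
    ∃ F G : ℝ → ℝ → ℝ, (Continuous fun z : ℝ × ℝ => F z.1 z.2) ∧
      (Continuous fun z : ℝ × ℝ => G z.1 z.2) ∧ (∀ t x, HasDerivAt (F t) (G t x) x) ∧
      Decays (k + 1) (4 * δ) F ∧ (∃ C, Decays (k + 1) C G) ∧
      ∀ t, 0 ≤ t → ∀ x, F t x = b t x * backwardWaveDt F t x + c t x * (1 + backwardWave F t x) := by
  have hK := hco.contracting hk hδ
  set Φ := sourceMap k b b₁ c c₁ with hΦ
  set f := ContractingWith.fixedPoint Φ hK with hf
  have hfix : Φ f = f := hK.fixedPoint_isFixedPt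
  have hit : ∀ n t x, HasDerivAt (unweight (k + 1) (Φ^[n] 0).1 t)
      (unweight (k + 1) (Φ^[n] 0).2 t x) x := by
    intro n
    induction n with
    | zero =>
      intro t x
      have e : unweight (k + 1) (0 : Plane) = fun _ _ => 0 := by
        funext t x
        simp [unweight]
      simp only [Function.iterate_zero, id_eq, Prod.fst_zero, Prod.snd_zero, e]
      exact hasDerivAt_const _ _
    | succ n ih =>
      rw [Function.iterate_succ_apply']
      exact hco.hasDerivAt_sourceMap hk ih
  have hlim : Tendsto (fun n => Φ^[n] 0) atTop (𝓝 f) := hK.tendsto_iterate_fixedPoint 0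
  have hFG : ∀ t x, HasDerivAt (unweight (k + 1) f.1 t) (unweight (k + 1) f.2 t x) x := by
    intro t x
    have hw := weight_pos (k + 1) t
    have key : HasDerivAt (fun x => f.1 (t, x)) (f.2 (t, x)) x := by
      refine hasDerivAt_of_tendstoUniformly (l := atTop)
        (f := fun (n : ℕ) x => (Φ^[n] 0).1 (t, x)) (f' := fun (n : ℕ) x => (Φ^[n] 0).2 (t, x))
        (g' := fun x => f.2 (t, x)) ?_ (Eventually.of_forall fun n x => ?_) (fun x => ?_) x
      · have h1 := BoundedContinuousFunction.tendsto_iff_tendstoUniformly.1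
          ((continuous_snd.tendsto f).comp hlim)
        exact h1.comp fun x : ℝ => (t, x)
      · have h2 := (hit n t x).mul_const ((1 + max t 0) ^ (k + 1))
        simp only [unweight] at h2
        simpa only [div_mul_cancel₀ _ hw.ne'] using h2
      · have h1 := BoundedContinuousFunction.tendsto_iff_tendstoUniformly.1
          ((continuous_fst.tendsto f).comp hlim)
        exact h1.tendsto_at (t, x)
    exact key.div_const _
  have e1 : ∀ t x, unweight (k + 1) f.1 t x
      = linSource b c (unweight (k + 1) f.1) (max t 0) x + c (max t 0) x := by
    intro t x
    have := congrArg Prod.fst hfix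
    conv_lhs => rw [← this]
    exact unweight_reweight (hco.continuousOn_fst hk _) (hco.decays_fst hk _) t x
  -- The fixed point equation gives ‖F‖ ≤ ‖F‖/4 + 2δ, hence ‖F‖ ≤ 8δ/3.
  have hnorm : ‖f.1‖ ≤ 4 * δ := by
    have h1 : ‖f.1‖ ≤ δ * (1 + 2 / (k - 1)) * ‖f.1‖ + 2 * δ := by
      have := congrArg Prod.fst hfix
      conv_lhs => rw [← this]
      have hd := hco.decays_fst hk f.1
      refine (BoundedContinuousFunction.norm_le hd.nonneg).2 fun z => ?_
      rw [hΦ, sourceMap, reweight_apply (hco.continuousOn_fst hk _) hd]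
      exact hd.norm_weight_mul_le z
    have h2 := mul_le_mul_of_nonneg_right hδ (norm_nonneg f.1)
    have h3 := hco.decays_b.nonneg
    linarith [norm_nonneg f.1]
  refine ⟨unweight (k + 1) f.1, unweight (k + 1) f.2, continuous_unweight _ _,
    continuous_unweight _ _, hFG, (decays_unweight _ f.1).weaken le_rfl hnorm,
    ⟨_, decays_unweight _ f.2⟩, fun t ht x => ?_⟩
  rw [e1, max_eq_left ht, linSource]
  ring

end

theorem exists_isCorrector {θ k δ : ℝ} {b : ℝ → ℝ → ℝ} (hk : 1 < k)
    (hδ : δ * (1 + 2 / (k - 1)) ≤ 1 / 4) (hδ' : 4 * δ / (k * (k - 1)) ≤ θ) (hb : IsC2 b)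
    (hd : DecayBound k δ b) : ∃ h, IsCorrector θ k b h := by
  obtain ⟨F, G, cF, cG, hFG, dF, ⟨C, dG⟩, heq⟩ := (coeffs_of_decayBound hb hd).exists_source hk hδ
  have hq : 2 < k + 1 := by linarith
  have hδ0 : 0 ≤ 4 * δ := dF.nonneg
  have e1 : ∀ t, 0 ≤ t → ∀ x, dt (backwardWave F) t x = backwardWaveDt F t x := fun t ht x =>
    dt_eq_of_hasDerivWithinAt ht
      (hasDerivAt_backwardWave_left hq cF cG hFG dF dG t x).hasDerivWithinAt
  have e2 : ∀ t x, dx (backwardWave F) t x = backwardWaveDx F t x := fun t x =>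
    dx_eq_of_hasDerivAt (hasDerivAt_backwardWave_right hq cF cG hFG dF dG t x)
  have eq1 : k + 1 - 1 = k := by ring
  refine ⟨backwardWave F, (contDiff_backwardWave hq cF cG hFG dF dG).contDiffOn, ?_, ?_, ?_⟩
  · intro t x ht
    have h1 : dt (dt (backwardWave F)) t x = F t x + backwardWaveDx G t x :=
      dt_eq_of_hasDerivWithinAt ht ((hasDerivAt_backwardWaveDt_left hq cF cG hFG dF dG t
        x).hasDerivWithinAt.congr (fun s hs => e1 s hs x) (e1 t ht x))
    have h2 : dx (dx (backwardWave F)) t x = backwardWaveDx G t x := by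
      refine dx_eq_of_hasDerivAt ?_
      simp only [e2]
      exact hasDerivAt_backwardWaveDx_right hq cF cG hFG dF dG t x
    have h3 := heq t ht x
    rw [h1, h2, e1 t ht, h3]
    ring
  · intro t x ht
    have h := decays_backwardWave hq cF dF t ht x
    rw [eq1, div_div (4 * δ)] at h
    exact h.trans (div_le_div_of_nonneg_right hδ' (by positivity))
  -- Only δ ≥ 0 is known here, and the constant must be strictly positive.
  · refine ⟨4 * δ / k + 1, by positivity, fun t x ht => ?_⟩
    rw [e1 t ht, e2]
    have h1 := decays_backwardWaveDt (by linarith) cF dF t ht x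
    have h2 := decays_backwardWaveDx (by linarith) cF dF t ht x
    rw [eq1] at h1 h2
    have h3 : 4 * δ / k / (1 + t) ^ k ≤ (4 * δ / k + 1) / (1 + t) ^ k :=
      div_le_div_of_nonneg_right (by linarith) (by positivity)
    exact ⟨h1.trans h3, h2.trans h3⟩

/-! ## Test functions -/

/-- `ψ` vanishes on `[0, T) × ℝ` outside `[0, T₁] × [-M, M]`. -/
def SuppIn (T : EReal) (T₁ M : ℝ) (ψ : ℝ → ℝ → ℝ) : Prop :=
  ∀ t ∈ timeInterval T, ∀ x, T₁ < t ∨ M < |x| → ψ t x = 0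

theorem exists_ge_of_isCompact {T : EReal} (hT : 0 < T) {K : Set ℝ} (hK : IsCompact K)
    (hKT : K ⊆ timeInterval T) : ∃ T₁ ∈ timeInterval T, ∀ t ∈ K, t ≤ T₁ := by
  obtain ⟨T₁, h1, h2⟩ := (hK.insert 0).exists_isGreatest (insert_nonempty 0 K)
  refine ⟨T₁, ?_, fun t ht => h2 (mem_insert_of_mem _ ht)⟩
  rcases h1 with rfl | h1
  · exact zero_mem_timeInterval hT
  · exact hKT h1

section

variable {T : EReal} {T₁ M : ℝ} {ψ : ℝ → ℝ → ℝ}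

theorem IsTestFunction.cnOn (h : IsTestFunction T ψ) : CnOn 2 T ψ := h.1

theorem IsTestFunction.exists_suppIn (hT : 0 < T) (h : IsTestFunction T ψ) :
    ∃ T₁ ∈ timeInterval T, ∃ M, 0 ≤ M ∧ SuppIn T T₁ M ψ := by
  obtain ⟨-, K, hK, hKT, h0⟩ := h
  obtain ⟨T₁, hT₁, h1⟩ := exists_ge_of_isCompact hT (hK.image continuous_fst) (by
    rintro _ ⟨z, hz, rfl⟩
    exact (hKT hz).1)
  obtain ⟨M, hM⟩ := (hK.image continuous_snd).isBounded.exists_norm_le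
  refine ⟨T₁, hT₁, |M|, abs_nonneg M, fun t ht x hx => h0 t x ht fun hmem => ?_⟩
  rcases hx with hx | hx
  · exact absurd (h1 t ⟨_, hmem, rfl⟩) (not_le.2 hx)
  · exact absurd ((hM x ⟨_, hmem, rfl⟩).trans (le_abs_self M)) (not_le.2 hx)

theorem SuppIn.isTestFunction (h : SuppIn T T₁ M ψ) (hT₁ : T₁ ∈ timeInterval T)
    (hψ : CnOn 2 T ψ) : IsTestFunction T ψ := by
  refine ⟨hψ, Icc 0 T₁ ×ˢ Icc (-M) M, isCompact_Icc.prod isCompact_Icc,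
    prod_mono (Icc_subset_timeInterval hT₁) (subset_univ _), fun t x ht hx => h t ht x ?_⟩
  by_contra hcon
  rw [not_or, not_lt, not_lt] at hcon
  exact hx ⟨⟨ht.1, hcon.1⟩, abs_le.1 hcon.2⟩

theorem SuppIn.dt (h : SuppIn T T₁ M ψ) : SuppIn T T₁ M (dt ψ) := by
  intro t ht x hx
  have hev : (fun s => ψ s x) =ᶠ[𝓝[Ici 0] t] fun _ => 0 := by
    rcases hx with hx | hx
    · filter_upwards [timeInterval_mem_nhdsWithin ht, mem_nhdsWithin_of_mem_nhds (Ioi_mem_nhds hx)]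
        with s h1 h2 using h s h1 x (Or.inl h2)
    · filter_upwards [timeInterval_mem_nhdsWithin ht] with s h1 using h s h1 x (Or.inr hx)
  rw [DampedWave.dt, hev.derivWithin_eq (h t ht x hx)]
  simp

theorem SuppIn.dx (h : SuppIn T T₁ M ψ) : SuppIn T T₁ M (dx ψ) := by
  intro t ht x hx
  have hev : (fun y => ψ t y) =ᶠ[𝓝 x] fun _ => 0 := by
    rcases hx with hx | hx
    · exact Eventually.of_forall fun y => h t ht y (Or.inl hx)
    · have : {y : ℝ | M < |y|} ∈ 𝓝 x := (isOpen_lt continuous_const continuous_abs).mem_nhds hx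
      filter_upwards [this] with y hy using h t ht y (Or.inr hy)
  rw [DampedWave.dx, hev.deriv_eq]
  simp

theorem SuppIn.mul_left (h : SuppIn T T₁ M ψ) (a : ℝ → ℝ → ℝ) :
    SuppIn T T₁ M fun t x => a t x * ψ t x := fun t ht x hx => by
  simp only [h t ht x hx, mul_zero]

theorem SuppIn.memLp (h : SuppIn T T₁ M ψ) (hψ : CnOn 0 T ψ) {t : ℝ} (ht : t ∈ timeInterval T) :
    MemLp (ψ t) 2 volume :=
  memLp_of_continuous (hψ.continuous_right ht) fun x hx => h t ht x (Or.inr hx)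

theorem SuppIn.hasCompactSupport (h : SuppIn T T₁ M ψ) {t : ℝ} (ht : t ∈ timeInterval T) :
    HasCompactSupport (ψ t) :=
  HasCompactSupport.intro (K := Icc (-M) M) isCompact_Icc fun x hx => h t ht x (Or.inr (by
    rwa [mem_Icc, ← abs_le, not_le] at hx))

theorem SuppIn.ofFun_eq_zero (h : SuppIn T T₁ M ψ) {t : ℝ} (ht : t ∈ timeInterval T)
    (hT : T₁ < t) : ofFun (ψ t) = 0 := by
  have e : ψ t = fun _ => 0 := funext fun x => h t ht x (Or.inl hT)
  rw [e]
  refine (eq_ofFun ?_).symm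
  filter_upwards [Lp.coeFn_zero ℝ 2 (volume : Measure ℝ)] with x hx
  rw [hx, Pi.zero_apply]

theorem SuppIn.continuousOn_ofFun (h : SuppIn T T₁ M ψ) (hM : 0 ≤ M) (hψ : CnOn 0 T ψ) :
    ContinuousOn (fun t => ofFun (ψ t)) (timeInterval T) :=
  DampedWave.continuousOn_ofFun hM hψ.continuousOn fun t ht x hx => h t ht x (Or.inr hx)

theorem SuppIn.hasDerivWithinAt_ofFun (h : SuppIn T T₁ M ψ) (hM : 0 ≤ M) (hψ : CnOn 1 T ψ)
    {t : ℝ} (ht : t ∈ timeInterval T) :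
    HasDerivWithinAt (fun t => ofFun (ψ t)) (ofFun (DampedWave.dt ψ t)) (timeInterval T) t :=
  DampedWave.hasDerivWithinAt_ofFun hM (convex_timeInterval T)
    (fun _ ht x => (hasDerivWithinAt_timeInterval_iff ht).2 (hψ.hasDerivWithinAt ht x))
    (fun _ ht => hψ.continuous_right ht) hψ.dt_one.continuousOn
    (fun t ht x hx => h t ht x (Or.inr hx)) (fun t ht x hx => h.dt t ht x (Or.inr hx)) ht

theorem CnOn.contDiff_right {n : WithTop ℕ∞} (h : CnOn n T ψ) {t : ℝ} (ht : t ∈ timeInterval T) :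
    ContDiff ℝ n (ψ t) := by
  rw [← contDiffOn_univ]
  exact ContDiffOn.comp (g := fun z : ℝ × ℝ => ψ z.1 z.2) (f := fun x : ℝ => (t, x)) h
    (contDiff_const.prodMk contDiff_id).contDiffOn fun x _ => mem_strip ht x

theorem SuppIn.inner_grad (h : SuppIn T T₁ M ψ) (hψ : CnOn 1 T ψ) {t : ℝ}
    (ht : t ∈ timeInterval T) (w : H1) :
    inner ℝ (grad w) (ofFun (ψ t)) = -inner ℝ (toL2 w) (ofFun (DampedWave.dx ψ t)) := by
  rw [inner_ofFun _ (h.memLp (hψ.of_le zero_le_one) ht), inner_ofFun _ (h.dx.memLp hψ.dx_one ht)]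
  have := (isWeakDeriv_grad w).integral_mul_deriv (hψ.contDiff_right ht) (h.hasCompactSupport ht)
  rw [show (∫ x, toL2 w x * DampedWave.dx ψ t x) = ∫ x, toL2 w x * deriv (ψ t) x from rfl, this,
    neg_neg]

/-- The fundamental theorem of calculus for functions vanishing near the end of `[0, T)`. -/
theorem integral_timeInterval_eq {Y Y' : ℝ → ℝ} (hT₁ : T₁ ∈ timeInterval T)
    (hd : ∀ t ∈ timeInterval T, HasDerivWithinAt Y (Y' t) (timeInterval T) t)
    (hc : ContinuousOn Y' (timeInterval T))
    (h0 : ∀ t ∈ timeInterval T, T₁ < t → Y t = 0 ∧ Y' t = 0) :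
    ∫ t in timeInterval T, Y' t = -Y 0 := by
  obtain ⟨T₂, h12, hT₂⟩ := exists_gt_mem_timeInterval hT₁
  have hsub := Icc_subset_timeInterval hT₂
  have e1 : ∫ t in timeInterval T, Y' t = ∫ t in Icc 0 T₂, Y' t :=
    (setIntegral_eq_of_subset_of_forall_sdiff_eq_zero
      (measurableSet_Ici.inter (isOpen_coe_lt T).measurableSet) hsub fun t ht =>
      (h0 t ht.1 (h12.trans (not_le.1 fun hle => ht.2 ⟨ht.1.1, hle⟩))).2)
  rw [e1, integral_Icc_eq_integral_Ioc, ← intervalIntegral.integral_of_le hT₂.1,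
    intervalIntegral.integral_eq_sub_of_hasDerivAt_of_le hT₂.1
      (fun t ht => ((hd t (hsub ht)).mono hsub).continuousWithinAt)
      (fun t ht => (hd t (hsub (Ioo_subset_Icc_self ht))).hasDerivAt
        (timeInterval_mem_nhds (hsub (Ioo_subset_Icc_self ht)) ht.1))
      ((hc.mono hsub).intervalIntegrable_of_Icc hT₂.1), (h0 T₂ hT₂ h12).1, zero_sub]

end

/-! ## The linear wave equation with a source -/

section

variable {T : EReal} {f : ℝ → L2} {V : ℝ → H1 × L2}

/-- `V(t) = S(-t) (u, u_t)(t)` for the solution `u` of `u_tt - u_xx = f`, where `S` is the wave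
group. -/
def LinearFlow (T : EReal) (f : ℝ → L2) (V : ℝ → H1 × L2) : Prop :=
  ∀ t ∈ timeInterval T, HasDerivWithinAt V (wave (-t) (0, f t)) (timeInterval T) t

theorem LinearFlow.toL2_deriv (h : LinearFlow T f V) {t : ℝ} (ht : t ∈ timeInterval T) :
    HasDerivWithinAt (fun t => toL2 (V t).1) (-((1 / 2 : ℝ) • shiftIntegral t (f t)))
      (timeInterval T) t := by
  have h1 := (incl.comp (ContinuousLinearMap.fst ℝ H1 L2)).hasFDerivAt.comp_hasDerivWithinAt t
    (h t ht)
  refine h1.congr_deriv ?_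
  change toL2 (wave (-t) (0, f t)).1 = _
  rw [toL2_wave, shiftIntegral_neg, toL2_zero, map_zero, map_zero]
  module

theorem LinearFlow.grad_deriv (h : LinearFlow T f V) {t : ℝ} (ht : t ∈ timeInterval T) :
    HasDerivWithinAt (fun t => grad (V t).1) ((1 / 2 : ℝ) • (shift (-t) (f t) - shift t (f t)))
      (timeInterval T) t := by
  have h1 := (grad.comp (ContinuousLinearMap.fst ℝ H1 L2)).hasFDerivAt.comp_hasDerivWithinAt t
    (h t ht)
  refine h1.congr_deriv ?_
  change grad (wave (-t) (0, f t)).1 = _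
  rw [grad_wave, map_zero, map_zero, map_zero, neg_neg]
  module

theorem LinearFlow.snd_deriv (h : LinearFlow T f V) {t : ℝ} (ht : t ∈ timeInterval T) :
    HasDerivWithinAt (fun t => (V t).2) ((1 / 2 : ℝ) • (shift (-t) (f t) + shift t (f t)))
      (timeInterval T) t := by
  have h1 := (ContinuousLinearMap.snd ℝ H1 L2).hasFDerivAt.comp_hasDerivWithinAt t (h t ht)
  refine h1.congr_deriv ?_
  change (wave (-t) (0, f t)).2 = _
  rw [wave_snd, map_zero, map_zero, map_zero, neg_neg]
  module

theorem _root_.ContinuousOn.wave {X : Type*} [TopologicalSpace X] {s : Set X} {a : X → ℝ}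
    {W : X → H1 × L2} (ha : ContinuousOn a s) (hW : ContinuousOn W s) :
    ContinuousOn (fun x => wave (a x) (W x)) s := by
  have h := ha.prodMk hW
  have h' := Continuous.comp_continuousOn' (f := fun x => (a x, W x)) continuous_wave h
  exact h'

theorem LinearFlow.continuousOn (h : LinearFlow T f V) :
    ContinuousOn (fun t => wave t (V t)) (timeInterval T) := by
  have h1 : ContinuousOn V (timeInterval T) := fun t ht => (h t ht).continuousWithinAt
  exact continuousOn_id.wave h1

theorem hasDerivWithinAt_shift {y : ℝ → L2} {y' d : L2} {s : Set ℝ} {t₀ : ℝ}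
    (hy : HasDerivWithinAt y y' s t₀) (hd : HasDerivAt (fun t => shift t (y t₀)) d t₀) :
    HasDerivWithinAt (fun t => shift t (y t)) (d + shift t₀ y') s t₀ :=
  hasDerivWithinAt_family (B := fun t => (shift t).toLinearMap) continuous_shift hy hd

theorem hasDerivWithinAt_shift_neg {y : ℝ → L2} {y' d : L2} {s : Set ℝ} {t₀ : ℝ}
    (hy : HasDerivWithinAt y y' s t₀) (hd : HasDerivAt (fun t => shift t (y t₀)) d (-t₀)) :
    HasDerivWithinAt (fun t => shift (-t) (y t)) (-d + shift (-t₀) y') s t₀ := by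
  refine hasDerivWithinAt_family (B := fun t => (shift (-t)).toLinearMap)
    ((continuous_neg.comp continuous_fst).shift continuous_snd) hy ?_
  have := hd.scomp t₀ (hasDerivAt_neg t₀)
  rwa [neg_one_smul] at this

/-- Differentiating S(t) V(t) gives two terms. The one with V' has first component zero, since S(t)
S(-t)(0, f) = (0, f), and the derivative of the group alone yields the second component of S(t) V.
-/
theorem LinearFlow.memX (h : LinearFlow T f V) :
    MemX T (fun t => (wave t (V t)).1) fun t => (wave t (V t)).2 := by
  refine ⟨continuous_fst.comp_continuousOn h.continuousOn, fun t ht => ?_,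
    continuous_snd.comp_continuousOn h.continuousOn⟩
  have hw := isWeakDeriv_grad (V t).1
  have h1 := hasDerivWithinAt_shift (h.toL2_deriv ht) (hw.hasDerivAt_shift t)
  have h2 := hasDerivWithinAt_shift_neg (h.toL2_deriv ht) (hw.hasDerivAt_shift (-t))
  have h3 := hasDerivWithinAt_family continuous_shiftIntegral (h.snd_deriv ht)
    (hasDerivAt_shiftIntegral (V t).2 t)
  refine (((h1.add h2).const_smul (1 / 2 : ℝ)).add (h3.const_smul (1 / 2 : ℝ))).congr_deriv ?_
  simp only [wave_snd, map_neg, map_smul, map_add, shift_shiftIntegral]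
  module

/-- For Y(t) = ⟨u_t, ψ⟩ - ⟨u, ψ_t⟩ one has Y' = ⟨f, ψ⟩ - ⟨u, ψ_tt - ψ_xx⟩, and Y vanishes for late
times. Integrating Y' over [0, T) gives the identity. -/
theorem LinearFlow.weak (h : LinearFlow T f V) (hT : 0 < T) (hf : ContinuousOn f (timeInterval T))
    {ψ : ℝ → ℝ → ℝ} (hψ : IsTestFunction T ψ) :
    ∫ t in timeInterval T, inner ℝ (toL2 (wave t (V t)).1)
        (ofFun fun x => dt (dt ψ) t x - dx (dx ψ) t x)
      = inner ℝ (V 0).2 (ofFun (ψ 0)) - inner ℝ (toL2 (V 0).1) (ofFun (dt ψ 0))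
        + ∫ t in timeInterval T, inner ℝ (f t) (ofFun (ψ t)) := by
  obtain ⟨T₁, hT₁, M, hM, hs⟩ := hψ.exists_suppIn hT
  have c2 : CnOn 2 T ψ := hψ.cnOn
  have c1 : CnOn 1 T ψ := c2.of_le (by norm_num)
  have c0 : CnOn 0 T ψ := c1.of_le (by norm_num)
  have hu := h.memX
  have hcu : ContinuousOn (fun t => toL2 (wave t (V t)).1) (timeInterval T) :=
    fun t ht => (hu.hasDeriv t ht).continuousWithinAt
  have kψ := hs.continuousOn_ofFun hM c0
  have kψt := hs.dt.continuousOn_ofFun hM c1.dt_one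
  have ktt := hs.dt.dt.continuousOn_ofFun hM c2.dt_two.dt_one
  have kxx := hs.dx.dx.continuousOn_ofFun hM c2.dx_two.dx_one
  have e0 : ∀ t ∈ timeInterval T, (ofFun fun x => dt (dt ψ) t x - dx (dx ψ) t x)
      = ofFun (dt (dt ψ) t) - ofFun (dx (dx ψ) t) := fun t ht =>
    ofFun_sub (hs.dt.dt.memLp c2.dt_two.dt_one ht) (hs.dx.dx.memLp c2.dx_two.dx_one ht)
  set Y := fun t => inner ℝ (wave t (V t)).2 (ofFun (ψ t))
    - inner ℝ (toL2 (wave t (V t)).1) (ofFun (dt ψ t)) with hY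
  set Y' := fun t => inner ℝ (f t) (ofFun (ψ t)) - inner ℝ (toL2 (wave t (V t)).1)
    (ofFun (dt (dt ψ) t) - ofFun (dx (dx ψ) t)) with hY'
  have hder : ∀ t ∈ timeInterval T, HasDerivWithinAt Y (Y' t) (timeInterval T) t := by
    intro t ht
    have hφ := hs.hasDerivWithinAt_ofFun hM c1 ht
    have hsh := hasDerivAt_shift_ofFun (c1.contDiff_right ht) (hs.hasCompactSupport ht)
    have h1 := hasDerivWithinAt_shift hφ (hsh t)
    have h2 := hasDerivWithinAt_shift_neg hφ (hsh (-t))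
    have hz1 : HasDerivWithinAt (fun t => (V t).2 + grad (V t).1) _ _ t :=
      (h.snd_deriv ht).add (h.grad_deriv ht)
    have hz2 : HasDerivWithinAt (fun t => (V t).2 - grad (V t).1) _ _ t :=
      (h.snd_deriv ht).sub (h.grad_deriv ht)
    -- The velocity u_t need not be differentiable in L². Moving the translations onto ψ leaves V,
    -- which is differentiable, paired with translates of a smooth function.
    have e1 : ∀ s, inner ℝ (wave s (V s)).2 (ofFun (ψ s))
        = 1 / 2 * (inner ℝ ((V s).2 + grad (V s).1) (shift (-s) (ofFun (ψ s)))
          + inner ℝ ((V s).2 - grad (V s).1) (shift s (ofFun (ψ s)))) := by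
      intro s
      have e3 : inner ℝ ((V s).2 - grad (V s).1) (shift s (ofFun (ψ s)))
          = inner ℝ (shift (-s) ((V s).2 - grad (V s).1)) (ofFun (ψ s)) := by
        rw [inner_shift_left, neg_neg]
      rw [← inner_shift_left, e3, ← inner_add_left, ← real_inner_smul_left]
      congr 1
      rw [wave_snd, map_add, map_sub]
      module
    have hg : inner ℝ (grad (wave t (V t)).1) (ofFun (deriv (ψ t)))
        = -inner ℝ (toL2 (wave t (V t)).1) (ofFun (dx (dx ψ) t)) :=
      hs.dx.inner_grad c2.dx_two ht (wave t (V t)).1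
    have hA := ((hz1.inner ℝ h2).add (hz2.inner ℝ h1)).const_mul (1 / 2 : ℝ)
    have hB := (hu.hasDeriv t ht).inner ℝ (hs.dt.hasDerivWithinAt_ofFun hM c2.dt_two ht)
    rw [hY]
    simp only [e1]
    refine (hA.sub hB).congr_deriv ?_
    simp only [hY', inner_sub_right]
    have hg' : inner ℝ (toL2 (wave t (V t)).1) (ofFun (dx (dx ψ) t))
      = -inner ℝ (grad (wave t (V t)).1) (ofFun (deriv (ψ t))) := by rw [hg, neg_neg]
    rw [hg', wave_snd, grad_wave]
    have s1 : ∀ a b : L2, inner ℝ (shift t a) b = inner ℝ a (shift (-t) b) := inner_shift_left t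
    have s2 : ∀ a b : L2, inner ℝ (shift (-t) a) b = inner ℝ a (shift t b) := fun a b => by
      rw [inner_shift_left, neg_neg]
    simp only [inner_add_left, inner_sub_left, inner_add_right, inner_neg_right,
      real_inner_smul_left, s1, s2, shift_shift, neg_add_cancel, add_neg_cancel, shift_zero]
    ring
  have hcont : ContinuousOn Y' (timeInterval T) :=
    (hf.inner kψ).sub (hcu.inner (ktt.sub kxx))
  have key := integral_timeInterval_eq hT₁ hder hcont fun t ht htT => by
    simp only [hY, hY', hs.ofFun_eq_zero ht htT, hs.dt.ofFun_eq_zero ht htT,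
      hs.dt.dt.ofFun_eq_zero ht htT, hs.dx.dx.ofFun_eq_zero ht htT, sub_self, inner_zero_right,
      and_self]
  have hint : ∀ g : ℝ → ℝ, ContinuousOn g (timeInterval T) →
      (∀ t ∈ timeInterval T, T₁ < t → g t = 0) → IntegrableOn g (timeInterval T) := by
    intro g hg hg0
    refine IntegrableOn.of_forall_sdiff_eq_zero
      ((hg.mono (Icc_subset_timeInterval hT₁)).integrableOn_Icc)
      (measurableSet_Ici.inter (isOpen_coe_lt T).measurableSet) fun t ht => ?_
    exact hg0 t ht.1 (not_le.1 fun hle => ht.2 ⟨ht.1.1, hle⟩)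
  have e2 : ∫ t in timeInterval T, inner ℝ (toL2 (wave t (V t)).1)
      (ofFun fun x => dt (dt ψ) t x - dx (dx ψ) t x) = ∫ t in timeInterval T,
        inner ℝ (toL2 (wave t (V t)).1) (ofFun (dt (dt ψ) t) - ofFun (dx (dx ψ) t)) :=
    setIntegral_congr_fun (measurableSet_Ici.inter (isOpen_coe_lt T).measurableSet) fun t ht => by
      simp only [e0 t ht]
  rw [e2]
  have hsplit : ∫ t in timeInterval T, Y' t = (∫ t in timeInterval T, inner ℝ (f t) (ofFun (ψ t)))
      - ∫ t in timeInterval T, inner ℝ (toL2 (wave t (V t)).1)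
        (ofFun (dt (dt ψ) t) - ofFun (dx (dx ψ) t)) := by
    refine integral_sub (hint _ (hf.inner kψ) fun t ht htT => ?_)
      (hint _ (hcu.inner (ktt.sub kxx)) fun t ht htT => ?_)
    · rw [hs.ofFun_eq_zero ht htT, inner_zero_right]
    · rw [hs.dt.dt.ofFun_eq_zero ht htT, hs.dx.dx.ofFun_eq_zero ht htT, sub_self,
        inner_zero_right]
  rw [hsplit] at key
  have hY0 : Y 0 = inner ℝ (V 0).2 (ofFun (ψ 0)) - inner ℝ (toL2 (V 0).1) (ofFun (dt ψ 0)) := by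
    simp only [hY, wave_zero]
  rw [hY0] at key
  linarith

end

/-! ## Uniqueness for the linear wave equation -/

section

variable {ε q C T₁ M : ℝ} {F : ℝ → ℝ → ℝ}

/-- A forward characteristic started after T₁ never meets the support, and one of unit speed moves
in x by at most T₁ before time T₁. -/
theorem SuppIn.charInt (hF : Continuous fun z : ℝ × ℝ => F z.1 z.2) (hd : Decays q C F)
    (hq : 1 < q) (hε : |ε| = 1) (h : SuppIn ⊤ T₁ M F) :
    SuppIn ⊤ T₁ (M + T₁) (charInt ε F) := by
  intro t ht x hx
  rw [timeInterval_top] at ht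
  rw [DampedWave.charInt, tailInt_eq hq hF hd ht]
  refine (setIntegral_congr_fun measurableSet_Ioi fun s hs => ?_).trans (integral_zero ℝ ℝ)
  have hs' : t < s := hs
  refine h s (by simpa using (ht : (0 : ℝ) ≤ t).trans hs'.le) _ ?_
  by_cases h1 : T₁ < s
  · exact Or.inl h1
  · have h2 : s ≤ T₁ := not_lt.1 h1
    rcases hx with hx | hx
    · exact Or.inl (hx.trans hs')
    · right
      have h3 : |x| ≤ |x - ε * t + ε * s| + |ε * (s - t)| := by
        have := abs_sub (x - ε * t + ε * s) (ε * (s - t))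
        rwa [show x - ε * t + ε * s - ε * (s - t) = x by ring] at this
      rw [abs_mul, hε, one_mul, abs_of_pos (by linarith : 0 < s - t)] at h3
      have : (0 : ℝ) ≤ t := ht
      linarith

theorem SuppIn.mono {T T' : EReal} (hT : T' ≤ T) (h : SuppIn T T₁ M F) : SuppIn T' T₁ M F :=
  fun t ht => h t (timeInterval_mono hT ht)

end

/-- Duality: η(t) φ(x) is the wave operator applied to its solution from t = ∞. That solution
vanishes after the last time in the support of η and spreads at finite speed, so it is an admissible
test function. It need not vanish at t = 0. -/
theorem inner_eq_zero_of_wave_test {T : EReal} (hT : 0 < T) {d : ℝ → L2}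
    (h : ∀ ψ : ℝ → ℝ → ℝ, IsTestFunction T ψ → ∫ t in timeInterval T, inner ℝ (d t)
      (ofFun fun x => dt (dt ψ) t x - dx (dx ψ) t x) = 0)
    {η φ : ℝ → ℝ} (hη : ContDiff ℝ ∞ η) (hηc : HasCompactSupport η)
    (hηT : tsupport η ⊆ timeInterval T) (hφ : ContDiff ℝ ∞ φ) (hφc : HasCompactSupport φ) :
    ∫ t in timeInterval T, η t * inner ℝ (d t) (ofFun φ) = 0 := by
  obtain ⟨T₁, hT₁, hηT₁⟩ := exists_ge_of_isCompact hT hηc hηT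
  obtain ⟨M, hM⟩ := hφc.isCompact.isBounded.exists_norm_le
  have hη0 : ∀ t, T₁ < t → η t = 0 := fun t ht => by
    by_contra hne
    exact absurd (hηT₁ t (subset_tsupport _ hne)) (not_le.2 ht)
  have hφ0 : ∀ x, |M| < |x| → φ x = 0 := fun x hx => by
    by_contra hne
    exact absurd ((hM x (subset_tsupport _ hne)).trans (le_abs_self M)) (not_le.2 hx)
  have hdφ : Continuous (deriv φ) := hφ.continuous_deriv (by simp)
  have decay : ∀ {χ : ℝ → ℝ}, Continuous χ → HasCompactSupport χ →
      ∃ C, Decays 3 C fun t x => η t * χ x := by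
    intro χ hχ hχc
    obtain ⟨A, hA⟩ := hη.continuous.bounded_above_of_compact_support hηc
    obtain ⟨B, hB⟩ := hχ.bounded_above_of_compact_support hχc
    have hA0 := (norm_nonneg _).trans (hA 0)
    have hB0 := (norm_nonneg _).trans (hB 0)
    -- The exponent 3 is an arbitrary choice above 2; compact support gives decay of any order.
    refine ⟨A * B * (1 + T₁) ^ (3 : ℝ), fun s hs x => ?_⟩
    rw [le_div_iff₀ (by positivity), abs_mul]
    by_cases h1 : T₁ < s
    · rw [hη0 s h1, abs_zero, zero_mul, zero_mul]
      have := hT₁.1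
      positivity
    · have h2 : (1 + s) ^ (3 : ℝ) ≤ (1 + T₁) ^ (3 : ℝ) :=
        Real.rpow_le_rpow (by linarith) (by linarith [not_lt.1 h1]) (by norm_num)
      exact mul_le_mul (mul_le_mul (hA s) (hB x) (abs_nonneg _) hA0) h2 (by positivity)
        (by positivity)
  set F : ℝ → ℝ → ℝ := fun t x => η t * φ x
  set G : ℝ → ℝ → ℝ := fun t x => η t * deriv φ x
  obtain ⟨C, dF⟩ := decay hφ.continuous hφc
  obtain ⟨C', dG⟩ := decay hdφ hφc.deriv
  have cF : Continuous fun z : ℝ × ℝ => F z.1 z.2 :=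
    (hη.continuous.comp continuous_fst).mul (hφ.continuous.comp continuous_snd)
  have cG : Continuous fun z : ℝ × ℝ => G z.1 z.2 :=
    (hη.continuous.comp continuous_fst).mul (hdφ.comp continuous_snd)
  have hFG : ∀ t x, HasDerivAt (F t) (G t x) x := fun t x =>
    (hφ.differentiable (by simp)).differentiableAt.hasDerivAt.const_mul (η t)
  have hq : (2 : ℝ) < 3 := by norm_num
  have hs : SuppIn ⊤ T₁ |M| F := fun t _ x hx => by
    rcases hx with hx | hx
    · simp only [F, hη0 t hx, zero_mul]
    · simp only [F, hφ0 x hx, mul_zero]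
  have hs1 : SuppIn ⊤ T₁ (|M| + T₁ + T₁) (backwardWave F) :=
    (hs.charInt cF dF (by norm_num) (by simp)).charInt
      (continuous_charInt (by norm_num) cF dF) (decays_charInt (by norm_num) cF dF) (by norm_num)
      (by simp)
  have hψ : IsTestFunction T (backwardWave F) :=
    (hs1.mono le_top).isTestFunction hT₁
      (contDiff_backwardWave hq cF cG hFG dF dG).contDiffOn
  rw [← h _ hψ]
  refine setIntegral_congr_fun (measurableSet_Ici.inter (isOpen_coe_lt T).measurableSet)
    fun t ht => ?_
  have e1 : ∀ t, 0 ≤ t → ∀ x, dt (backwardWave F) t x = backwardWaveDt F t x := fun t ht x =>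
    dt_eq_of_hasDerivWithinAt ht
      (hasDerivAt_backwardWave_left hq cF cG hFG dF dG t x).hasDerivWithinAt
  have e2 : ∀ t x, dx (backwardWave F) t x = backwardWaveDx F t x := fun t x =>
    dx_eq_of_hasDerivAt (hasDerivAt_backwardWave_right hq cF cG hFG dF dG t x)
  have e : (fun x => dt (dt (backwardWave F)) t x - dx (dx (backwardWave F)) t x)
      = fun x => η t * φ x := by
    funext x
    have h1 : dt (dt (backwardWave F)) t x = F t x + backwardWaveDx G t x :=
      dt_eq_of_hasDerivWithinAt ht.1 ((hasDerivAt_backwardWaveDt_left hq cF cG hFG dF dG t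
        x).hasDerivWithinAt.congr (fun s hs => e1 s hs x) (e1 t ht.1 x))
    have h2 : dx (dx (backwardWave F)) t x = backwardWaveDx G t x := by
      refine dx_eq_of_hasDerivAt ?_
      simp only [e2]
      exact hasDerivAt_backwardWaveDx_right hq cF cG hFG dF dG t x
    rw [h1, h2]
    ring
  simp only [e]
  rw [ofFun_const_mul _ (memLp_of_test hφ.continuous hφc), inner_smul_right]

theorem eq_zero_of_wave_test {T : EReal} (hT : 0 < T) {d : ℝ → L2}
    (hd : ContinuousOn d (timeInterval T))
    (h : ∀ ψ : ℝ → ℝ → ℝ, IsTestFunction T ψ → ∫ t in timeInterval T, inner ℝ (d t)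
      (ofFun fun x => dt (dt ψ) t x - dx (dx ψ) t x) = 0) :
    ∀ t ∈ timeInterval T, d t = 0 := by
  set U : Set ℝ := Ioi 0 ∩ {t : ℝ | (t : EReal) < T} with hU
  have hUo : IsOpen U := isOpen_Ioi.inter (isOpen_coe_lt T)
  have hUI : U ⊆ timeInterval T := fun t ht => ⟨(mem_Ioi.1 ht.1).le, ht.2⟩
  have hpos : ∀ t ∈ U, d t = 0 := by
    intro t ht
    refine eq_zero_of_inner_test fun φ hφ hφc => ?_
    have hc : ContinuousOn (fun t => inner ℝ (d t) (ofFun φ)) U :=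
      (hd.mono hUI).inner continuousOn_const
    have hae := hUo.ae_eq_zero_of_integral_contDiff_smul_eq_zero (μ := volume)
      (hc.locallyIntegrableOn hUo.measurableSet) fun η hη hηc hηU => by
        have h1 := inner_eq_zero_of_wave_test hT h hη hηc (hηU.trans hUI) hφ hφc
        rw [setIntegral_eq_integral_of_forall_compl_eq_zero] at h1
        · simpa only [smul_eq_mul] using h1
        · intro t ht
          rw [image_eq_zero_of_notMem_tsupport (fun hmem => ht (hUI (hηU hmem))), zero_mul]
    have h2 : (fun t => inner ℝ (d t) (ofFun φ)) =ᵐ[volume.restrict U] fun _ => 0 :=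
      (ae_restrict_iff' hUo.measurableSet).2 hae
    exact Measure.eqOn_open_of_ae_eq h2 hUo hc continuousOn_const ht
  -- Localization in time yields the result on the open interval only; t = 0 is reached by
  -- continuity of d.
  intro t ht
  rcases ht.1.eq_or_lt with h0 | h0
  · subst h0
    have h1 : Tendsto d (𝓝[>] 0) (𝓝 (d 0)) :=
      (hd 0 ht).mono_left (by
        rw [nhdsWithin_timeInterval ht]
        exact nhdsWithin_mono _ Ioi_subset_Ici_self)
    have h2 : d =ᶠ[𝓝[>] 0] fun _ => 0 := by
      filter_upwards [self_mem_nhdsWithin,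
        mem_nhdsWithin_of_mem_nhds ((isOpen_coe_lt T).mem_nhds ht.2)] with t h3 h4
      exact hpos t ⟨h3, h4⟩
    exact tendsto_nhds_unique h1 (tendsto_const_nhds.congr' h2.symm)
  · exact hpos t ⟨h0, ht.2⟩

/-! ## Multiplication by the damping coefficient -/

/-- Multiplication of an element of `L²(ℝ)` by a bounded function. -/
def mulL2 (m : ℝ → ℝ) (f : L2) : L2 := ofFun fun x => m x * f x

section

variable {L : ℝ} {m m' : ℝ → ℝ}

theorem memLp_mul (hm : Continuous m) (hb : ∀ x, |m x| ≤ L) (f : L2) :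
    MemLp (fun x => m x * f x) 2 volume :=
  MemLp.of_le_mul (c := L) (Lp.memLp f)
    (hm.aestronglyMeasurable.mul (Lp.aestronglyMeasurable f)) (Eventually.of_forall fun x => by
      rw [norm_mul]
      exact mul_le_mul_of_nonneg_right (hb x) (norm_nonneg _))

theorem mulL2_coeFn (hm : Continuous m) (hb : ∀ x, |m x| ≤ L) (f : L2) :
    mulL2 m f =ᵐ[volume] fun x => m x * f x := ofFun_coeFn (memLp_mul hm hb f)

theorem mulL2_sub (hm : Continuous m) (hb : ∀ x, |m x| ≤ L) (f g : L2) :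
    mulL2 m (f - g) = mulL2 m f - mulL2 m g := by
  rw [mulL2, mulL2, mulL2, ← ofFun_sub (memLp_mul hm hb f) (memLp_mul hm hb g)]
  refine ofFun_congr (memLp_mul hm hb _) ?_
  filter_upwards [Lp.coeFn_sub f g] with x hx
  rw [hx, Pi.sub_apply]
  ring

theorem norm_mulL2_le (hm : Continuous m) (hb : ∀ x, |m x| ≤ L) (f : L2) :
    ‖mulL2 m f‖ ≤ L * ‖f‖ := by
  refine Lp.norm_le_mul_norm_of_ae_le_mul ?_
  filter_upwards [mulL2_coeFn hm hb f] with x hx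
  rw [hx, norm_mul]
  exact mul_le_mul_of_nonneg_right (hb x) (norm_nonneg _)

theorem norm_mulL2_sub_le {L' D : ℝ} (hm : Continuous m) (hb : ∀ x, |m x| ≤ L)
    (hm' : Continuous m') (hb' : ∀ x, |m' x| ≤ L') (hD : ∀ x, |m x - m' x| ≤ D) (f : L2) :
    ‖mulL2 m f - mulL2 m' f‖ ≤ D * ‖f‖ := by
  refine Lp.norm_le_mul_norm_of_ae_le_mul ?_
  filter_upwards [mulL2_coeFn hm hb f, mulL2_coeFn hm' hb' f,
    Lp.coeFn_sub (mulL2 m f) (mulL2 m' f)] with x h1 h2 h3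
  rw [h3, Pi.sub_apply, h1, h2, ← sub_mul, norm_mul]
  exact mul_le_mul_of_nonneg_right (hD x) (norm_nonneg _)

theorem inner_mulL2 (hm : Continuous m) (hb : ∀ x, |m x| ≤ L) (f : L2) {φ : ℝ → ℝ}
    (hφ : MemLp φ 2 volume) (hmφ : MemLp (fun x => m x * φ x) 2 volume) :
    inner ℝ (mulL2 m f) (ofFun φ) = inner ℝ f (ofFun fun x => m x * φ x) := by
  rw [inner_ofFun _ hφ, inner_ofFun _ hmφ]
  refine integral_congr_ae ?_
  filter_upwards [mulL2_coeFn hm hb f] with x hx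
  rw [hx]
  ring

end

/-- A bounded damping coefficient, Lipschitz continuous in time. -/
structure BoundedDamping (L : ℝ) (a : ℝ → ℝ → ℝ) : Prop where
  cnOn : CnOn 2 ⊤ a
  bound : ∀ t, 0 ≤ t → ∀ x, |a t x| ≤ L
  lipschitz : ∀ s, 0 ≤ s → ∀ t, 0 ≤ t → ∀ x, |a s x - a t x| ≤ L * |s - t|

theorem BoundedDamping.continuous {L : ℝ} {a : ℝ → ℝ → ℝ} (ha : BoundedDamping L a) {t : ℝ}
    (ht : 0 ≤ t) : Continuous (a t) := ha.cnOn.continuous_right (by simpa using ht)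

theorem boundedDamping_damping {k δ : ℝ} {b : ℝ → ℝ → ℝ} (hk : 0 < k) (hb : IsC2 b)
    (hd : DecayBound k δ b) : BoundedDamping (2 + δ) (damping b) := by
  have h2 := hb.cnOn
  have h1 : CnOn 1 ⊤ b := h2.of_le (by norm_num)
  have hδ : 0 ≤ δ := by
    have := (abs_nonneg _).trans (hd 0 0 le_rfl).1
    simpa using this
  have hle : ∀ {q t : ℝ}, 0 ≤ t → 0 ≤ q → δ / (1 + t) ^ q ≤ δ := fun ht hq =>
    div_le_self hδ (Real.one_le_rpow (by linarith) hq)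
  refine ⟨?_, fun t ht x => ?_, fun s hs t ht x => ?_⟩
  · refine ContDiffOn.add (f := fun z : ℝ × ℝ => 2 / (1 + z.1)) ?_ h2
    refine contDiffOn_const.div (contDiff_const.add contDiff_fst).contDiffOn fun z hz => ?_
    have : 0 ≤ z.1 := hz.1.1
    linarith
  · have e1 : |2 / (1 + t)| ≤ 2 := by
      rw [abs_of_nonneg (by positivity)]
      exact div_le_self (by norm_num) (by linarith)
    exact (abs_add_le _ _).trans (add_le_add e1 ((hd t x ht).1.trans (hle ht hk.le)))
  · have e1 : |2 / (1 + s) - 2 / (1 + t)| ≤ 2 * |s - t| := by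
      have : 2 / (1 + s) - 2 / (1 + t) = 2 * (t - s) / ((1 + s) * (1 + t)) := by
        field_simp
        ring
      rw [this, abs_div, abs_mul, abs_two, abs_sub_comm t s,
        abs_of_pos (by positivity : 0 < (1 + s) * (1 + t))]
      exact div_le_self (by positivity) (by nlinarith [mul_nonneg hs ht])
    have e2 : |b s x - b t x| ≤ δ * |s - t| := by
      have := (convex_Ici (0 : ℝ)).norm_image_sub_le_of_norm_hasDerivWithin_le
        (f := fun s => b s x) (f' := fun s => dt b s x) (C := δ) (x := t) (y := s)
        (fun r hr => h1.hasDerivWithinAt (by simpa using hr) x)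
        (fun r hr => (hd r x hr).2.2.1.trans (hle hr (by linarith))) ht hs
      exact this
    have e3 : damping b s x - damping b t x
        = (2 / (1 + s) - 2 / (1 + t)) + (b s x - b t x) := by
      rw [damping, damping]
      ring
    rw [e3, add_mul]
    exact (abs_add_le _ _).trans (add_le_add e1 e2)

/-- The source term `|u|^p - a u_t`. -/
def source (a : ℝ → ℝ → ℝ) (p t : ℝ) (U : H1 × L2) : L2 :=
  absPow p U.1 - mulL2 (a (max t 0)) U.2

section

variable {L p : ℝ} {a : ℝ → ℝ → ℝ}

theorem continuous_source (ha : BoundedDamping L a) (hp : 1 < p) :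
    Continuous fun z : ℝ × (H1 × L2) => source a p z.1 z.2 := by
  have h1 : Continuous fun z : ℝ × (H1 × L2) => absPow p z.2.1 :=
    (continuous_absPow hp).comp (continuous_fst.comp continuous_snd)
  refine h1.sub ?_
  rw [continuous_iff_continuousAt]
  rintro ⟨t₀, u₀, v₀⟩
  rw [ContinuousAt, tendsto_iff_norm_sub_tendsto_zero]
  have hm : ∀ t : ℝ, 0 ≤ max t 0 := fun t => le_max_right t 0
  have h2 : ∀ z : ℝ × (H1 × L2), ‖mulL2 (a (max z.1 0)) z.2.2 - mulL2 (a (max t₀ 0)) v₀‖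
      ≤ L * ‖z.2.2 - v₀‖ + L * |max z.1 0 - max t₀ 0| * ‖v₀‖ := by
    intro z
    have e : mulL2 (a (max z.1 0)) z.2.2 - mulL2 (a (max t₀ 0)) v₀
        = mulL2 (a (max z.1 0)) (z.2.2 - v₀)
          + (mulL2 (a (max z.1 0)) v₀ - mulL2 (a (max t₀ 0)) v₀) := by
      rw [mulL2_sub (ha.continuous (hm _)) (ha.bound _ (hm _))]
      abel
    rw [e]
    exact (norm_add_le _ _).trans (add_le_add
      (norm_mulL2_le (ha.continuous (hm _)) (ha.bound _ (hm _)) _)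
      (norm_mulL2_sub_le (ha.continuous (hm _)) (ha.bound _ (hm _)) (ha.continuous (hm _))
        (ha.bound _ (hm _)) (ha.lipschitz _ (hm _) _ (hm _)) _))
  refine squeeze_zero (fun _ => norm_nonneg _) h2 ?_
  have h3 : Continuous fun z : ℝ × (H1 × L2) =>
      L * ‖z.2.2 - v₀‖ + L * |max z.1 0 - max t₀ 0| * ‖v₀‖ := by fun_prop
  simpa using h3.tendsto (t₀, u₀, v₀)

theorem norm_source_sub_le (ha : BoundedDamping L a) (hp : 1 < p) {M : ℝ} (t : ℝ)
    {U W : H1 × L2} (hU : ‖U‖ ≤ M) (hW : ‖W‖ ≤ M) :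
    ‖source a p t U - source a p t W‖ ≤ (p * (4 * M) ^ (p - 1) + L) * ‖U - W‖ := by
  have hm : 0 ≤ max t 0 := le_max_right t 0
  have h1 := norm_absPow_sub_le hp ((norm_fst_le U).trans hU) ((norm_fst_le W).trans hW)
  have h2 := norm_mulL2_le (ha.continuous hm) (ha.bound _ hm) (U.2 - W.2)
  have hM : 0 ≤ M := (norm_nonneg U).trans hU
  have hL : 0 ≤ L := (abs_nonneg _).trans (ha.bound 0 le_rfl 0)
  have e : source a p t U - source a p t W
      = (absPow p U.1 - absPow p W.1) - mulL2 (a (max t 0)) (U.2 - W.2) := by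
    rw [mulL2_sub (ha.continuous hm) (ha.bound _ hm), source, source]
    abel
  rw [e, add_mul]
  refine (norm_sub_le _ _).trans (add_le_add (h1.trans ?_) (h2.trans ?_))
  · exact mul_le_mul_of_nonneg_left (norm_fst_le (U - W))
      (mul_nonneg (by linarith) (by positivity))
  · exact mul_le_mul_of_nonneg_left (norm_snd_le (U - W)) hL

end

/-! ## Weak solutions and the flow of the damped wave equation -/

theorem measurableSet_timeInterval (T : EReal) : MeasurableSet (timeInterval T) :=
  measurableSet_Ici.inter (isOpen_coe_lt T).measurableSet

theorem integrableOn_timeInterval {T : EReal} {T₁ : ℝ} (hT₁ : T₁ ∈ timeInterval T) {g : ℝ → ℝ}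
    (hg : ContinuousOn g (timeInterval T)) (h0 : ∀ t ∈ timeInterval T, T₁ < t → g t = 0) :
    IntegrableOn g (timeInterval T) :=
  IntegrableOn.of_forall_sdiff_eq_zero
    ((hg.mono (Icc_subset_timeInterval hT₁)).integrableOn_Icc) (measurableSet_timeInterval T)
    fun t ht => h0 t ht.1 (not_le.1 fun hle => ht.2 ⟨ht.1.1, hle⟩)

section

variable {L p : ℝ} {a : ℝ → ℝ → ℝ} {T : EReal} {u : ℝ → H1} {ut : ℝ → L2} {u₀ : H1} {u₁ : L2}

theorem MemX.continuousOn_toL2 (hX : MemX T u ut) :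
    ContinuousOn (fun t => toL2 (u t)) (timeInterval T) :=
  fun t ht => (hX.hasDeriv t ht).continuousWithinAt

theorem MemX.continuousOn_source (hX : MemX T u ut) (ha : BoundedDamping L a) (hp : 1 < p) :
    ContinuousOn (fun t => source a p t (u t, ut t)) (timeInterval T) := by
  have h := continuousOn_id.prodMk (hX.continuousOn.prodMk hX.continuousOn_deriv)
  have h' := Continuous.comp_continuousOn' (f := fun t => (t, (u t, ut t)))
    (continuous_source ha hp) h
  exact h'

/-- Integrating (aψ)_t by parts in time turns the weak formulation into that of the undamped wave
equation with source |u|^p - a u_t. The boundary term carries u(0), not yet known to equal u₀, so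
the initial velocity acquires the correction a(0)(u₀ - u(0)). -/
theorem weak_iff (ha : BoundedDamping L a) (hp : 1 < p) (hT : 0 < T) (hX : MemX T u ut)
    {ψ : ℝ → ℝ → ℝ} (hψ : IsTestFunction T ψ) :
    (∫ t in timeInterval T, ∫ x, toL2 (u t) x *
        (dt (dt ψ) t x - dx (dx ψ) t x - dt (fun s y => a s y * ψ s y) t x)
      = (∫ x, ((a 0 x * toL2 u₀ x + u₁ x) * ψ 0 x - toL2 u₀ x * dt ψ 0 x))
        + ∫ t in timeInterval T, ∫ x, |toL2 (u t) x| ^ p * ψ t x) ↔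
    ∫ t in timeInterval T, inner ℝ (toL2 (u t)) (ofFun fun x => dt (dt ψ) t x - dx (dx ψ) t x)
      = inner ℝ (u₁ + mulL2 (a 0) (toL2 u₀ - toL2 (u 0))) (ofFun (ψ 0))
        - inner ℝ (toL2 u₀) (ofFun (dt ψ 0))
        + ∫ t in timeInterval T, inner ℝ (source a p t (u t, ut t)) (ofFun (ψ t)) := by
  obtain ⟨T₁, hT₁, M, hM, hs⟩ := hψ.exists_suppIn hT
  have h0T := zero_mem_timeInterval hT
  have hm := measurableSet_timeInterval T
  have c2 : CnOn 2 T ψ := hψ.cnOn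
  have c1 : CnOn 1 T ψ := c2.of_le (by norm_num)
  have c0 : CnOn 0 T ψ := c1.of_le (by norm_num)
  have d1 : CnOn 1 T (fun s y => a s y * ψ s y) :=
    ((ha.cnOn.mono le_top).mul c2).of_le (by norm_num)
  have d0 : CnOn 0 T (fun s y => a s y * ψ s y) := d1.of_le (by norm_num)
  have hsa : SuppIn T T₁ M (fun s y => a s y * ψ s y) := hs.mul_left a
  have kψ := hs.continuousOn_ofFun hM c0
  have ktt := hs.dt.dt.continuousOn_ofFun hM c2.dt_two.dt_one
  have kxx := hs.dx.dx.continuousOn_ofFun hM c2.dx_two.dx_one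
  have ka := hsa.continuousOn_ofFun hM d0
  have kat := hsa.dt.continuousOn_ofFun hM d1.dt_one
  have hu := hX.continuousOn_toL2
  have e0 : ∀ t ∈ timeInterval T, (ofFun fun x => dt (dt ψ) t x - dx (dx ψ) t x)
      = ofFun (dt (dt ψ) t) - ofFun (dx (dx ψ) t) := fun t ht =>
    ofFun_sub (hs.dt.dt.memLp c2.dt_two.dt_one ht) (hs.dx.dx.memLp c2.dx_two.dx_one ht)
  have iA : IntegrableOn (fun t => inner ℝ (toL2 (u t))
      (ofFun fun x => dt (dt ψ) t x - dx (dx ψ) t x)) (timeInterval T) := by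
    refine integrableOn_timeInterval hT₁ ((hu.inner (ktt.sub kxx)).congr fun t ht => ?_)
      fun t ht htT => ?_
    · simp only [e0 t ht]
      rfl
    · rw [e0 t ht, hs.dt.dt.ofFun_eq_zero ht htT, hs.dx.dx.ofFun_eq_zero ht htT, sub_self,
        inner_zero_right]
  have iB : IntegrableOn (fun t => inner ℝ (toL2 (u t))
      (ofFun (dt (fun s y => a s y * ψ s y) t))) (timeInterval T) :=
    integrableOn_timeInterval hT₁ (hu.inner kat) fun t ht htT => by
      rw [hsa.dt.ofFun_eq_zero ht htT, inner_zero_right]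
  have iC : IntegrableOn (fun t => inner ℝ (ut t) (ofFun fun x => a t x * ψ t x))
      (timeInterval T) :=
    integrableOn_timeInterval hT₁ (hX.continuousOn_deriv.inner ka) fun t ht htT => by
      rw [hsa.ofFun_eq_zero ht htT, inner_zero_right]
  have iD : IntegrableOn (fun t => inner ℝ (absPow p (u t)) (ofFun (ψ t))) (timeInterval T) :=
    integrableOn_timeInterval hT₁ (((continuous_absPow hp).comp_continuousOn
      hX.continuousOn).inner kψ) fun t ht htT => by
      rw [hs.ofFun_eq_zero ht htT, inner_zero_right]
  have hbp := integral_timeInterval_eq hT₁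
    (Y := fun t => inner ℝ (toL2 (u t)) (ofFun fun x => a t x * ψ t x))
    (Y' := fun t => inner ℝ (toL2 (u t)) (ofFun (dt (fun s y => a s y * ψ s y) t))
      + inner ℝ (ut t) (ofFun fun x => a t x * ψ t x))
    (fun t ht => (hX.hasDeriv t ht).inner ℝ (hsa.hasDerivWithinAt_ofFun hM d1 ht))
    ((hu.inner kat).add (hX.continuousOn_deriv.inner ka)) fun t ht htT => by
      simp only [hsa.ofFun_eq_zero ht htT, hsa.dt.ofFun_eq_zero ht htT, inner_zero_right,
        add_zero, and_self]
  rw [integral_add iB iC] at hbp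
  have mulE : ∀ t ∈ timeInterval T, ∀ f : L2, inner ℝ (mulL2 (a t) f) (ofFun (ψ t))
      = inner ℝ f (ofFun fun x => a t x * ψ t x) := fun t ht f =>
    inner_mulL2 (ha.continuous ht.1) (ha.bound t ht.1) f (hs.memLp c0 ht) (hsa.memLp d0 ht)
  have hL : ∫ t in timeInterval T, ∫ x, toL2 (u t) x *
        (dt (dt ψ) t x - dx (dx ψ) t x - dt (fun s y => a s y * ψ s y) t x)
      = (∫ t in timeInterval T, inner ℝ (toL2 (u t))
          (ofFun fun x => dt (dt ψ) t x - dx (dx ψ) t x))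
        - ∫ t in timeInterval T, inner ℝ (toL2 (u t))
          (ofFun (dt (fun s y => a s y * ψ s y) t)) := by
    rw [← integral_sub iA iB]
    refine setIntegral_congr_fun hm fun t ht => ?_
    have m1 : MemLp (fun x => dt (dt ψ) t x - dx (dx ψ) t x) 2 volume :=
      (hs.dt.dt.memLp c2.dt_two.dt_one ht).sub (hs.dx.dx.memLp c2.dx_two.dx_one ht)
    have m2 := hsa.dt.memLp d1.dt_one ht
    rw [← inner_sub_right, ← ofFun_sub m1 m2]
    exact (inner_ofFun _ (m1.sub m2)).symm
  have hR : ∫ t in timeInterval T, ∫ x, |toL2 (u t) x| ^ p * ψ t x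
      = ∫ t in timeInterval T, inner ℝ (absPow p (u t)) (ofFun (ψ t)) := by
    refine setIntegral_congr_fun hm fun t ht => ?_
    rw [inner_ofFun _ (hs.memLp c0 ht)]
    refine integral_congr_ae ?_
    filter_upwards [absPow_coeFn hp (u t)] with x hx
    rw [hx]
  have hS : ∫ t in timeInterval T, inner ℝ (source a p t (u t, ut t)) (ofFun (ψ t))
      = (∫ t in timeInterval T, inner ℝ (absPow p (u t)) (ofFun (ψ t)))
        - ∫ t in timeInterval T, inner ℝ (ut t) (ofFun fun x => a t x * ψ t x) := by
    rw [← integral_sub iD iC]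
    refine setIntegral_congr_fun hm fun t ht => ?_
    rw [source, inner_sub_left, max_eq_left ht.1, mulE t ht]
  have hD : ∫ x, ((a 0 x * toL2 u₀ x + u₁ x) * ψ 0 x - toL2 u₀ x * dt ψ 0 x)
      = inner ℝ (u₁ + mulL2 (a 0) (toL2 u₀)) (ofFun (ψ 0))
        - inner ℝ (toL2 u₀) (ofFun (dt ψ 0)) := by
    have n1 := hs.memLp c0 h0T
    have n2 := hs.dt.memLp c1.dt_one h0T
    have i1 : ∀ f : L2, Integrable fun x => f x * ψ 0 x := fun f =>
      (Lp.memLp f).integrable_mul n1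
    have i2 : ∀ f : L2, Integrable fun x => f x * dt ψ 0 x := fun f =>
      (Lp.memLp f).integrable_mul n2
    rw [inner_ofFun _ n1, inner_ofFun _ n2, ← integral_sub (i1 _) (i2 _)]
    refine integral_congr_ae ?_
    filter_upwards [Lp.coeFn_add u₁ (mulL2 (a 0) (toL2 u₀)),
      mulL2_coeFn (ha.continuous le_rfl) (ha.bound 0 le_rfl) (toL2 u₀)] with x h1 h2
    rw [h1, Pi.add_apply, h2]
    ring
  rw [hL, hR, hD, hS, mulL2_sub (ha.continuous le_rfl) (ha.bound 0 le_rfl)]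
  simp only [inner_add_left, inner_sub_left, mulE 0 h0T]
  constructor <;> intro h <;> linarith

/-- The equation satisfied by `V(t) = S(-t) (u, u_t)(t)` for a solution `u` of
`u_tt - u_xx + a u_t = |u|^p`. -/
def NonlinearFlow (a : ℝ → ℝ → ℝ) (p : ℝ) (T : EReal) (V : ℝ → H1 × L2) : Prop :=
  LinearFlow T (fun t => source a p t (wave t (V t))) V

theorem NonlinearFlow.continuousOn_source {V : ℝ → H1 × L2} (h : NonlinearFlow a p T V)
    (ha : BoundedDamping L a) (hp : 1 < p) :
    ContinuousOn (fun t => source a p t (wave t (V t))) (timeInterval T) := by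
  have h1 := (LinearFlow.memX h).continuousOn_source ha hp
  exact h1

theorem NonlinearFlow.isSolution {V : ℝ → H1 × L2} (h : NonlinearFlow a p T V)
    (ha : BoundedDamping L a) (hp : 1 < p) (hT : 0 < T) (h0 : V 0 = (u₀, u₁)) :
    IsSolution a p u₀ u₁ T (fun t => (wave t (V t)).1) fun t => (wave t (V t)).2 := by
  refine ⟨hT, LinearFlow.memX h, fun ψ hψ => ?_⟩
  rw [weak_iff ha hp hT (LinearFlow.memX h) hψ,
    LinearFlow.weak h hT (h.continuousOn_source ha hp) hψ]
  rw [wave_zero, h0, sub_self, ← sub_self (0 : L2),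
    mulL2_sub (ha.continuous le_rfl) (ha.bound 0 le_rfl), sub_self, add_zero]

theorem exists_linearFlow {f : ℝ → L2} (hT : 0 < T) (hf : ContinuousOn f (timeInterval T))
    (V₀ : H1 × L2) : ∃ V, LinearFlow T f V ∧ V 0 = V₀ := by
  -- Freezing f for negative times makes the integrand continuous on the open set {s < T}, which
  -- contains a two-sided neighbourhood of 0.
  set F : ℝ → H1 × L2 := fun s => wave (-s) (0, f (max s 0)) with hF
  have hmax : ∀ s : ℝ, (s : EReal) < T → max s 0 ∈ timeInterval T := fun s hs => by
    refine ⟨le_max_right _ _, ?_⟩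
    rcases le_total s 0 with h | h
    · rw [max_eq_right h]
      exact_mod_cast hT
    · rwa [max_eq_left h]
  have hc : ContinuousOn F {s : ℝ | (s : EReal) < T} := by
    refine continuousOn_neg.wave (continuousOn_const.prodMk ?_)
    exact hf.comp (f := fun s : ℝ => max s 0) (by fun_prop) fun s hs => hmax s hs
  refine ⟨fun t => V₀ + ∫ s in (0 : ℝ)..t, F s, fun t ht => ?_, by simp⟩
  have hmem := (isOpen_coe_lt T).mem_nhds ht.2
  have h1 : HasDerivAt (fun t => ∫ s in (0 : ℝ)..t, F s) (F t) t := by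
    have : SecondCountableTopologyEither ℝ (H1 × L2) := secondCountableTopologyEither_of_left ℝ _
    refine intervalIntegral.integral_hasDerivAt_right ?_
      (hc.stronglyMeasurableAtFilter (isOpen_coe_lt T) t ht.2) (hc.continuousAt hmem)
    refine (hc.mono fun s hs => ?_).intervalIntegrable
    rw [uIcc_of_le ht.1] at hs
    exact (Icc_subset_timeInterval ht hs).2
  have h2 := (h1.const_add V₀).hasDerivWithinAt (s := timeInterval T)
  refine h2.congr_deriv ?_
  rw [hF]
  simp only [max_eq_left ht.1]

/-- Regard |u|^p - a u_t as a given source and solve the linear problem with the corrected data of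
`weak_iff`. Its solution and u have the same weak formulation, so they coincide in L², hence in H¹,
and so do their time derivatives. The source is then the one computed from the flow itself. -/
theorem IsSolution.exists_nonlinearFlow (h : IsSolution a p u₀ u₁ T u ut)
    (ha : BoundedDamping L a) (hp : 1 < p) :
    ∃ V, NonlinearFlow a p T V ∧ V 0 = (u₀, u₁) ∧
      ∀ t ∈ timeInterval T, wave t (V t) = (u t, ut t) := by
  have hT := h.pos
  have hX := h.memX
  have h0T := zero_mem_timeInterval hT
  have hf := hX.continuousOn_source ha hp
  obtain ⟨V, hV, hV0⟩ := exists_linearFlow hT hf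
    (u₀, u₁ + mulL2 (a 0) (toL2 u₀ - toL2 (u 0)))
  have hY := hV.memX
  have hd : ∀ t ∈ timeInterval T, toL2 (u t) - toL2 (wave t (V t)).1 = 0 := by
    refine eq_zero_of_wave_test hT (hX.continuousOn_toL2.sub hY.continuousOn_toL2)
      fun ψ hψ => ?_
    obtain ⟨T₁, hT₁, M, hM, hs⟩ := hψ.exists_suppIn hT
    have c2 : CnOn 2 T ψ := hψ.cnOn
    have ktt := hs.dt.dt.continuousOn_ofFun hM c2.dt_two.dt_one
    have kxx := hs.dx.dx.continuousOn_ofFun hM c2.dx_two.dx_one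
    have e0 : ∀ t ∈ timeInterval T, (ofFun fun x => dt (dt ψ) t x - dx (dx ψ) t x)
        = ofFun (dt (dt ψ) t) - ofFun (dx (dx ψ) t) := fun t ht =>
      ofFun_sub (hs.dt.dt.memLp c2.dt_two.dt_one ht) (hs.dx.dx.memLp c2.dx_two.dx_one ht)
    have hint : ∀ w : ℝ → L2, ContinuousOn w (timeInterval T) →
        IntegrableOn (fun t => inner ℝ (w t)
          (ofFun fun x => dt (dt ψ) t x - dx (dx ψ) t x)) (timeInterval T) := by
      intro w hw
      refine integrableOn_timeInterval hT₁ ((hw.inner (ktt.sub kxx)).congr fun t ht => ?_)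
        fun t ht htT => ?_
      · simp only [e0 t ht]
        rfl
      · rw [e0 t ht, hs.dt.dt.ofFun_eq_zero ht htT, hs.dx.dx.ofFun_eq_zero ht htT, sub_self,
          inner_zero_right]
    simp only [inner_sub_left]
    rw [integral_sub (hint _ hX.continuousOn_toL2) (hint _ hY.continuousOn_toL2),
      (weak_iff ha hp hT hX hψ).1 (h.weak ψ hψ), hV.weak hT hf hψ, hV0, sub_self]
  have e1 : ∀ t ∈ timeInterval T, (wave t (V t)).1 = u t := fun t ht =>
    toL2_injective (sub_eq_zero.1 (hd t ht)).symm
  have e2 : ∀ t ∈ timeInterval T, (wave t (V t)).2 = ut t := fun t ht => by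
    refine (uniqueDiffOn_timeInterval T t ht).eq_deriv _ (hY.hasDeriv t ht) ?_
    exact (hX.hasDeriv t ht).congr (fun s hs => by rw [e1 s hs]) (by rw [e1 t ht])
  have e3 : ∀ t ∈ timeInterval T, wave t (V t) = (u t, ut t) := fun t ht =>
    Prod.ext (e1 t ht) (e2 t ht)
  refine ⟨V, fun t ht => ?_, ?_, e3⟩
  · have := hV t ht
    simp only [← e3 t ht] at this
    exact this
  -- At t = 0 the first components give u(0) = u₀, so the correction of the initial velocity
  -- vanishes.
  · have h0 := e3 0 h0T
    rw [wave_zero, hV0] at h0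
    have hu0 : u₀ = u 0 := congrArg Prod.fst h0
    rw [hV0, ← hu0, sub_self, ← sub_self (0 : L2),
      mulL2_sub (ha.continuous le_rfl) (ha.bound 0 le_rfl), sub_self, add_zero]

end

/-! ## Maximal solutions of ordinary differential equations -/

section

variable {E : Type*} [NormedAddCommGroup E] [NormedSpace ℝ E]

/-- The vector field `G` is continuous, and Lipschitz continuous in space on bounded sets. -/
structure LocallyLipschitzField (G : ℝ → E → E) : Prop where
  continuous : Continuous fun z : ℝ × E => G z.1 z.2
  lipschitz : ∀ T M : ℝ, ∃ K : ℝ, 0 ≤ K ∧ ∀ t ∈ Icc 0 T, ∀ x y : E, ‖x‖ ≤ M → ‖y‖ ≤ M →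
    ‖G t x - G t y‖ ≤ K * ‖x - y‖

/-- `V` solves `V' = G(t, V)` on `[0, T)`. -/
def IsIntegralCurve (G : ℝ → E → E) (T : EReal) (V : ℝ → E) : Prop :=
  ∀ t ∈ timeInterval T, HasDerivWithinAt V (G t (V t)) (timeInterval T) t

variable {G : ℝ → E → E} {T T' : EReal} {V W : ℝ → E}

theorem IsIntegralCurve.mono (h : IsIntegralCurve G T V) (hT : T' ≤ T) :
    IsIntegralCurve G T' V := fun t ht =>
  (h t (timeInterval_mono hT ht)).mono (timeInterval_mono hT)

theorem IsIntegralCurve.continuousOn (h : IsIntegralCurve G T V) :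
    ContinuousOn V (timeInterval T) := fun t ht => (h t ht).continuousWithinAt

theorem IsIntegralCurve.hasDerivWithinAt_Ici (h : IsIntegralCurve G T V) {t : ℝ}
    (ht : t ∈ timeInterval T) : HasDerivWithinAt V (G t (V t)) (Ici t) t :=
  ((hasDerivWithinAt_timeInterval_iff ht).1 (h t ht)).mono (Ici_subset_Ici.2 ht.1)

theorem IsIntegralCurve.eq (hG : LocallyLipschitzField G) (h : IsIntegralCurve G T V)
    (h' : IsIntegralCurve G T W) (h0 : V 0 = W 0) {t : ℝ} (ht : t ∈ timeInterval T) :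
    V t = W t := by
  have hsub := Icc_subset_timeInterval ht
  have hcV := h.continuousOn.mono hsub
  have hcW := h'.continuousOn.mono hsub
  obtain ⟨M₁, h1⟩ := isCompact_Icc.exists_bound_of_continuousOn hcV
  obtain ⟨M₂, h2⟩ := isCompact_Icc.exists_bound_of_continuousOn hcW
  obtain ⟨K, hK, hlip⟩ := hG.lipschitz t (max M₁ M₂)
  refine ODE_solution_unique_of_mem_Icc_right (v := G) (K := ⟨K, hK⟩)
    (s := fun _ => Metric.closedBall 0 (max M₁ M₂)) (fun s hs => ?_) hcV
    (fun s hs => h.hasDerivWithinAt_Ici (hsub (Ico_subset_Icc_self hs))) (fun s hs => ?_) hcW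
    (fun s hs => h'.hasDerivWithinAt_Ici (hsub (Ico_subset_Icc_self hs))) (fun s hs => ?_) h0
    (right_mem_Icc.2 ht.1)
  · refine LipschitzOnWith.of_dist_le_mul fun x hx y hy => ?_
    rw [dist_eq_norm, dist_eq_norm]
    exact hlip s (Ico_subset_Icc_self hs) x y (mem_closedBall_zero_iff.1 hx)
      (mem_closedBall_zero_iff.1 hy)
  · exact mem_closedBall_zero_iff.2 ((h1 s (Ico_subset_Icc_self hs)).trans (le_max_left _ _))
  · exact mem_closedBall_zero_iff.2 ((h2 s (Ico_subset_Icc_self hs)).trans (le_max_right _ _))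

/-- The point is uniformity: ε depends only on the time horizon T and the norm bound M, not on t₀ or
x. -/
theorem LocallyLipschitzField.exists_local [CompleteSpace E] (hG : LocallyLipschitzField G)
    (T M : ℝ) : ∃ ε : ℝ, 0 < ε ∧ ∀ t₀ ∈ Icc 0 T, ∀ x : E, ‖x‖ ≤ M → ∃ V : ℝ → E, V t₀ = x ∧
      ∀ t ∈ Icc t₀ (t₀ + ε), HasDerivWithinAt V (G t (V t)) (Icc t₀ (t₀ + ε)) t := by
  obtain ⟨K, hK, hlip⟩ := hG.lipschitz (T + 1) (|M| + 1)
  have hc0 : Continuous fun t => G t 0 := hG.continuous.comp (f := fun t : ℝ => (t, (0 : E)))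
    (by fun_prop)
  obtain ⟨B, hB⟩ := (isCompact_Icc (a := (0 : ℝ)) (b := T + 1)).exists_bound_of_continuousOn
    hc0.continuousOn
  set D : ℝ := |B| + K * (|M| + 1) with hD
  have hD0 : 0 ≤ D := by positivity
  have hbd : ∀ t ∈ Icc 0 (T + 1), ∀ x : E, ‖x‖ ≤ |M| + 1 → ‖G t x‖ ≤ D := by
    intro t ht x hx
    have h1 := hlip t ht x 0 hx (by rw [norm_zero]; positivity)
    rw [sub_zero] at h1
    have h2 := norm_le_norm_add_norm_sub' (G t x) (G t 0)
    have h3 := (hB t ht).trans (le_abs_self B)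
    have h4 := mul_le_mul_of_nonneg_left hx hK
    linarith
  -- The field is bounded by D on the unit ball around x, so during time 1/(D + 1) ≤ 1 a curve stays
  -- in that ball and before T + 1.
  refine ⟨1 / (D + 1), by positivity, fun t₀ ht₀ x hx => ?_⟩
  have hε : 1 / (D + 1) ≤ 1 := by
    rw [div_le_one (by positivity)]
    linarith
  have hI : ∀ t ∈ Icc t₀ (t₀ + 1 / (D + 1)), t ∈ Icc 0 (T + 1) := fun t ht =>
    ⟨ht₀.1.trans ht.1, by linarith [ht.2, ht₀.2]⟩
  have hball : ∀ y ∈ Metric.closedBall x 1, ‖y‖ ≤ |M| + 1 := fun y hy => by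
    have := norm_le_norm_add_norm_sub' y x
    rw [Metric.mem_closedBall, dist_eq_norm] at hy
    linarith [le_abs_self M]
  have hle : t₀ ≤ t₀ + 1 / (D + 1) := le_add_of_nonneg_right (by positivity)
  have hPL : IsPicardLindelof G (tmin := t₀) (tmax := t₀ + 1 / (D + 1)) ⟨t₀, left_mem_Icc.2 hle⟩ x
      1 0 ⟨D, hD0⟩ ⟨K, hK⟩ := by
    refine ⟨fun t ht => LipschitzOnWith.of_dist_le_mul fun y hy z hz => ?_, fun y _ => ?_,
      fun t ht y hy => hbd t (hI t ht) y (hball y hy), ?_⟩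
    · rw [dist_eq_norm, dist_eq_norm]
      exact hlip t (hI t ht) y z (hball y hy) (hball z hz)
    · exact (hG.continuous.comp (f := fun t : ℝ => (t, y)) (by fun_prop)).continuousOn
    · have e : max (t₀ + 1 / (D + 1) - t₀) (t₀ - t₀) = 1 / (D + 1) := by
        rw [sub_self, add_sub_cancel_left, max_eq_left (by positivity)]
      simp only [e, NNReal.coe_one, NNReal.coe_zero, sub_zero]
      change D * (1 / (D + 1)) ≤ 1
      rw [mul_one_div, div_le_one (by positivity)]
      linarith
  exact hPL.exists_eq_forall_mem_Icc_hasDerivWithinAt₀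

/-- Extension of an integral curve by a local solution. -/
theorem IsIntegralCurve.extend {t₀ ε : ℝ} (hε : 0 < ε) (h : IsIntegralCurve G T V)
    (ht₀ : t₀ ∈ timeInterval T) (hW0 : W t₀ = V t₀)
    (hW : ∀ t ∈ Icc t₀ (t₀ + ε), HasDerivWithinAt W (G t (W t)) (Icc t₀ (t₀ + ε)) t) :
    IsIntegralCurve G ((t₀ + ε : ℝ) : EReal) fun t => if t ≤ t₀ then V t else W t := by
  set U : ℝ → E := fun t => if t ≤ t₀ then V t else W t with hU
  have eV : ∀ t, t ≤ t₀ → U t = V t := fun t ht => if_pos ht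
  have eW : ∀ t, t₀ ≤ t → U t = W t := fun t ht => by
    rcases ht.eq_or_lt with h1 | h1
    · subst h1
      rw [eV _ le_rfl, hW0]
    · exact if_neg (not_le.2 h1)
  have d1 : ∀ t ∈ Icc 0 t₀, HasDerivWithinAt U (G t (U t)) (Icc 0 t₀) t := fun t ht => by
    rw [eV t ht.2]
    exact ((h t (Icc_subset_timeInterval ht₀ ht)).mono (Icc_subset_timeInterval ht₀)).congr
      (fun s hs => eV s hs.2) (eV t ht.2)
  have d2 : ∀ t ∈ Icc t₀ (t₀ + ε), HasDerivWithinAt U (G t (U t)) (Icc t₀ (t₀ + ε)) t :=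
    fun t ht => by
      rw [eW t ht.1]
      exact (hW t ht).congr (fun s hs => eW s hs.1) (eW t ht.1)
  intro t ht
  rw [hasDerivWithinAt_timeInterval_iff ht]
  rw [timeInterval_coe] at ht
  rcases lt_trichotomy t t₀ with h1 | h1 | h1
  · refine (d1 t ⟨ht.1, h1.le⟩).mono_of_mem_nhdsWithin ?_
    filter_upwards [self_mem_nhdsWithin, mem_nhdsWithin_of_mem_nhds (Iio_mem_nhds h1)]
      with s hs hs' using ⟨hs, le_of_lt hs'⟩
  -- At the junction both one-sided derivatives equal G at the common value.
  · subst h1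
    refine ((d1 t (right_mem_Icc.2 ht.1)).union (d2 t (left_mem_Icc.2
      (by linarith)))).mono_of_mem_nhdsWithin ?_
    filter_upwards [self_mem_nhdsWithin, mem_nhdsWithin_of_mem_nhds (Iio_mem_nhds ht.2)]
      with s hs hs'
    rcases le_total s t with h2 | h2
    · exact Or.inl ⟨hs, h2⟩
    · exact Or.inr ⟨h2, le_of_lt hs'⟩
  · refine (d2 t ⟨h1.le, ht.2.le⟩).mono_of_mem_nhdsWithin ?_
    filter_upwards [mem_nhdsWithin_of_mem_nhds (Ioo_mem_nhds h1 ht.2)]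
      with s hs using Ioo_subset_Icc_self hs

/-- Integral curves with the same initial value can be glued together. -/
theorem exists_isIntegralCurve_of_forall (hG : LocallyLipschitzField G) {V₀ : E}
    (h : ∀ t ∈ timeInterval T, ∃ T' : ℝ, t < T' ∧
      ∃ V, IsIntegralCurve G (T' : EReal) V ∧ V 0 = V₀) (hT : 0 < T) :
    ∃ V, IsIntegralCurve G T V ∧ V 0 = V₀ := by
  choose! τ hτ Φ hΦ hΦ0 using h
  have key : ∀ t ∈ timeInterval T, ∀ s, 0 ≤ s → s < τ t → s ∈ timeInterval T →
      Φ s s = Φ t s := by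
    intro t ht s hs hst hsT
    have hmin : s ∈ timeInterval ((min (τ s) (τ t) : ℝ) : EReal) := by
      rw [timeInterval_coe]
      exact ⟨hs, lt_min (hτ s hsT) hst⟩
    exact ((hΦ s hsT).mono (EReal.coe_le_coe_iff.2 (min_le_left _ _))).eq hG
      ((hΦ t ht).mono (EReal.coe_le_coe_iff.2 (min_le_right _ _)))
      (by rw [hΦ0 s hsT, hΦ0 t ht]) hmin
  -- The diagonal choice coincides near each t with the single curve Φ t, by uniqueness.
  refine ⟨fun t => Φ t t, fun t ht => ?_, hΦ0 0 (zero_mem_timeInterval hT)⟩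
  have ht' : t ∈ timeInterval (τ t : EReal) := by
    rw [timeInterval_coe]
    exact ⟨ht.1, hτ t ht⟩
  have h1 := (hasDerivWithinAt_timeInterval_iff ht').1 (hΦ t ht t ht')
  rw [hasDerivWithinAt_timeInterval_iff ht]
  refine h1.congr_of_eventuallyEq ?_ rfl
  filter_upwards [timeInterval_mem_nhdsWithin ht, mem_nhdsWithin_of_mem_nhds
    (Iio_mem_nhds (hτ t ht))] with s hs hs'
  exact key t ht s hs.1 hs' hs

/-- If there is no global integral curve, then the maximal one blows up in finite time. -/
theorem LocallyLipschitzField.exists_blowup [CompleteSpace E] (hG : LocallyLipschitzField G)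
    (V₀ : E) (hno : ¬∃ V, IsIntegralCurve G ⊤ V ∧ V 0 = V₀) :
    ∃ Tstar : ℝ, 0 < Tstar ∧ ∃ V, IsIntegralCurve G (Tstar : EReal) V ∧ V 0 = V₀ ∧
      Tendsto (fun t => ‖V t‖) (𝓝[<] Tstar) atTop := by
  set S : Set ℝ := {T | ∃ V, IsIntegralCurve G (T : EReal) V ∧ V 0 = V₀} with hS
  have hext : ∀ T : ℝ, 0 < T → ∀ V, IsIntegralCurve G (T : EReal) V → V 0 = V₀ →
      ∀ M : ℝ, ∃ ε : ℝ, 0 < ε ∧ ∀ t₀ ∈ timeInterval (T : EReal), ‖V t₀‖ ≤ M → t₀ + ε ∈ S := by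
    intro T hT V hV hV0 M
    obtain ⟨ε, hε, hloc⟩ := hG.exists_local T M
    refine ⟨ε, hε, fun t₀ ht₀ hM => ?_⟩
    have ht₀' := ht₀
    rw [timeInterval_coe] at ht₀'
    obtain ⟨W, hW0, hW⟩ := hloc t₀ (Ico_subset_Icc_self ht₀') _ hM
    exact ⟨_, hV.extend hε ht₀ hW0 hW, by rw [if_pos ht₀.1, hV0]⟩
  obtain ⟨T₁, hT₁, hT₁S⟩ : ∃ T, 0 < T ∧ T ∈ S := by
    obtain ⟨ε, hε, hloc⟩ := hG.exists_local 0 ‖V₀‖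
    obtain ⟨W, hW0, hW⟩ := hloc 0 ⟨le_rfl, le_rfl⟩ V₀ le_rfl
    rw [zero_add] at hW
    refine ⟨ε, hε, W, fun t ht => ?_, hW0⟩
    rw [timeInterval_coe] at ht ⊢
    exact (hW t (Ico_subset_Icc_self ht)).mono Ico_subset_Icc_self
  have hbdd : BddAbove S := by
    by_contra hcon
    refine hno (exists_isIntegralCurve_of_forall hG (fun t _ => ?_) EReal.zero_lt_top)
    obtain ⟨T', hT', hlt⟩ := not_bddAbove_iff.1 hcon t
    exact ⟨T', hlt, hT'⟩
  have hpos : 0 < sSup S := hT₁.trans_le (le_csSup hbdd hT₁S)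
  obtain ⟨V, hV, hV0⟩ := exists_isIntegralCurve_of_forall (T := (sSup S : ℝ)) hG
    (fun t ht => by
      rw [timeInterval_coe] at ht
      obtain ⟨T', hT', hlt⟩ := exists_lt_of_lt_csSup ⟨T₁, hT₁S⟩ ht.2
      exact ⟨T', hlt, hT'⟩) (by exact_mod_cast hpos)
  refine ⟨sSup S, hpos, V, hV, hV0, tendsto_atTop.2 fun M => ?_⟩
  -- If ‖V(t)‖ ≤ M at a time within ε of sup S, the curve could be continued to t + ε > sup S. So
  -- ‖V‖ exceeds every M near the end, which gives a true limit and not only an unbounded norm.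
  obtain ⟨ε, hε, hS'⟩ := hext _ hpos V hV hV0 M
  have hnear : Ioo (max 0 (sSup S - ε)) (sSup S) ∈ 𝓝[<] (sSup S) :=
    Ioo_mem_nhdsLT (max_lt hpos (by linarith))
  filter_upwards [hnear] with t ht
  by_contra hcon
  have h1 : t + ε ∈ S := hS' t (by
    rw [timeInterval_coe]
    exact ⟨(le_max_left _ _).trans ht.1.le, ht.2⟩) (not_le.1 hcon).le
  have h2 := le_csSup hbdd h1
  linarith [(le_max_right 0 (sSup S - ε)).trans_lt ht.1]

end

/-! ## The blow-up alternative -/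

section

variable {L p : ℝ} {a : ℝ → ℝ → ℝ}

/-- The vector field of the damped wave equation in the interaction picture. -/
def waveField (a : ℝ → ℝ → ℝ) (p t : ℝ) (V : H1 × L2) : H1 × L2 :=
  wave (-t) (0, source a p t (wave t V))

theorem locallyLipschitzField_waveField (ha : BoundedDamping L a) (hp : 1 < p) :
    LocallyLipschitzField (waveField a p) := by
  refine ⟨?_, fun T M => ?_⟩
  · have h1 : Continuous fun z : ℝ × (H1 × L2) => source a p z.1 (wave z.1 z.2) := by
      have h := continuous_fst.prodMk continuous_wave
      have h' := Continuous.comp (f := fun z : ℝ × (H1 × L2) => (z.1, wave z.1 z.2))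
        (continuous_source ha hp) h
      exact h'
    have h2 : Continuous fun z : ℝ × (H1 × L2) =>
        ((0 : H1), source a p z.1 (wave z.1 z.2)) := continuous_const.prodMk h1
    rw [← continuousOn_univ]
    exact (continuous_fst.neg.continuousOn).wave h2.continuousOn
  · have hL : 0 ≤ L := (abs_nonneg _).trans (ha.bound 0 le_rfl 0)
    set M' : ℝ := (3 + |T|) * |M| with hM'
    have hM0 : 0 ≤ M' := by positivity
    set K : ℝ := p * (4 * M') ^ (p - 1) + L with hK
    have hK0 : 0 ≤ K := add_nonneg (mul_nonneg (by linarith) (by positivity)) hL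
    refine ⟨(3 + |T|) * (K * (3 + |T|)), by positivity, fun t ht x y hx hy => ?_⟩
    have hT : 3 + |t| ≤ 3 + |T| := by
      rw [abs_of_nonneg ht.1]
      linarith [ht.2, le_abs_self T]
    have hw : ∀ z : H1 × L2, ‖wave t z‖ ≤ (3 + |T|) * ‖z‖ := fun z =>
      (norm_wave_le t z).trans (mul_le_mul_of_nonneg_right hT (norm_nonneg z))
    have hw' : ∀ z : H1 × L2, ‖wave (-t) z‖ ≤ (3 + |T|) * ‖z‖ := fun z =>
      (norm_wave_le (-t) z).trans (by
        rw [abs_neg]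
        exact mul_le_mul_of_nonneg_right hT (norm_nonneg z))
    have hb : ∀ z : H1 × L2, ‖z‖ ≤ M → ‖wave t z‖ ≤ M' := fun z hz =>
      (hw z).trans (mul_le_mul_of_nonneg_left (hz.trans (le_abs_self M)) (by positivity))
    have h1 := norm_source_sub_le ha hp t (hb x hx) (hb y hy)
    rw [waveField, waveField, ← wave_sub, mul_assoc]
    refine (hw' _).trans (mul_le_mul_of_nonneg_left ?_ (by positivity))
    rw [Prod.mk_sub_mk, sub_self, Prod.norm_mk, norm_zero, max_eq_right (norm_nonneg _)]
    refine h1.trans ?_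
    rw [mul_assoc, ← wave_sub]
    exact mul_le_mul_of_nonneg_left (hw _) hK0

theorem blowsUpInFiniteTime_of_no_global (ha : BoundedDamping L a) (hp : 1 < p) (u₀ : H1) (u₁ : L2)
    (hno : ∀ u ut, ¬IsSolution a p u₀ u₁ ⊤ u ut) : BlowsUpInFiniteTime a p u₀ u₁ := by
  have hG := locallyLipschitzField_waveField ha hp
  obtain ⟨Tstar, hpos, V, hV, hV0, hlim⟩ := hG.exists_blowup (u₀, u₁) (by
    rintro ⟨V, hV, hV0⟩
    exact hno _ _ (NonlinearFlow.isSolution (T := ⊤) hV ha hp (by simp) hV0))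
  refine ⟨Tstar, hpos, fun t => (wave t (V t)).1, fun t => (wave t (V t)).2,
    NonlinearFlow.isSolution (T := Tstar) hV ha hp (EReal.coe_pos.2 hpos) hV0, fun T v vt hv => ?_, ?_⟩
  · obtain ⟨W, hW, hW0, hWv⟩ := hv.exists_nonlinearFlow ha hp
    have heq : ∀ t ∈ timeInterval T, t < Tstar → W t = V t := by
      intro t ht htT
      refine IsIntegralCurve.eq (T := min T Tstar) hG (IsIntegralCurve.mono hW (min_le_left _ _))
        (hV.mono (min_le_right _ _)) (by rw [hW0, hV0]) ⟨ht.1, lt_min ht.2 ?_⟩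
      exact EReal.coe_lt_coe_iff.2 htT
    -- A solution alive at `Tstar` would have an integral curve continuous there, yet equal to V
    -- before `Tstar`, where the norm diverges.
    have hT : T ≤ Tstar := by
      by_contra hcon
      have hmem : Tstar ∈ timeInterval T := ⟨hpos.le, not_le.1 hcon⟩
      have h1 : Tendsto (fun t => ‖W t‖) (𝓝[<] Tstar) (𝓝 ‖W Tstar‖) :=
        ((hW Tstar hmem).continuousWithinAt.continuousAt
          (timeInterval_mem_nhds hmem hpos)).norm.tendsto.mono_left nhdsWithin_le_nhds
      have h2 : Tendsto (fun t => ‖W t‖) (𝓝[<] Tstar) atTop := by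
        refine hlim.congr' ?_
        filter_upwards [Ioo_mem_nhdsLT hpos] with t ht
        rw [heq t (mem_timeInterval_of_le hmem ht.1.le ht.2.le) ht.2]
      exact not_tendsto_nhds_of_tendsto_atTop h2 _ h1
    refine ⟨hT, fun t ht => ?_⟩
    have h1 := hWv t ht
    have h2 : t < Tstar := EReal.coe_lt_coe_iff.1 (ht.2.trans_le hT)
    rw [heq t ht h2] at h1
    exact ⟨(congrArg Prod.fst h1).symm, (congrArg Prod.snd h1).symm⟩
  -- Divergence of V passes to (u, u_t) = S(t) V since S(-t) has norm at most 3 + T* on [0, T*).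
  · refine tendsto_atTop_mono' _ ?_ (hlim.atTop_div_const (by positivity : 0 < 3 + Tstar))
    filter_upwards [Ioo_mem_nhdsLT hpos] with t ht
    rw [div_le_iff₀ (by positivity)]
    have h1 : ‖V t‖ ≤ (3 + |(-t)|) * ‖wave t (V t)‖ := by
      have := norm_wave_le (-t) (wave t (V t))
      rwa [wave_neg_wave] at this
    rw [abs_neg, abs_of_pos ht.1] at h1
    have h2 : ‖wave t (V t)‖ ≤ ‖(wave t (V t)).1‖ + ‖(wave t (V t)).2‖ := by
      rw [Prod.norm_def]
      exact max_le_add_of_nonneg (norm_nonneg _) (norm_nonneg _)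
    calc ‖V t‖ ≤ (3 + t) * ‖wave t (V t)‖ := h1
      _ ≤ (3 + Tstar) * ‖wave t (V t)‖ :=
        mul_le_mul_of_nonneg_right (by linarith [ht.2]) (norm_nonneg _)
      _ ≤ (3 + Tstar) * (‖(wave t (V t)).1‖ + ‖(wave t (V t)).2‖) :=
        mul_le_mul_of_nonneg_left h2 (by positivity)
      _ = _ := mul_comm _ _

end

/-! ## Cutoff functions -/

/-- A smooth even function with values in `[0, 1]`, equal to `1` on `[-1, 1]` and to `0` outside
`[-2, 2]`. -/
def bump (s : ℝ) : ℝ := Real.smoothTransition (2 - s) * Real.smoothTransition (2 + s)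

theorem contDiff_bump {n : ℕ∞} : ContDiff ℝ n bump :=
  (Real.smoothTransition.contDiff.comp (contDiff_const.sub contDiff_id)).mul
    (Real.smoothTransition.contDiff.comp (contDiff_const.add contDiff_id))

theorem bump_nonneg (s : ℝ) : 0 ≤ bump s :=
  mul_nonneg (Real.smoothTransition.nonneg _) (Real.smoothTransition.nonneg _)

theorem bump_le_one (s : ℝ) : bump s ≤ 1 :=
  mul_le_one₀ (Real.smoothTransition.le_one _) (Real.smoothTransition.nonneg _)
    (Real.smoothTransition.le_one _)

theorem bump_eq_one {s : ℝ} (h : |s| ≤ 1) : bump s = 1 := by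
  obtain ⟨h1, h2⟩ := abs_le.1 h
  rw [bump, Real.smoothTransition.one_of_one_le (by linarith),
    Real.smoothTransition.one_of_one_le (by linarith), one_mul]

theorem bump_eq_zero {s : ℝ} (h : 2 ≤ |s|) : bump s = 0 := by
  rcases le_abs.1 h with h | h
  · rw [bump, Real.smoothTransition.zero_of_nonpos (by linarith), zero_mul]
  · rw [bump, Real.smoothTransition.zero_of_nonpos (x := 2 + s) (by linarith), mul_zero]

theorem bump_abs (s : ℝ) : bump |s| = bump s := by
  rcases abs_cases s with ⟨h, -⟩ | ⟨h, -⟩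
  · rw [h]
  · rw [h, bump, bump, sub_neg_eq_add, ← sub_eq_add_neg, mul_comm]

theorem bump_antitoneOn : AntitoneOn bump (Ici 1) := by
  intro s hs t ht hst
  have hs' : (1 : ℝ) ≤ s := hs
  have ht' : (1 : ℝ) ≤ t := ht
  rw [bump, bump, Real.smoothTransition.one_of_one_le (x := 2 + s) (by linarith),
    Real.smoothTransition.one_of_one_le (x := 2 + t) (by linarith), mul_one, mul_one]
  exact Real.smoothTransition.monotone (by linarith)

theorem hasCompactSupport_bump : HasCompactSupport bump :=
  HasCompactSupport.intro (K := Icc (-2) 2) isCompact_Icc fun s hs => bump_eq_zero (by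
    rw [mem_Icc, ← abs_le, not_le] at hs
    exact hs.le)

section

variable (n : ℕ)

/-- A power of `bump`. -/
def cutoff (s : ℝ) : ℝ := bump s ^ (n + 2)

theorem contDiff_cutoff {m : ℕ∞} : ContDiff ℝ m (cutoff n) := contDiff_bump.pow _

theorem hasDerivAt_cutoff (s : ℝ) : HasDerivAt (cutoff n) (deriv (cutoff n) s) s :=
  ((contDiff_cutoff n (m := 1)).differentiable one_ne_zero).differentiableAt.hasDerivAt

theorem contDiff_deriv_cutoff : ContDiff ℝ 1 (deriv (cutoff n)) :=
  (contDiff_succ_iff_deriv.1 (contDiff_cutoff n (m := 2))).2.2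

theorem hasDerivAt_deriv_cutoff (s : ℝ) :
    HasDerivAt (deriv (cutoff n)) (deriv (deriv (cutoff n)) s) s :=
  ((contDiff_deriv_cutoff n).differentiable one_ne_zero).differentiableAt.hasDerivAt

theorem cutoff_nonneg (s : ℝ) : 0 ≤ cutoff n s := pow_nonneg (bump_nonneg s) _

theorem cutoff_eq_one {s : ℝ} (h : |s| ≤ 1) : cutoff n s = 1 := by
  rw [cutoff, bump_eq_one h, one_pow]

theorem cutoff_eq_zero {s : ℝ} (h : 2 ≤ |s|) : cutoff n s = 0 := by
  rw [cutoff, bump_eq_zero h, zero_pow (by positivity)]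

theorem deriv_cutoff_eq_zero {s : ℝ} (h : |s| < 1) : deriv (cutoff n) s = 0 := by
  have hev : cutoff n =ᶠ[𝓝 s] fun _ => 1 := by
    filter_upwards [(isOpen_lt continuous_abs continuous_const).mem_nhds h] with r hr
      using cutoff_eq_one n (le_of_lt hr)
  rw [hev.deriv_eq, deriv_const]

theorem deriv_deriv_cutoff_eq_zero {s : ℝ} (h : |s| < 1) : deriv (deriv (cutoff n)) s = 0 := by
  have hev : deriv (cutoff n) =ᶠ[𝓝 s] fun _ => 0 := by
    filter_upwards [(isOpen_lt continuous_abs continuous_const).mem_nhds h] with r hr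
      using deriv_cutoff_eq_zero n hr
  rw [hev.deriv_eq, deriv_const]

/-- Two derivatives of the power n + 2 still leave a factor `bump` to the n. This lets the
derivatives of the cutoff be absorbed by a power of the cutoff itself. -/
theorem exists_cutoff_bound : ∃ A : ℝ, 0 ≤ A ∧ ∀ s, |cutoff n s| ≤ A * bump s ^ n ∧
    |deriv (cutoff n) s| ≤ A * bump s ^ n ∧ |deriv (deriv (cutoff n)) s| ≤ A * bump s ^ n := by
  have hb1 : ContDiff ℝ 1 (deriv bump) :=
    (contDiff_succ_iff_deriv.1 (contDiff_bump (n := 2))).2.2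
  have d0 : ∀ s, HasDerivAt bump (deriv bump s) s := fun s =>
    ((contDiff_bump (n := 1)).differentiable one_ne_zero).differentiableAt.hasDerivAt
  have d1 : ∀ s, HasDerivAt (deriv bump) (deriv (deriv bump) s) s := fun s =>
    (hb1.differentiable one_ne_zero).differentiableAt.hasDerivAt
  obtain ⟨A₁, h1⟩ := hb1.continuous.bounded_above_of_compact_support hasCompactSupport_bump.deriv
  obtain ⟨A₂, h2⟩ := (hb1.continuous_deriv le_rfl).bounded_above_of_compact_support
    hasCompactSupport_bump.deriv.deriv
  have hA1 := (norm_nonneg _).trans (h1 0)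
  have hA2 := (norm_nonneg _).trans (h2 0)
  have e1 : ∀ s, deriv (cutoff n) s = (n + 2) * (bump s ^ (n + 1) * deriv bump s) := fun s => by
    have : HasDerivAt (cutoff n) _ s := (d0 s).pow (n + 2)
    rw [this.deriv]
    push_cast
    ring_nf
  have e2 : ∀ s, deriv (deriv (cutoff n)) s = (n + 2) * ((n + 1) * bump s ^ n * deriv bump s ^ 2
      + bump s ^ (n + 1) * deriv (deriv bump) s) := fun s => by
    have h3 : HasDerivAt (fun s => bump s ^ (n + 1)) _ s := (d0 s).pow (n + 1)
    have h4 := (h3.mul (d1 s)).const_mul ((n : ℝ) + 2)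
    rw [show deriv (cutoff n) = _ from funext e1]
    refine h4.deriv.trans ?_
    push_cast
    ring
  refine ⟨1 + (n + 2) * A₁ + (n + 2) * ((n + 1) * A₁ ^ 2 + A₂), by positivity, fun s => ?_⟩
  have hw0 := bump_nonneg s
  have hw1 := bump_le_one s
  have hn := pow_nonneg hw0 n
  have hs1 : bump s ^ (n + 1) ≤ bump s ^ n := pow_le_pow_of_le_one hw0 hw1 (by lia)
  have hs2 : bump s ^ (n + 2) ≤ bump s ^ n := pow_le_pow_of_le_one hw0 hw1 (by lia)
  have h1s : |deriv bump s| ≤ A₁ := h1 s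
  have h2s : |deriv (deriv bump) s| ≤ A₂ := h2 s
  have hA3 : 0 ≤ (n + 2) * A₁ := by positivity
  have hA4 : 0 ≤ (n + 2) * ((n + 1) * A₁ ^ 2 + A₂) := by positivity
  refine ⟨?_, ?_, ?_⟩
  · rw [abs_of_nonneg (cutoff_nonneg n s), cutoff]
    refine hs2.trans (le_mul_of_one_le_left hn (by linarith))
  · rw [e1, abs_mul, abs_mul, abs_of_nonneg (pow_nonneg hw0 _),
      abs_of_nonneg (by positivity : (0 : ℝ) ≤ n + 2)]
    calc (n + 2) * (bump s ^ (n + 1) * |deriv bump s|) ≤ (n + 2) * (bump s ^ n * A₁) := by gcongr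
      _ = ((n + 2) * A₁) * bump s ^ n := by ring
      _ ≤ _ := mul_le_mul_of_nonneg_right (by linarith) hn
  · rw [e2, abs_mul, abs_of_nonneg (by positivity : (0 : ℝ) ≤ n + 2)]
    have h5 : |(n + 1) * bump s ^ n * deriv bump s ^ 2 + bump s ^ (n + 1) * deriv (deriv bump) s|
        ≤ (n + 1) * bump s ^ n * A₁ ^ 2 + bump s ^ n * A₂ := by
      refine (abs_add_le _ _).trans (add_le_add ?_ ?_)
      · rw [abs_mul, abs_of_nonneg (by positivity : (0 : ℝ) ≤ (n + 1) * bump s ^ n), abs_pow]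
        gcongr
      · rw [abs_mul, abs_of_nonneg (pow_nonneg hw0 _)]
        gcongr
    calc _ ≤ (n + 2) * ((n + 1) * bump s ^ n * A₁ ^ 2 + bump s ^ n * A₂) := by gcongr
      _ = ((n + 2) * ((n + 1) * A₁ ^ 2 + A₂)) * bump s ^ n := by ring
      _ ≤ _ := mul_le_mul_of_nonneg_right (by linarith) hn

theorem deriv_cutoff_nonpos {s : ℝ} (hs : 1 < s) : deriv (cutoff n) s ≤ 0 := by
  have h : AntitoneOn (cutoff n) (Ici 1) := fun s hs t ht hst =>
    pow_le_pow_left₀ (bump_nonneg t) (bump_antitoneOn hs ht hst) _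
  rw [← derivWithin_of_mem_nhds (Ici_mem_nhds hs)]
  exact h.derivWithin_nonpos

/-- Layer-cake formula: the cutoff is an average of indicators of intervals [-r, r], with -χ' as a
probability density on (1, 2]. -/
theorem cutoff_eq_integral {y : ℝ} (hy : 0 ≤ y) :
    ∫ r in Ioc (1 : ℝ) 2, -deriv (cutoff n) r * (if y ≤ r then 1 else 0) = cutoff n y := by
  have hc : Continuous fun r => -deriv (cutoff n) r := (contDiff_deriv_cutoff n).continuous.neg
  have hftc : ∀ m ≤ (2 : ℝ), ∫ r in Ioc m 2, -deriv (cutoff n) r = cutoff n m := by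
    intro m hm
    rw [← intervalIntegral.integral_of_le hm, intervalIntegral.integral_eq_sub_of_hasDerivAt
      (f := fun r => -cutoff n r) (fun r _ => (hasDerivAt_cutoff n r).neg)
      (hc.intervalIntegrable _ _), cutoff_eq_zero n (s := 2) (by norm_num)]
    ring
  have e : ∀ r, -deriv (cutoff n) r * (if y ≤ r then 1 else 0)
      = indicator (Ici y) (fun r => -deriv (cutoff n) r) r := fun r => by
    by_cases h : y ≤ r
    · rw [if_pos h, mul_one, indicator_of_mem (mem_Ici.2 h)]
    · rw [if_neg h, mul_zero, indicator_of_notMem (by simpa using h)]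
  simp only [e]
  rw [setIntegral_indicator measurableSet_Ici]
  rcases le_or_gt y 1 with h1 | h1
  · rw [show Ioc (1 : ℝ) 2 ∩ Ici y = Ioc 1 2 from
      inter_eq_left.2 fun r hr => h1.trans hr.1.le, hftc 1 one_le_two,
      cutoff_eq_one n (by simp), cutoff_eq_one n (by rwa [abs_of_nonneg hy])]
  · rw [show Ioc (1 : ℝ) 2 ∩ Ici y = Icc y 2 from by
      ext r
      simp only [mem_inter_iff, mem_Ioc, mem_Ici, mem_Icc]
      constructor
      · rintro ⟨⟨-, h2⟩, h3⟩
        exact ⟨h3, h2⟩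
      · rintro ⟨h3, h2⟩
        exact ⟨⟨h1.trans_le h3, h2⟩, h3⟩, integral_Icc_eq_integral_Ioc]
    rcases le_or_gt y 2 with h2 | h2
    · exact hftc y h2
    · rw [Ioc_eq_empty (not_lt.2 h2.le), setIntegral_empty,
        cutoff_eq_zero n (by rw [abs_of_nonneg hy]; exact h2.le)]

/-- A lower bound for all large symmetric integrals passes to the integrals against the cutoff
functions. -/
theorem le_integral_mul_cutoff {D : ℝ → ℝ} {c R : ℝ} (hR : 0 < R)
    (hD : IntegrableOn D (Icc (-(2 * R)) (2 * R)))
    (hc : ∀ r, R ≤ r → c ≤ ∫ x in (-r)..r, D x) : c ≤ ∫ x, D x * cutoff n (x / R) := by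
  set D' : ℝ → ℝ := indicator (Icc (-(2 * R)) (2 * R)) D with hD'
  have hDi : Integrable D' := hD.integrable_indicator measurableSet_Icc
  have hcont : Continuous fun r => -deriv (cutoff n) r := (contDiff_deriv_cutoff n).continuous.neg
  have hρ : Integrable (fun r => -deriv (cutoff n) r) (volume.restrict (Ioc 1 2)) :=
    (hcont.integrableOn_Icc).mono_set Ioc_subset_Icc_self
  -- D is only integrable locally. Truncating it to [-2R, 2R], outside of which the cutoff vanishes,
  -- permits Fubini.
  set F : ℝ → ℝ → ℝ := fun x r => D' x * (-deriv (cutoff n) r * (if |x / R| ≤ r then 1 else 0))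
    with hF
  have hFi : Integrable (Function.uncurry F) (volume.prod (volume.restrict (Ioc 1 2))) := by
    have hm : MeasurableSet {z : ℝ × ℝ | |z.1 / R| ≤ z.2} :=
      measurableSet_le (by fun_prop) measurable_snd
    refine ((hDi.mul_prod hρ).indicator hm).congr (Eventually.of_forall fun z => ?_)
    by_cases h : |z.1 / R| ≤ z.2
    · simp only [Function.uncurry, hF, indicator_of_mem (show z ∈ {z : ℝ × ℝ | |z.1 / R| ≤ z.2}
        from h), if_pos h, mul_one]
    · simp only [Function.uncurry, hF, indicator_of_notMem
        (show z ∉ {z : ℝ × ℝ | |z.1 / R| ≤ z.2} from h), if_neg h, mul_zero]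
  have e1 : ∫ x, D x * cutoff n (x / R) = ∫ x, ∫ r in Ioc (1 : ℝ) 2, F x r := by
    refine integral_congr_ae (Eventually.of_forall fun x => ?_)
    simp only [hF]
    rw [integral_const_mul, cutoff_eq_integral n (abs_nonneg _)]
    have : cutoff n |x / R| = cutoff n (x / R) := by rw [cutoff, cutoff, bump_abs]
    rw [this]
    by_cases hx : x ∈ Icc (-(2 * R)) (2 * R)
    · rw [hD', indicator_of_mem hx]
    · have h2 : 2 ≤ |x / R| := by
        rw [mem_Icc, ← abs_le, not_le] at hx
        rw [abs_div, abs_of_pos hR, le_div_iff₀ hR]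
        exact hx.le
      rw [cutoff_eq_zero n h2, mul_zero, mul_zero]
  have e2 : ∀ r ∈ Ioc (1 : ℝ) 2, ∫ x, F x r
      = -deriv (cutoff n) r * ∫ x in (-(r * R))..(r * R), D x := by
    intro r hr
    have hrR : -(r * R) ≤ r * R := by nlinarith [hr.1]
    rw [intervalIntegral.integral_of_le hrR, ← integral_Icc_eq_integral_Ioc,
      ← integral_indicator measurableSet_Icc, ← integral_const_mul]
    refine integral_congr_ae (Eventually.of_forall fun x => ?_)
    simp only [hF]
    by_cases hx : |x / R| ≤ r
    · have hx' : |x| ≤ r * R := by rwa [abs_div, abs_of_pos hR, div_le_iff₀ hR] at hx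
      have hx2 : |x| ≤ 2 * R := hx'.trans (mul_le_mul_of_nonneg_right hr.2 hR.le)
      rw [if_pos hx, hD', indicator_of_mem (mem_Icc.2 (abs_le.1 hx2)),
        indicator_of_mem (mem_Icc.2 (abs_le.1 hx'))]
      ring
    · have hx' : x ∉ Icc (-(r * R)) (r * R) := fun hmem => hx (by
        rw [abs_div, abs_of_pos hR, div_le_iff₀ hR]
        exact abs_le.2 hmem)
      rw [if_neg hx, indicator_of_notMem hx', mul_zero, mul_zero]
  have e3 : ∫ r in Ioc (1 : ℝ) 2, -deriv (cutoff n) r = 1 := by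
    have := cutoff_eq_integral n (y := 0) le_rfl
    rw [cutoff_eq_one n (by simp)] at this
    refine Eq.trans ?_ this
    refine setIntegral_congr_fun measurableSet_Ioc fun r hr => ?_
    rw [if_pos (zero_le_one.trans hr.1.le), mul_one]
  rw [e1, integral_integral_swap hFi]
  -- The integral against the cutoff is an average over r ∈ (1, 2] of integrals over [-rR, rR], each
  -- at least c. The limit inferior along symmetric intervals thus suffices, with no integrability
  -- of the data term on ℝ.
  calc c = ∫ r in Ioc (1 : ℝ) 2, -deriv (cutoff n) r * c := by
        rw [integral_mul_const, e3, one_mul]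
    _ ≤ ∫ r in Ioc (1 : ℝ) 2, ∫ x, F x r := by
        refine setIntegral_mono_on (hρ.mul_const c) hFi.integral_prod_right measurableSet_Ioc
          fun r hr => ?_
        rw [e2 r hr]
        refine mul_le_mul_of_nonneg_left (hc _ ?_)
          (neg_nonneg.2 (deriv_cutoff_nonpos n hr.1))
        nlinarith [hr.1]

end

/-! ## Auxiliary inequalities -/

/-- Young's inequality with a parameter. -/
theorem mul_le_rpow_add_rpow {p X Y m : ℝ} (hp : 1 < p) (hX : 0 ≤ X) (hY : 0 ≤ Y) (hm : 0 < m) :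
    X * Y ≤ m * X ^ p + m ^ (-(1 / (p - 1))) * Y ^ (1 + 1 / (p - 1)) := by
  have hp1 : 0 < p - 1 := by linarith
  have hσ : 0 < 1 / (p - 1) := by positivity
  rcases hX.eq_or_lt with h0 | hX
  · rw [← h0, zero_mul, Real.zero_rpow (by linarith), mul_zero, zero_add]
    positivity
  -- If Y ≤ m X^{p-1}, the first term already dominates the product; otherwise X < (Y/m)^{1/(p-1)}
  -- and the second one does.
  rcases le_or_gt Y (m * X ^ (p - 1)) with h | h
  · have e : X ^ p = X * X ^ (p - 1) := by
      rw [← Real.rpow_one_add' hX.le (by linarith)]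
      ring_nf
    have h1 : X * Y ≤ X * (m * X ^ (p - 1)) := mul_le_mul_of_nonneg_left h hX.le
    have h2 : 0 ≤ m ^ (-(1 / (p - 1))) * Y ^ (1 + 1 / (p - 1)) := by positivity
    rw [e]
    linarith
  · have h1 : X ≤ (Y / m) ^ (1 / (p - 1)) := by
      have h2 : X ^ (p - 1) ≤ Y / m := by
        rw [le_div_iff₀ hm, mul_comm]
        exact h.le
      have h3 := Real.rpow_le_rpow (by positivity) h2 hσ.le
      rwa [← Real.rpow_mul hX.le, mul_one_div_cancel hp1.ne', Real.rpow_one] at h3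
    have e : (Y / m) ^ (1 / (p - 1)) * Y = m ^ (-(1 / (p - 1))) * Y ^ (1 + 1 / (p - 1)) := by
      rw [Real.div_rpow hY hm.le, Real.rpow_neg hm.le, Real.rpow_one_add' hY (by positivity)]
      field_simp
    have h4 := mul_le_mul_of_nonneg_right h1 hY
    rw [e] at h4
    have h5 : 0 ≤ m * X ^ p := by positivity
    linarith

/-- The rectangle `[0, R] × [-R, R]`. -/
def rect (R : ℝ) : Set (ℝ × ℝ) := Icc 0 R ×ˢ Icc (-R) R

theorem measurableSet_rect (R : ℝ) : MeasurableSet (rect R) :=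
  measurableSet_Icc.prod measurableSet_Icc

theorem isCompact_rect (R : ℝ) : IsCompact (rect R) := isCompact_Icc.prod isCompact_Icc

theorem rect_mono {R R' : ℝ} (h : R ≤ R') : rect R ⊆ rect R' :=
  prod_mono (Icc_subset_Icc_right h) (Icc_subset_Icc (neg_le_neg h) h)

theorem rect_subset_strip (R : ℝ) : rect R ⊆ strip ⊤ := by
  rintro z ⟨h1, -⟩
  exact mem_strip (by simpa using h1.1) z.2

theorem integral_Ici_integral_eq {F : ℝ → ℝ → ℝ} {M : ℝ}
    (hF : ContinuousOn (fun z : ℝ × ℝ => F z.1 z.2) (strip ⊤)) (h0 : SuppIn ⊤ M M F) :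
    ∫ t in Ici 0, ∫ x, F t x = ∫ z in rect M, F z.1 z.2 := by
  have hmem : ∀ t, 0 ≤ t → t ∈ timeInterval ⊤ := fun t ht => by simpa using ht
  have hint : IntegrableOn (fun z : ℝ × ℝ => F z.1 z.2) (rect M) (volume.prod volume) :=
    (hF.mono (rect_subset_strip M)).integrableOn_compact (isCompact_rect M)
  have e1 := setIntegral_prod _ hint
  refine Eq.trans ?_ e1.symm
  rw [setIntegral_eq_of_subset_of_forall_sdiff_eq_zero (s := Icc 0 M) measurableSet_Ici
    Icc_subset_Ici_self]
  · refine setIntegral_congr_fun measurableSet_Icc fun t ht => ?_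
    exact (setIntegral_eq_integral_of_forall_compl_eq_zero fun x hx =>
      h0 t (hmem t ht.1) x (Or.inr (by rwa [mem_Icc, ← abs_le, not_le] at hx))).symm
  · intro t ht
    have hM : M < t := by
      by_contra hcon
      exact ht.2 ⟨ht.1, not_lt.1 hcon⟩
    refine (integral_congr_ae (Eventually.of_forall fun x => ?_)).trans (integral_zero ℝ ℝ)
    exact h0 t (hmem t ht.1) x (Or.inl hM)

/-- The growth R^{3/2} exactly balances the factor R^{-3/2} in the Young remainder at the critical
exponent p = 3. -/
theorem integral_rect_le {R : ℝ} (hR : 1 ≤ R) :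
    ∫ z in rect (2 * R), (1 + z.1) ^ (-(1 / 2) : ℝ) ≤ 16 * R ^ (3 / 2 : ℝ) := by
  have h2 : (0 : ℝ) ≤ 2 * R := by linarith
  have e1 := setIntegral_prod_mul (μ := volume) (ν := volume)
    (fun t : ℝ => (1 + t) ^ (-(1 / 2) : ℝ)) (fun _ : ℝ => (1 : ℝ)) (Icc 0 (2 * R))
    (Icc (-(2 * R)) (2 * R))
  simp only [mul_one] at e1
  have e2 : ∫ t in Icc 0 (2 * R), (1 + t) ^ (-(1 / 2) : ℝ)
      = 2 * (1 + 2 * R) ^ (1 / 2 : ℝ) - 2 := by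
    rw [integral_Icc_eq_integral_Ioc, ← intervalIntegral.integral_of_le h2,
      intervalIntegral.integral_eq_sub_of_hasDerivAt
        (f := fun t => 2 * (1 + t) ^ (1 / 2 : ℝ))]
    · rw [add_zero, Real.one_rpow, mul_one]
    · intro t ht
      rw [uIcc_of_le h2] at ht
      have hpos : (0 : ℝ) < 1 + t := by linarith [ht.1]
      have := (((hasDerivAt_id t).const_add 1).rpow_const (p := 1 / 2)
        (Or.inl hpos.ne')).const_mul 2
      refine this.congr_deriv ?_
      norm_num
      ring
    · refine ContinuousOn.intervalIntegrable fun t ht => ?_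
      rw [uIcc_of_le h2] at ht
      have hpos : (0 : ℝ) < 1 + t := by linarith [ht.1]
      exact ((continuousAt_const.add continuousAt_id).rpow_const
        (Or.inl hpos.ne')).continuousWithinAt
  have e3 : ∫ _ in Icc (-(2 * R)) (2 * R), (1 : ℝ) = 4 * R := by
    rw [setIntegral_const, measureReal_def, Real.volume_Icc, ENNReal.toReal_ofReal (by linarith)]
    simp only [smul_eq_mul, mul_one]
    ring
  rw [e2, e3] at e1
  have h3 : (1 + 2 * R) ^ (1 / 2 : ℝ) ≤ 2 * R ^ (1 / 2 : ℝ) := by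
    have h4 : (4 * R) ^ (1 / 2 : ℝ) = 2 * R ^ (1 / 2 : ℝ) := by
      rw [Real.mul_rpow (by norm_num) (by linarith), ← Real.sqrt_eq_rpow 4,
        show (4 : ℝ) = 2 ^ 2 by norm_num, Real.sqrt_sq (by norm_num)]
    rw [← h4]
    exact Real.rpow_le_rpow (by linarith) (by linarith) (by norm_num)
  have h5 : R ^ (3 / 2 : ℝ) = R * R ^ (1 / 2 : ℝ) := by
    rw [← Real.rpow_one_add' (by linarith) (by norm_num)]
    norm_num
  refine e1.le.trans ?_
  rw [h5]
  nlinarith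

/-! ## Multipliers -/

/-- A positive solution `g` of the adjoint equation `g_tt - g_xx - (a g)_t = 0` comparable to
`1 + t`, with bounded first derivatives. -/
structure IsMultiplier (κ B : ℝ) (a g : ℝ → ℝ → ℝ) : Prop where
  cnOn : CnOn 2 ⊤ g
  eqn : ∀ t x, 0 ≤ t →
    dt (dt g) t x - dx (dx g) t x - dt (fun s y => a s y * g s y) t x = 0
  lower : ∀ t x, 0 ≤ t → κ * (1 + t) ≤ g t x
  upper : ∀ t x, 0 ≤ t → g t x ≤ B * (1 + t)
  dt_bound : ∀ t x, 0 ≤ t → |dt g t x| ≤ B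
  dx_bound : ∀ t x, 0 ≤ t → |dx g t x| ≤ B
  damping_bound : ∀ t x, 0 ≤ t → |a t x * g t x| ≤ B

theorem mem_timeInterval_top {t : ℝ} (ht : 0 ≤ t) : t ∈ timeInterval ⊤ := by simpa using ht

section

variable {θ k δ : ℝ} {b h : ℝ → ℝ → ℝ}

/-- Since a g = (2 + (1+t) b)(1 + h), the adjoint expression for g collapses to (1 + t) times the
corrector equation. The bounds follow from |h| ≤ θ < 1 and from (1+t) ≤ (1+t)^k, which absorbs the
extra factor 1 + t in front of h_t, h_x and b. -/
theorem IsCorrector.isMultiplier (hh : IsCorrector θ k b h) (hk : 1 < k) (hθ : θ < 1)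
    (hb : IsC2 b) (hd : DecayBound k δ b) :
    ∃ B, IsMultiplier (1 - θ) B (damping b) (multiplier h) := by
  have ch := hh.isC2.cnOn
  have ch1 : CnOn 1 ⊤ h := ch.of_le (by norm_num)
  have cb1 : CnOn 1 ⊤ b := hb.cnOn.of_le (by norm_num)
  obtain ⟨C, hC, hC'⟩ := hh.deriv_bound
  have hδ : 0 ≤ δ := by
    have := (abs_nonneg _).trans (hd 0 0 le_rfl).1
    simpa using this
  have hle : ∀ {t q : ℝ}, 0 ≤ t → 0 ≤ q → 1 ≤ (1 + t) ^ q := fun ht hq =>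
    Real.one_le_rpow (by linarith) hq
  have hone : ∀ {t : ℝ}, 0 ≤ t → 1 + t ≤ (1 + t) ^ k := fun ht =>
    Real.self_le_rpow_of_one_le (by linarith) hk.le
  have hb0 : ∀ t x, 0 ≤ t → |h t x| ≤ θ := fun t x ht => by
    have h1 := hh.bound t x ht
    have h2 : 0 ≤ θ := by
      have := (abs_nonneg _).trans (hh.bound 0 0 le_rfl)
      simpa using this
    exact h1.trans (div_le_self h2 (hle ht (by linarith)))
  have hmul : ∀ {t c D : ℝ}, 0 ≤ t → 0 ≤ D → |c| ≤ D / (1 + t) ^ k → |(1 + t) * c| ≤ D := by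
    intro t c D ht hD hc
    rw [abs_mul, abs_of_pos (by linarith : 0 < 1 + t)]
    calc (1 + t) * |c| ≤ (1 + t) ^ k * (D / (1 + t) ^ k) :=
          mul_le_mul (hone ht) hc (abs_nonneg _) (by positivity)
      _ = D := mul_div_cancel₀ _ (by have := hle ht (by linarith : 0 ≤ k); linarith)
  have dlin : ∀ t : ℝ, HasDerivWithinAt (fun t : ℝ => 1 + t) 1 (Ici 0) t := fun t =>
    ((hasDerivAt_id t).const_add 1).hasDerivWithinAt
  have dg : ∀ t x, 0 ≤ t → HasDerivWithinAt (fun s => multiplier h s x)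
      ((1 + h t x) + (1 + t) * dt h t x) (Ici 0) t := fun t x ht => by
    have h1 := (ch1.hasDerivWithinAt (mem_timeInterval_top ht) x).const_add 1
    refine ((dlin t).mul h1).congr_deriv ?_
    ring
  have e1 : ∀ t x, 0 ≤ t → dt (multiplier h) t x = (1 + h t x) + (1 + t) * dt h t x :=
    fun t x ht => dt_eq_of_hasDerivWithinAt ht (dg t x ht)
  have e2 : ∀ t x, 0 ≤ t →
      dt (dt (multiplier h)) t x = 2 * dt h t x + (1 + t) * dt (dt h) t x := by
    intro t x ht
    have h1 := (ch1.hasDerivWithinAt (mem_timeInterval_top ht) x).const_add 1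
    have h2 := (dlin t).mul (ch.dt_two.hasDerivWithinAt (mem_timeInterval_top ht) x)
    have h3 : HasDerivWithinAt (fun s => (1 + h s x) + (1 + s) * dt h s x)
        (dt h t x + (1 * dt h t x + (1 + t) * dt (dt h) t x)) (Ici 0) t := h1.add h2
    refine (dt_eq_of_hasDerivWithinAt ht (h3.congr (fun s hs => e1 s x hs) (e1 t x ht))).trans ?_
    ring
  have e3 : ∀ t x, 0 ≤ t → dx (multiplier h) t x = (1 + t) * dx h t x := fun t x ht =>
    dx_eq_of_hasDerivAt
      (((ch1.hasDerivAt (mem_timeInterval_top ht) x).const_add 1).const_mul (1 + t))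
  have e4 : ∀ t x, 0 ≤ t → dx (dx (multiplier h)) t x = (1 + t) * dx (dx h) t x := by
    intro t x ht
    refine dx_eq_of_hasDerivAt ?_
    rw [show (fun y => dx (multiplier h) t y) = fun y => (1 + t) * dx h t y from
      funext fun y => e3 t y ht]
    exact (ch.dx_two.hasDerivAt (mem_timeInterval_top ht) x).const_mul (1 + t)
  have e5 : ∀ t x, 0 ≤ t →
      damping b t x * multiplier h t x = (2 + (1 + t) * b t x) * (1 + h t x) := by
    intro t x ht
    have : 1 + t ≠ 0 := by linarith
    rw [damping, multiplier]
    field_simp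
  have e6 : ∀ t x, 0 ≤ t → dt (fun s y => damping b s y * multiplier h s y) t x
      = (b t x + (1 + t) * dt b t x) * (1 + h t x) + (2 + (1 + t) * b t x) * dt h t x := by
    intro t x ht
    have h1 := (ch1.hasDerivWithinAt (mem_timeInterval_top ht) x).const_add 1
    have h2 := ((dlin t).mul
      (cb1.hasDerivWithinAt (mem_timeInterval_top ht) x)).const_add 2
    have h3 : HasDerivWithinAt (fun s => (2 + (1 + s) * b s x) * (1 + h s x))
      ((1 * b t x + (1 + t) * dt b t x) * (1 + h t x)
        + (2 + (1 + t) * b t x) * dt h t x) (Ici 0) t := h2.mul h1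
    refine (dt_eq_of_hasDerivWithinAt ht (h3.congr (fun s hs => e5 s x hs) (e5 t x ht))).trans ?_
    ring
  refine ⟨2 + C + (2 + δ) * 2, ?_, fun t x ht => ?_, fun t x ht => ?_, fun t x ht => ?_,
    fun t x ht => ?_, fun t x ht => ?_, fun t x ht => ?_⟩
  · refine CnOn.mul (f := fun t _ => 1 + t) (g := fun t x => 1 + h t x) ?_ ?_
    · exact (contDiff_const.add contDiff_fst).contDiffOn
    · exact contDiffOn_const.add ch
  · have h1 := hh.eqn t x ht
    have h2 : 1 + t ≠ 0 := by linarith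
    rw [e2 t x ht, e4 t x ht, e6 t x ht]
    have h3 : (1 + t) * (b t x / (1 + t)) = b t x := mul_div_cancel₀ _ h2
    linear_combination (1 + t) * h1 + (1 + h t x) * h3
  · have h1 := (abs_le.1 (hb0 t x ht)).1
    rw [multiplier, mul_comm]
    exact mul_le_mul_of_nonneg_left (by linarith) (by linarith)
  · have h1 := (abs_le.1 (hb0 t x ht)).2
    rw [multiplier, mul_comm]
    exact mul_le_mul_of_nonneg_right (by linarith) (by linarith)
  · rw [e1 t x ht]
    have h1 := hmul ht hC.le (hC' t x ht).1
    have h2 := hb0 t x ht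
    have h3 : |1 + h t x| ≤ 1 + |h t x| := (abs_add_le _ _).trans (by rw [abs_one])
    exact (abs_add_le _ _).trans (by linarith)
  · rw [e3 t x ht]
    exact (hmul ht hC.le (hC' t x ht).2).trans (by linarith)
  · rw [e5 t x ht, abs_mul]
    have h1 := hmul ht hδ (hd t x ht).1
    have h2 := hb0 t x ht
    have h3 : |1 + h t x| ≤ 1 + |h t x| := (abs_add_le _ _).trans (by rw [abs_one])
    have h4 : |2 + (1 + t) * b t x| ≤ 2 + |(1 + t) * b t x| :=
      (abs_add_le _ _).trans (by rw [abs_two])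
    have h5 : |2 + (1 + t) * b t x| * |1 + h t x| ≤ (2 + δ) * 2 :=
      mul_le_mul (by linarith) (by linarith) (abs_nonneg _) (by linarith)
    linarith

end

section

variable {κ B : ℝ} {a g φ : ℝ → ℝ → ℝ}

theorem dt_mul (hg : CnOn 1 ⊤ g) (hφ : CnOn 1 ⊤ φ) {t : ℝ} (ht : 0 ≤ t) (x : ℝ) :
    dt (fun s y => g s y * φ s y) t x = dt g t x * φ t x + g t x * dt φ t x :=
  dt_eq_of_hasDerivWithinAt ht ((hg.hasDerivWithinAt (mem_timeInterval_top ht) x).mul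
    (hφ.hasDerivWithinAt (mem_timeInterval_top ht) x))

theorem dx_mul (hg : CnOn 1 ⊤ g) (hφ : CnOn 1 ⊤ φ) {t : ℝ} (ht : 0 ≤ t) (x : ℝ) :
    dx (fun s y => g s y * φ s y) t x = dx g t x * φ t x + g t x * dx φ t x :=
  dx_eq_of_hasDerivAt ((hg.hasDerivAt (mem_timeInterval_top ht) x).mul
    (hφ.hasDerivAt (mem_timeInterval_top ht) x))

theorem dt_dt_mul (hg : CnOn 2 ⊤ g) (hφ : CnOn 2 ⊤ φ) {t : ℝ} (ht : 0 ≤ t) (x : ℝ) :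
    dt (dt fun s y => g s y * φ s y) t x
      = dt (dt g) t x * φ t x + 2 * (dt g t x * dt φ t x) + g t x * dt (dt φ) t x := by
  have g1 : CnOn 1 ⊤ g := hg.of_le (by norm_num)
  have φ1 : CnOn 1 ⊤ φ := hφ.of_le (by norm_num)
  have hm := mem_timeInterval_top ht
  have h1 := (hg.dt_two.hasDerivWithinAt hm x).mul (φ1.hasDerivWithinAt hm x)
  have h2 := (g1.hasDerivWithinAt hm x).mul (hφ.dt_two.hasDerivWithinAt hm x)
  have h3 : HasDerivWithinAt (fun s => dt g s x * φ s x + g s x * dt φ s x) _ (Ici 0) t :=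
    h1.add h2
  refine (dt_eq_of_hasDerivWithinAt ht (h3.congr (fun s hs => dt_mul g1 φ1 hs x)
    (dt_mul g1 φ1 ht x))).trans ?_
  ring

theorem dx_dx_mul (hg : CnOn 2 ⊤ g) (hφ : CnOn 2 ⊤ φ) {t : ℝ} (ht : 0 ≤ t) (x : ℝ) :
    dx (dx fun s y => g s y * φ s y) t x
      = dx (dx g) t x * φ t x + 2 * (dx g t x * dx φ t x) + g t x * dx (dx φ) t x := by
  have g1 : CnOn 1 ⊤ g := hg.of_le (by norm_num)
  have φ1 : CnOn 1 ⊤ φ := hφ.of_le (by norm_num)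
  have hm := mem_timeInterval_top ht
  have h1 := (hg.dx_two.hasDerivAt hm x).mul (φ1.hasDerivAt hm x)
  have h2 := (g1.hasDerivAt hm x).mul (hφ.dx_two.hasDerivAt hm x)
  have h3 : HasDerivAt (fun y => dx g t y * φ t y + g t y * dx φ t y) _ x := h1.add h2
  have h4 : (fun y => dx (fun s y => g s y * φ s y) t y)
      = fun y => dx g t y * φ t y + g t y * dx φ t y := funext fun y => dx_mul g1 φ1 ht y
  rw [← h4] at h3
  refine (dx_eq_of_hasDerivAt h3).trans ?_
  ring

/-- The adjoint operator applied to `g φ`, where `g` solves the adjoint equation. -/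
def adjointError (a g φ : ℝ → ℝ → ℝ) (t x : ℝ) : ℝ :=
  2 * (dt g t x * dt φ t x) + g t x * dt (dt φ) t x - 2 * (dx g t x * dx φ t x)
    - g t x * dx (dx φ) t x - a t x * g t x * dt φ t x

/-- In the expansion the undifferentiated φ is multiplied by the adjoint equation for g, which is
zero. Only terms with derivatives of φ remain. -/
theorem IsMultiplier.adjoint_mul (hg : IsMultiplier κ B a g) (ha : CnOn 2 ⊤ a) (hφ : CnOn 2 ⊤ φ)
    {t : ℝ} (ht : 0 ≤ t) (x : ℝ) :
    dt (dt fun s y => g s y * φ s y) t x - dx (dx fun s y => g s y * φ s y) t x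
      - dt (fun s y => a s y * (g s y * φ s y)) t x = adjointError a g φ t x := by
  have h1 : CnOn 1 ⊤ (fun s y => a s y * g s y) := (ha.mul hg.cnOn).of_le (by norm_num)
  have φ1 : CnOn 1 ⊤ φ := hφ.of_le (by norm_num)
  rw [dt_dt_mul hg.cnOn hφ ht, dx_dx_mul hg.cnOn hφ ht,
    show (fun s y => a s y * (g s y * φ s y)) = fun s y => a s y * g s y * φ s y from
      funext fun s => funext fun y => (mul_assoc _ _ _).symm, dt_mul h1 φ1 ht, adjointError]
  linear_combination φ t x * hg.eqn t x ht

/-- The rescaled space-time cutoff. -/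
def spaceTimeCutoff (n : ℕ) (R t x : ℝ) : ℝ := cutoff n (t / R) * cutoff n (x / R)

theorem cnOn_spaceTimeCutoff (n : ℕ) (R : ℝ) : CnOn 2 ⊤ (spaceTimeCutoff n R) := by
  have h1 : ContDiff ℝ 2 fun z : ℝ × ℝ => cutoff n (z.1 / R) * cutoff n (z.2 / R) :=
    ((contDiff_cutoff n (m := 2)).comp (contDiff_fst.div_const R)).mul
      ((contDiff_cutoff n (m := 2)).comp (contDiff_snd.div_const R))
  exact h1.contDiffOn

theorem hasDerivAt_comp_div {f f' : ℝ → ℝ} (hf : ∀ s, HasDerivAt f (f' s) s) (R t : ℝ) :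
    HasDerivAt (fun t => f (t / R)) (f' (t / R) / R) t := by
  refine ((hf (t / R)).comp t ((hasDerivAt_id t).div_const R)).congr_deriv ?_
  ring

section

variable (n : ℕ) (R : ℝ)

theorem dt_spaceTimeCutoff {t : ℝ} (ht : 0 ≤ t) (x : ℝ) : dt (spaceTimeCutoff n R) t x
    = deriv (cutoff n) (t / R) / R * cutoff n (x / R) :=
  dt_eq_of_hasDerivWithinAt ht
    ((hasDerivAt_comp_div (hasDerivAt_cutoff n) R t).mul_const _).hasDerivWithinAt

theorem dt_dt_spaceTimeCutoff {t : ℝ} (ht : 0 ≤ t) (x : ℝ) : dt (dt (spaceTimeCutoff n R)) t x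
    = deriv (deriv (cutoff n)) (t / R) / R / R * cutoff n (x / R) :=
  dt_eq_of_hasDerivWithinAt ht
    ((((hasDerivAt_comp_div (hasDerivAt_deriv_cutoff n) R t).div_const R).mul_const
      _).hasDerivWithinAt.congr (fun _ hs => dt_spaceTimeCutoff n R hs x)
      (dt_spaceTimeCutoff n R ht x))

theorem dx_spaceTimeCutoff (t x : ℝ) : dx (spaceTimeCutoff n R) t x
    = cutoff n (t / R) * (deriv (cutoff n) (x / R) / R) :=
  dx_eq_of_hasDerivAt ((hasDerivAt_comp_div (hasDerivAt_cutoff n) R x).const_mul _)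

theorem dx_dx_spaceTimeCutoff (t x : ℝ) : dx (dx (spaceTimeCutoff n R)) t x
    = cutoff n (t / R) * (deriv (deriv (cutoff n)) (x / R) / R / R) := by
  refine dx_eq_of_hasDerivAt ?_
  rw [show (fun y => dx (spaceTimeCutoff n R) t y) = _ from
    funext fun y => dx_spaceTimeCutoff n R t y]
  exact ((hasDerivAt_comp_div (hasDerivAt_deriv_cutoff n) R x).div_const R).const_mul _

end

theorem adjointError_eq_zero (a g : ℝ → ℝ → ℝ) (n : ℕ) {R t x : ℝ} (ht : 0 ≤ t) (htR : t < R)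
    (hx : |x| < R) : adjointError a g (spaceTimeCutoff n R) t x = 0 := by
  have hR : 0 < R := ht.trans_lt htR
  have h1 : |t / R| < 1 := by
    rwa [abs_div, abs_of_pos hR, div_lt_one hR, abs_of_nonneg ht]
  have h2 : |x / R| < 1 := by rwa [abs_div, abs_of_pos hR, div_lt_one hR]
  rw [adjointError, dt_spaceTimeCutoff n R ht, dt_dt_spaceTimeCutoff n R ht, dx_spaceTimeCutoff,
    dx_dx_spaceTimeCutoff, deriv_cutoff_eq_zero n h1, deriv_deriv_cutoff_eq_zero n h1,
    deriv_cutoff_eq_zero n h2, deriv_deriv_cutoff_eq_zero n h2]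
  simp

/-- Every term is O(1/R): first derivatives of the cutoff cost 1/R and meet bounded coefficients,
while second derivatives cost 1/R² and meet g = O(R). -/
theorem IsMultiplier.exists_abs_adjointError_le (hg : IsMultiplier κ B a g) (hκ : 0 ≤ κ) (n : ℕ) :
    ∃ D : ℝ, 0 ≤ D ∧ ∀ R, 1 ≤ R → ∀ t, 0 ≤ t → t ≤ 2 * R → ∀ x,
      |adjointError a g (spaceTimeCutoff n R) t x|
        ≤ D / R * (bump (t / R) * bump (x / R)) ^ n := by
  obtain ⟨A, hA, hb⟩ := exists_cutoff_bound n
  have hB : 0 ≤ B := (abs_nonneg _).trans (hg.dt_bound 0 0 le_rfl)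
  -- 11 = 2 + 3 + 2 + 3 + 1 over the five terms of `adjointError`; each 3 comes from g ≤ B(1 + 2R) ≤
  -- 3BR.
  refine ⟨11 * B * A ^ 2, by positivity, fun R hR t ht htR x => ?_⟩
  have hR0 : 0 < R := by linarith
  set w := (bump (t / R) * bump (x / R)) ^ n with hw
  have hw0 : 0 ≤ w := pow_nonneg (mul_nonneg (bump_nonneg _) (bump_nonneg _)) _
  have hprod : ∀ {c d : ℝ}, |c| ≤ A * bump (t / R) ^ n → |d| ≤ A * bump (x / R) ^ n →
      |c| * |d| ≤ A ^ 2 * w := fun {c d} hc hd => by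
    have := mul_le_mul hc hd (abs_nonneg d) ((abs_nonneg c).trans hc)
    rw [hw, mul_pow]
    linarith
  obtain ⟨t0, t1, t2⟩ := hb (t / R)
  obtain ⟨x0, x1, x2⟩ := hb (x / R)
  have p1 : |dt (spaceTimeCutoff n R) t x| ≤ A ^ 2 * w / R := by
    rw [dt_spaceTimeCutoff n R ht, abs_mul, abs_div, abs_of_pos hR0, div_mul_eq_mul_div]
    exact div_le_div_of_nonneg_right (hprod t1 x0) hR0.le
  have p2 : |dx (spaceTimeCutoff n R) t x| ≤ A ^ 2 * w / R := by
    rw [dx_spaceTimeCutoff, abs_mul, abs_div, abs_of_pos hR0, mul_div_assoc']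
    exact div_le_div_of_nonneg_right (hprod t0 x1) hR0.le
  have p3 : |dt (dt (spaceTimeCutoff n R)) t x| ≤ A ^ 2 * w / R / R := by
    rw [dt_dt_spaceTimeCutoff n R ht, abs_mul, abs_div, abs_div, abs_of_pos hR0,
      div_mul_eq_mul_div, div_mul_eq_mul_div]
    exact div_le_div_of_nonneg_right (div_le_div_of_nonneg_right (hprod t2 x0) hR0.le) hR0.le
  have p4 : |dx (dx (spaceTimeCutoff n R)) t x| ≤ A ^ 2 * w / R / R := by
    rw [dx_dx_spaceTimeCutoff, abs_mul, abs_div, abs_div, abs_of_pos hR0, mul_div_assoc',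
      mul_div_assoc']
    exact div_le_div_of_nonneg_right (div_le_div_of_nonneg_right (hprod t0 x2) hR0.le) hR0.le
  set P := A ^ 2 * w / R with hP
  have hP0 : 0 ≤ P := by positivity
  have hg1 : |g t x| ≤ 3 * B * R := by
    have h1 : 0 ≤ g t x := (mul_nonneg hκ (by linarith)).trans (hg.lower t x ht)
    rw [abs_of_nonneg h1]
    refine (hg.upper t x ht).trans ?_
    nlinarith
  have hgR : ∀ {c : ℝ}, |c| ≤ P / R → |g t x * c| ≤ 3 * B * P := fun {c} hc => by
    rw [abs_mul]
    refine (mul_le_mul hg1 hc (abs_nonneg _) (by positivity)).trans (le_of_eq ?_)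
    field_simp
  have hgB : ∀ {c d : ℝ}, |c| ≤ B → |d| ≤ P → |c * d| ≤ B * P := fun {c d} hc hd => by
    rw [abs_mul]
    exact mul_le_mul hc hd (abs_nonneg _) hB
  have q1 := abs_le.1 (hgB (hg.dt_bound t x ht) p1)
  have q2 := abs_le.1 (hgR p3)
  have q3 := abs_le.1 (hgB (hg.dx_bound t x ht) p2)
  have q4 := abs_le.1 (hgR p4)
  have q5 := abs_le.1 (hgB (hg.damping_bound t x ht) p1)
  have e : 11 * B * A ^ 2 / R * w = 11 * (B * P) := by
    rw [hP]
    ring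
  rw [e, adjointError, abs_le]
  constructor <;> linarith [q1.1, q1.2, q2.1, q2.2, q3.1, q3.2, q4.1, q4.2, q5.1, q5.2]

end

/-! ## Nonexistence of global solutions -/

theorem DataCondition.exists_le {g a : ℝ → ℝ → ℝ} {u₀ : H1} {u₁ : L2}
    (h : DataCondition g a u₀ u₁) : ∃ c : ℝ, 0 < c ∧ ∃ R₀ : ℝ, ∀ R, R₀ ≤ R →
      c ≤ ∫ x in (-R)..R, ((-dt g 0 x + g 0 x * a 0 x) * toL2 u₀ x + g 0 x * u₁ x) := by
  obtain ⟨c, hc0, hc⟩ := EReal.lt_iff_exists_real_btwn.1 h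
  obtain ⟨R₀, hR₀⟩ := eventually_atTop.1 (eventually_lt_of_lt_liminf hc)
  exact ⟨c, by exact_mod_cast hc0, R₀, fun R hR => (EReal.coe_lt_coe_iff.1 (hR₀ R hR)).le⟩

section

variable {L κ B p : ℝ} {a g : ℝ → ℝ → ℝ} {u : ℝ → H1} {ut : ℝ → L2} {u₀ : H1} {u₁ : L2}

/-- A jointly continuous representative makes the integrands continuous on rectangles, so that the
iterated integrals of the weak formulation become genuine space-time integrals. -/
theorem continuousOn_rep {T : EReal} (hu : ContinuousOn u (timeInterval T)) :
    ContinuousOn (fun z : ℝ × ℝ => rep (u z.1) z.2) (strip T) := by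
  have h1 : ContinuousOn (fun z : ℝ × ℝ => u z.1) (strip T) :=
    hu.comp continuousOn_fst fun z hz => hz.1
  have h2 := h1.prodMk continuousOn_snd
  have h' := Continuous.comp_continuousOn' (f := fun z : ℝ × ℝ => (u z.1, z.2)) continuous_rep h2
  exact h'

theorem continuousOn_adjointError {φ : ℝ → ℝ → ℝ} (hg : IsMultiplier κ B a g) (ha : CnOn 2 ⊤ a)
    (hφ : CnOn 2 ⊤ φ) :
    ContinuousOn (fun z : ℝ × ℝ => adjointError a g φ z.1 z.2) (strip ⊤) := by
  have g1 : CnOn 1 ⊤ g := hg.cnOn.of_le (by norm_num)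
  have φ1 : CnOn 1 ⊤ φ := hφ.of_le (by norm_num)
  exact ((((continuousOn_const.mul (g1.dt_one.continuousOn.mul φ1.dt_one.continuousOn)).add
    (g1.continuousOn.mul hφ.dt_two.dt_one.continuousOn)).sub
    (continuousOn_const.mul (g1.dx_one.continuousOn.mul φ1.dx_one.continuousOn))).sub
    (g1.continuousOn.mul hφ.dx_two.dx_one.continuousOn)).sub
    ((ha.continuousOn.mul g1.continuousOn).mul φ1.dt_one.continuousOn)

theorem suppIn_spaceTimeCutoff (n : ℕ) {R : ℝ} (hR : 0 < R) :
    SuppIn ⊤ (2 * R) (2 * R) (spaceTimeCutoff n R) := by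
  have h : ∀ y, 2 * R < |y| → cutoff n (y / R) = 0 := fun y hy => cutoff_eq_zero n (by
    rw [abs_div, abs_of_pos hR, le_div_iff₀ hR]
    exact hy.le)
  intro t _ x hx
  rw [spaceTimeCutoff]
  rcases hx with hx | hx
  · rw [h t (hx.trans_le (le_abs_self t)), zero_mul]
  · rw [h x hx, mul_zero]

theorem IsSolution.integral_rect_eq (hu : IsSolution a p u₀ u₁ ⊤ u ut) (hp : 0 ≤ p)
    (ha : CnOn 2 ⊤ a) (hg : IsMultiplier κ B a g) (n : ℕ) {R : ℝ} (hR : 0 < R) :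
    ∫ z in rect (2 * R), rep (u z.1) z.2 * adjointError a g (spaceTimeCutoff n R) z.1 z.2
      = (∫ x, ((-dt g 0 x + g 0 x * a 0 x) * toL2 u₀ x + g 0 x * u₁ x) * cutoff n (x / R))
        + ∫ z in rect (2 * R),
          |rep (u z.1) z.2| ^ p * (g z.1 z.2 * spaceTimeCutoff n R z.1 z.2) := by
  have hφ := cnOn_spaceTimeCutoff n R
  have hs := suppIn_spaceTimeCutoff n hR
  have hψ : IsTestFunction ⊤ fun t x => g t x * spaceTimeCutoff n R t x :=
    (hs.mul_left g).isTestFunction (mem_timeInterval_top (by positivity)) (hg.cnOn.mul hφ)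
  have hw := hu.weak _ hψ
  have hU := continuousOn_rep hu.memX.continuousOn
  rw [timeInterval_top] at hw
  have e1 : ∀ t ∈ Ici (0 : ℝ), ∫ x, toL2 (u t) x *
        (dt (dt fun t x => g t x * spaceTimeCutoff n R t x) t x
          - dx (dx fun t x => g t x * spaceTimeCutoff n R t x) t x
          - dt (fun s y => a s y * (g s y * spaceTimeCutoff n R s y)) t x)
      = ∫ x, rep (u t) x * adjointError a g (spaceTimeCutoff n R) t x := fun t ht => by
    refine integral_congr_ae ?_
    filter_upwards [rep_ae_eq (u t)] with x hx
    rw [hx, hg.adjoint_mul ha hφ ht]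
  have e2 : ∀ t ∈ Ici (0 : ℝ), ∫ x, |toL2 (u t) x| ^ p * (g t x * spaceTimeCutoff n R t x)
      = ∫ x, |rep (u t) x| ^ p * (g t x * spaceTimeCutoff n R t x) := fun t _ => by
    refine integral_congr_ae ?_
    filter_upwards [rep_ae_eq (u t)] with x hx
    rw [hx]
  -- Near t = 0 the time cutoff is constantly 1, so the boundary terms are exactly the density of
  -- the data condition times the spatial cutoff.
  have hc1 : cutoff n (0 / R) = 1 := cutoff_eq_one n (by simp)
  have hc2 : deriv (cutoff n) (0 / R) = 0 := deriv_cutoff_eq_zero n (by simp)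
  have e3 : ∀ x, (a 0 x * toL2 u₀ x + u₁ x) * (g 0 x * spaceTimeCutoff n R 0 x)
        - toL2 u₀ x * dt (fun t x => g t x * spaceTimeCutoff n R t x) 0 x
      = ((-dt g 0 x + g 0 x * a 0 x) * toL2 u₀ x + g 0 x * u₁ x) * cutoff n (x / R) := fun x => by
    rw [dt_mul (hg.cnOn.of_le (by norm_num)) (hφ.of_le (by norm_num)) le_rfl,
      dt_spaceTimeCutoff n R le_rfl, spaceTimeCutoff, hc1, hc2]
    ring
  rw [setIntegral_congr_fun measurableSet_Ici e1, setIntegral_congr_fun measurableSet_Ici e2] at hw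
  simp only [e3] at hw
  rw [integral_Ici_integral_eq (F := fun t x => rep (u t) x
        * adjointError a g (spaceTimeCutoff n R) t x) (M := 2 * R)
      (hU.mul (continuousOn_adjointError hg ha hφ)) (SuppIn.mul_left ?_ _),
    integral_Ici_integral_eq (F := fun t x => |rep (u t) x| ^ p
        * (g t x * spaceTimeCutoff n R t x)) (M := 2 * R)
      ((hU.abs.rpow_const fun _ _ => Or.inr hp).mul (hg.cnOn.continuousOn.mul hφ.continuousOn))
      ((hs.mul_left g).mul_left _)] at hw
  · exact hw
  · intro t ht x hx
    rw [adjointError, hs.dt t ht x hx, hs.dt.dt t ht x hx, hs.dx t ht x hx, hs.dx.dx t ht x hx]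
    simp

/-- Young's inequality with parameter l κ (1+t), so that the first term is controlled by |U|^p g
φ_R. With σ = 1/(p-1) the remainder is R^{-(1+σ)} (1+t)^{-σ} up to constants, and p ≤ 3 enters
through σ ≥ 1/2. -/
theorem abs_mul_adjointError_le {D R l t x U E : ℝ} {n : ℕ} (hp : 1 < p) (hp3 : p ≤ 3)
    (hn : 2 / (p - 1) ≤ n) (hκ : 0 < κ) (hD : 0 ≤ D) (hR : 1 ≤ R) (hl : 0 < l) (ht : 0 ≤ t)
    (hg : κ * (1 + t) ≤ g t x) (hE : |E| ≤ D / R * (bump (t / R) * bump (x / R)) ^ n) :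
    |U * E| ≤ l * (|U| ^ p * (g t x * spaceTimeCutoff n R t x))
      + l ^ (-(1 / (p - 1))) * (κ ^ (-(1 / (p - 1))) * D ^ (1 + 1 / (p - 1)))
        * (R ^ (-(3 / 2) : ℝ) * (1 + t) ^ (-(1 / 2) : ℝ)) := by
  have hp1 : 0 < p - 1 := by linarith
  have hp0 : 0 < p := by linarith
  have hR0 : 0 < R := by linarith
  have ht1 : 0 < 1 + t := by linarith
  set w := bump (t / R) * bump (x / R) with hw
  have hw0 : 0 ≤ w := mul_nonneg (bump_nonneg _) (bump_nonneg _)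
  have hw1 : w ≤ 1 := mul_le_one₀ (bump_le_one _) (bump_nonneg _) (bump_le_one _)
  have hφ : spaceTimeCutoff n R t x = w ^ (n + 2) := by
    rw [spaceTimeCutoff, cutoff, cutoff, hw, mul_pow]
  set σ := 1 / (p - 1) with hσ
  have hσ2 : 1 / 2 ≤ σ := one_div_le_one_div_of_le hp1 (by linarith)
  -- The p-th power of the new weight is w^{n+2}, the cutoff itself. Since 0 ≤ w ≤ 1, the inequality
  -- needs n ≥ (n + 2)/p, that is n ≥ 2/(p - 1).
  have hs : w ^ n ≤ w ^ (((n : ℝ) + 2) / p) := by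
    rw [← Real.rpow_natCast]
    refine Real.rpow_le_rpow_of_exponent_ge' hw0 hw1 (by positivity) ?_
    rw [div_le_iff₀ hp0]
    rw [div_le_iff₀ hp1] at hn
    linarith
  have hXp : (|U| * w ^ (((n : ℝ) + 2) / p)) ^ p = |U| ^ p * w ^ (n + 2) := by
    rw [Real.mul_rpow (abs_nonneg _) (by positivity), ← Real.rpow_mul hw0, div_mul_cancel₀ _ hp0.ne',
      ← Real.rpow_natCast w (n + 2)]
    push_cast
    rfl
  have h1 : |U * E| ≤ (|U| * w ^ (((n : ℝ) + 2) / p)) * (D / R) := by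
    rw [abs_mul]
    calc |U| * |E| ≤ |U| * (D / R * w ^ n) := mul_le_mul_of_nonneg_left hE (abs_nonneg _)
      _ ≤ |U| * (D / R * w ^ (((n : ℝ) + 2) / p)) := by gcongr
      _ = _ := by ring
  have h2 := mul_le_rpow_add_rpow (m := l * (κ * (1 + t))) hp
    (by positivity : 0 ≤ |U| * w ^ (((n : ℝ) + 2) / p)) (by positivity : 0 ≤ D / R) (by positivity)
  rw [hXp, ← hσ] at h2
  have h3 : l * (κ * (1 + t)) * (|U| ^ p * w ^ (n + 2))
      ≤ l * (|U| ^ p * (g t x * spaceTimeCutoff n R t x)) := by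
    rw [hφ]
    have h4 : κ * (1 + t) * (|U| ^ p * w ^ (n + 2)) ≤ g t x * (|U| ^ p * w ^ (n + 2)) :=
      mul_le_mul_of_nonneg_right hg (by positivity)
    have h5 := mul_le_mul_of_nonneg_left h4 hl.le
    linarith
  have h6 : (l * (κ * (1 + t))) ^ (-σ) * (D / R) ^ (1 + σ)
      = l ^ (-σ) * (κ ^ (-σ) * D ^ (1 + σ)) * (R ^ (-(1 + σ)) * (1 + t) ^ (-σ)) := by
    rw [Real.mul_rpow hl.le (by positivity), Real.mul_rpow hκ.le ht1.le,
      Real.div_rpow hD hR0.le, Real.rpow_neg hR0.le]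
    ring
  have h7 : R ^ (-(1 + σ)) * (1 + t) ^ (-σ) ≤ R ^ (-(3 / 2) : ℝ) * (1 + t) ^ (-(1 / 2) : ℝ) :=
    mul_le_mul (Real.rpow_le_rpow_of_exponent_le hR (by linarith))
      (Real.rpow_le_rpow_of_exponent_le (by linarith) (by linarith)) (by positivity)
      (by positivity)
  have h8 : 0 ≤ l ^ (-σ) * (κ ^ (-σ) * D ^ (1 + σ)) := by positivity
  have h9 := mul_le_mul_of_nonneg_left h7 h8
  rw [h6] at h2
  linarith

theorem IsSolution.exists_energy_le (hu : IsSolution a p u₀ u₁ ⊤ u ut) (hp : 1 < p) (hp3 : p ≤ 3)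
    (ha : CnOn 2 ⊤ a) (hg : IsMultiplier κ B a g) (hκ : 0 < κ) {c R₀ : ℝ}
    (hdata : ∀ R, R₀ ≤ R →
      c ≤ ∫ x in (-R)..R, ((-dt g 0 x + g 0 x * a 0 x) * toL2 u₀ x + g 0 x * u₁ x)) :
    ∃ n : ℕ, ∃ D : ℝ, ∀ R, 1 ≤ R → R₀ ≤ R → ∀ l : ℝ, 0 < l →
      c + ∫ z in rect (2 * R), |rep (u z.1) z.2| ^ p * (g z.1 z.2 * spaceTimeCutoff n R z.1 z.2)
        ≤ l * (∫ z in rect (2 * R) \ rect (R / 2),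
            |rep (u z.1) z.2| ^ p * (g z.1 z.2 * spaceTimeCutoff n R z.1 z.2))
          + D * l ^ (-(1 / (p - 1))) := by
  obtain ⟨n, hn⟩ := exists_nat_ge (2 / (p - 1))
  obtain ⟨D, hD, hE⟩ := hg.exists_abs_adjointError_le hκ.le n
  refine ⟨n, 16 * (κ ^ (-(1 / (p - 1))) * D ^ (1 + 1 / (p - 1))), fun R hR hR₀ l hl => ?_⟩
  have hR0 : 0 < R := by linarith
  have hφ := cnOn_spaceTimeCutoff n R
  have hU := continuousOn_rep hu.memX.continuousOn
  set F : ℝ × ℝ → ℝ := fun z =>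
    |rep (u z.1) z.2| ^ p * (g z.1 z.2 * spaceTimeCutoff n R z.1 z.2) with hF
  set W : ℝ × ℝ → ℝ := fun z => rep (u z.1) z.2
    * adjointError a g (spaceTimeCutoff n R) z.1 z.2 with hW
  have cF : ContinuousOn F (strip ⊤) :=
    (hU.abs.rpow_const fun _ _ => Or.inr (by linarith)).mul
      (hg.cnOn.continuousOn.mul hφ.continuousOn)
  have cW : ContinuousOn W (strip ⊤) := hU.mul (continuousOn_adjointError hg ha hφ)
  have cN : ContinuousOn (fun z : ℝ × ℝ => (1 + z.1) ^ (-(1 / 2) : ℝ)) (strip ⊤) := fun z hz => by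
    have h1 : (0 : ℝ) ≤ z.1 := hz.1.1
    exact ((continuousAt_const.add continuousAt_fst).rpow_const
      (Or.inl (by linarith : (0 : ℝ) < 1 + z.1).ne')).continuousWithinAt
  have int : ∀ {f : ℝ × ℝ → ℝ}, ContinuousOn f (strip ⊤) → IntegrableOn f (rect (2 * R)) :=
    fun hf => (hf.mono (rect_subset_strip _)).integrableOn_compact (isCompact_rect _)
  set S := rect (2 * R) \ rect (R / 2) with hS
  have hSsub : S ⊆ rect (2 * R) := sdiff_subset
  have hSm : MeasurableSet S := (measurableSet_rect _).diff (measurableSet_rect _)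
  set K := l ^ (-(1 / (p - 1))) * (κ ^ (-(1 / (p - 1))) * D ^ (1 + 1 / (p - 1))) with hK
  have hK0 : 0 ≤ K := by positivity
  have hpt : ∀ z ∈ rect (2 * R), W z ≤ l * F z
      + K * R ^ (-(3 / 2) : ℝ) * (1 + z.1) ^ (-(1 / 2) : ℝ) := by
    intro z hz
    have h1 := abs_mul_adjointError_le (U := rep (u z.1) z.2) hp hp3 hn hκ hD hR hl hz.1.1
      (hg.lower z.1 z.2 hz.1.1) (hE R hR z.1 hz.1.1 hz.1.2 z.2)
    rw [← hK, ← mul_assoc K] at h1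
    exact (le_abs_self _).trans h1
  -- The error contains only derivatives of the cutoff, which vanish for t < R, |x| < R. Hence the
  -- inner rectangle does not contribute.
  have e1 : ∫ z in rect (2 * R), W z = ∫ z in S, W z := by
    refine setIntegral_eq_of_subset_of_forall_sdiff_eq_zero (measurableSet_rect _) hSsub
      fun z hz => ?_
    have h1 : z ∈ rect (R / 2) := by
      by_contra hcon
      exact hz.2 ⟨hz.1, hcon⟩
    have h2 : |z.2| ≤ R / 2 := abs_le.2 h1.2
    have h3 : z.1 ≤ R / 2 := h1.1.2
    simp only [hW, adjointError_eq_zero a g n h1.1.1 (by linarith : z.1 < R)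
      (by linarith : |z.2| < R), mul_zero]
  have h2 : ∫ z in S, W z ≤ l * (∫ z in S, F z)
      + K * R ^ (-(3 / 2) : ℝ) * ∫ z in S, (1 + z.1) ^ (-(1 / 2) : ℝ) := by
    have iF := (int cF).mono_set hSsub
    have iN := (int cN).mono_set hSsub
    rw [← integral_const_mul, ← integral_const_mul,
      ← integral_add (iF.const_mul l) (iN.const_mul _)]
    exact setIntegral_mono_on ((int cW).mono_set hSsub)
      ((iF.const_mul l).add (iN.const_mul _)) hSm fun z hz => hpt z (hSsub hz)
  have h3 : ∫ z in S, (1 + z.1) ^ (-(1 / 2) : ℝ) ≤ 16 * R ^ (3 / 2 : ℝ) := by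
    refine (setIntegral_mono_set (int cN) ?_ hSsub.eventuallyLE).trans (integral_rect_le hR)
    filter_upwards [ae_restrict_mem (measurableSet_rect (2 * R))] with z hz
    have h1 : (0 : ℝ) ≤ z.1 := hz.1.1
    exact Real.rpow_nonneg (by linarith) _
  -- The powers of R cancel, leaving a bound uniform in R.
  have h4 : K * R ^ (-(3 / 2) : ℝ) * ∫ z in S, (1 + z.1) ^ (-(1 / 2) : ℝ) ≤ K * 16 := by
    refine (mul_le_mul_of_nonneg_left h3 (by positivity)).trans (le_of_eq ?_)
    rw [Real.rpow_neg hR0.le]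
    have : R ^ (3 / 2 : ℝ) ≠ 0 := (Real.rpow_pos_of_pos hR0 _).ne'
    field_simp
  have h5 := hu.integral_rect_eq (by linarith) ha hg n hR0
  have h6 := le_integral_mul_cutoff n hR0 (c := c)
    (D := fun x => (-dt g 0 x + g 0 x * a 0 x) * toL2 u₀ x + g 0 x * u₁ x) (by
      have h0 : (0 : ℝ) ∈ timeInterval ⊤ := mem_timeInterval_top le_rfl
      have g1 : CnOn 1 ⊤ g := hg.cnOn.of_le (by norm_num)
      have loc : ∀ f : L2, IntegrableOn f (Icc (-(2 * R)) (2 * R)) := fun f =>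
        ((Lp.memLp f).locallyIntegrable (by norm_num)).integrableOn_isCompact isCompact_Icc
      have c1 : Continuous fun x => -dt g 0 x + g 0 x * a 0 x :=
        (g1.dt_one.continuous_right h0).neg.add
          ((g1.continuous_right h0).mul (ha.continuous_right h0))
      exact ((loc _).continuousOn_mul c1.continuousOn isCompact_Icc).add
        ((loc _).continuousOn_mul (g1.continuous_right h0).continuousOn isCompact_Icc))
    fun r hr => hdata r (hR₀.trans hr)
  have h7 : ∫ z in rect (2 * R), W z
    = (∫ x, ((-dt g 0 x + g 0 x * a 0 x) * toL2 u₀ x + g 0 x * u₁ x) * cutoff n (x / R))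
      + ∫ z in rect (2 * R), F z := h5
  have h8 : K * 16 = 16 * (κ ^ (-(1 / (p - 1))) * D ^ (1 + 1 / (p - 1)))
      * l ^ (-(1 / (p - 1))) := by
    rw [hK]
    ring
  rw [← h8]
  linarith

theorem not_isSolution_top (hp : 1 < p) (hp3 : p ≤ 3) (ha : CnOn 2 ⊤ a)
    (hg : IsMultiplier κ B a g) (hκ : 0 < κ) (hdata : DataCondition g a u₀ u₁) :
    ¬IsSolution a p u₀ u₁ ⊤ u ut := by
  intro hu
  obtain ⟨c, hc, R₀, hR₀⟩ := hdata.exists_le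
  obtain ⟨n, D, hen⟩ := hu.exists_energy_le hp hp3 ha hg hκ hR₀
  have hU := continuousOn_rep hu.memX.continuousOn
  set H : ℝ × ℝ → ℝ := fun z => |rep (u z.1) z.2| ^ p * g z.1 z.2 with hH
  set F : ℝ → ℝ × ℝ → ℝ := fun R z =>
    |rep (u z.1) z.2| ^ p * (g z.1 z.2 * spaceTimeCutoff n R z.1 z.2) with hF
  have cH : ContinuousOn H (strip ⊤) :=
    (hU.abs.rpow_const fun _ _ => Or.inr (by linarith)).mul hg.cnOn.continuousOn
  have iH : ∀ R, IntegrableOn H (rect R) := fun R =>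
    (cH.mono (rect_subset_strip R)).integrableOn_compact (isCompact_rect R)
  have iF : ∀ R M, IntegrableOn (F R) (rect M) := fun R M =>
    (((hU.abs.rpow_const fun _ _ => Or.inr (by linarith)).mul (hg.cnOn.continuousOn.mul
      (cnOn_spaceTimeCutoff n R).continuousOn)).mono (rect_subset_strip M)).integrableOn_compact
      (isCompact_rect M)
  have hg0 : ∀ z : ℝ × ℝ, 0 ≤ z.1 → 0 ≤ g z.1 z.2 := fun z hz =>
    (mul_nonneg hκ.le (by linarith)).trans (hg.lower z.1 z.2 hz)
  have H0 : ∀ {R : ℝ}, ∀ z ∈ rect R, 0 ≤ H z := fun z hz =>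
    mul_nonneg (by positivity) (hg0 z hz.1.1)
  have hcut0 : ∀ R t x, 0 ≤ spaceTimeCutoff n R t x := fun R t x =>
    mul_nonneg (cutoff_nonneg n _) (cutoff_nonneg n _)
  have hcut1 : ∀ R t x, spaceTimeCutoff n R t x ≤ 1 := fun R t x =>
    mul_le_one₀ (pow_le_one₀ (bump_nonneg _) (bump_le_one _)) (cutoff_nonneg n _)
      (pow_le_one₀ (bump_nonneg _) (bump_le_one _))
  have F0 : ∀ {R M : ℝ}, ∀ z ∈ rect M, 0 ≤ F R z := fun z hz =>
    mul_nonneg (by positivity) (mul_nonneg (hg0 z hz.1.1) (hcut0 _ _ _))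
  have FH : ∀ {R M : ℝ}, ∀ z ∈ rect M, F R z ≤ H z := fun z hz =>
    mul_le_mul_of_nonneg_left (mul_le_of_le_one_right (hg0 z hz.1.1) (hcut1 _ _ _))
      (by positivity)
  set K : ℝ → ℝ := fun R => ∫ z in rect R, H z with hK
  have Kmono : Monotone K := fun R R' h => by
    refine setIntegral_mono_set (iH R') ?_ (rect_mono h).eventuallyLE
    filter_upwards [ae_restrict_mem (measurableSet_rect R')] with z hz using H0 z hz
  have KF : ∀ R, 0 < R → K R ≤ ∫ z in rect (2 * R), F R z := fun R hR => by
    have e : K R = ∫ z in rect R, F R z := by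
      refine setIntegral_congr_fun (measurableSet_rect R) fun z hz => ?_
      have h1 : |z.1 / R| ≤ 1 := by
        rw [abs_div, abs_of_pos hR, div_le_one hR, abs_of_nonneg hz.1.1]
        exact hz.1.2
      have h2 : |z.2 / R| ≤ 1 := by
        rw [abs_div, abs_of_pos hR, div_le_one hR]
        exact abs_le.2 hz.2
      simp only [hH, hF, spaceTimeCutoff, cutoff_eq_one n h1, cutoff_eq_one n h2, mul_one]
    rw [e]
    refine setIntegral_mono_set (iF R _) ?_ (rect_mono (by linarith)).eventuallyLE
    filter_upwards [ae_restrict_mem (measurableSet_rect (2 * R))] with z hz using F0 z hz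
  have Kdiff : ∀ R, 0 < R →
      ∫ z in rect (2 * R) \ rect (R / 2), F R z ≤ K (2 * R) - K (R / 2) := fun R hR => by
    rw [hK]
    simp only []
    rw [← setIntegral_sdiff (measurableSet_rect _) (iH _) (rect_mono (by linarith))]
    exact setIntegral_mono_on ((iF R _).mono_set sdiff_subset) ((iH _).mono_set sdiff_subset)
      ((measurableSet_rect _).diff (measurableSet_rect _)) fun z hz => FH z hz.1
  have Fdiff : ∀ R, 0 < R → ∫ z in rect (2 * R) \ rect (R / 2), F R z
      ≤ ∫ z in rect (2 * R), F R z := fun R hR => by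
    refine setIntegral_mono_set (iF R _) ?_ sdiff_subset.eventuallyLE
    filter_upwards [ae_restrict_mem (measurableSet_rect (2 * R))] with z hz using F0 z hz
  -- First pass, l = 1/2: half of the integral on the left absorbs the transition integral, which
  -- gives a bound independent of R.
  have Kbdd : BddAbove (range K) := by
    refine ⟨2 * (D * (1 / 2) ^ (-(1 / (p - 1)))), ?_⟩
    rintro _ ⟨R, rfl⟩
    set R' := max R (max 1 R₀)
    have h1 : 1 ≤ R' := (le_max_left _ _).trans (le_max_right _ _)
    have h2 : R₀ ≤ R' := (le_max_right _ _).trans (le_max_right _ _)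
    have h3 := hen R' h1 h2 (1 / 2) (by norm_num)
    have h4 := KF R' (by linarith)
    have h5 := Fdiff R' (by linarith)
    have h6 : K R ≤ K R' := Kmono (le_max_left _ _)
    simp only [hF] at h4 h5
    linarith
  have Klim := tendsto_atTop_ciSup Kmono Kbdd
  have Kdlim : Tendsto (fun R => K (2 * R) - K (R / 2)) atTop (𝓝 0) := by
    have h1 := Klim.comp (tendsto_id.const_mul_atTop (two_pos : (0 : ℝ) < 2))
    have h2 := Klim.comp (tendsto_id.atTop_div_const (two_pos : (0 : ℝ) < 2))
    have h3 := h1.sub h2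
    rw [sub_self] at h3
    exact h3
  -- Second pass: K is monotone and bounded, so its increments K(2R) - K(R/2) tend to 0, and for
  -- each fixed l only the remainder survives as R → ∞.
  have hl : ∀ l : ℝ, 0 < l → c ≤ D * l ^ (-(1 / (p - 1))) := fun l hl => by
    have h1 : Tendsto (fun R => l * (K (2 * R) - K (R / 2)) + D * l ^ (-(1 / (p - 1)))) atTop
        (𝓝 (l * 0 + D * l ^ (-(1 / (p - 1))))) := (Kdlim.const_mul l).add_const _
    rw [mul_zero, zero_add] at h1
    refine ge_of_tendsto h1 ?_
    filter_upwards [eventually_ge_atTop 1, eventually_ge_atTop R₀] with R hR1 hR2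
    have h3 := hen R hR1 hR2 l hl
    have h4 := mul_le_mul_of_nonneg_left (Kdiff R (by linarith)) hl.le
    have h5 : 0 ≤ ∫ z in rect (2 * R), F R z :=
      setIntegral_nonneg (measurableSet_rect _) fun z hz => F0 z hz
    linarith
  have hlim : Tendsto (fun l : ℝ => D * l ^ (-(1 / (p - 1)))) atTop (𝓝 (D * 0)) :=
    (tendsto_rpow_neg_atTop (one_div_pos.2 (by linarith))).const_mul D
  rw [mul_zero] at hlim
  have := ge_of_tendsto hlim (by
    filter_upwards [eventually_gt_atTop 0] with l hl0 using hl l hl0)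
  linarith

end

end

end DampedWave

/-! ### The theorem -/

open DampedWave

theorem theorem1p2 (θ k : ℝ) (hθ : θ ∈ Set.Ioo (0 : ℝ) 1) (hk : 1 < k) :
    ∃ δ₀ : ℝ, 0 < δ₀ ∧ ∀ δ ∈ Set.Ioo (0 : ℝ) δ₀,
      ∀ b : ℝ → ℝ → ℝ, IsC2 b → DecayBound k δ b →
        (∃ h : ℝ → ℝ → ℝ, IsCorrector θ k b h) ∧
        ∀ h : ℝ → ℝ → ℝ, IsCorrector θ k b h →
          ∀ p : ℝ, 1 < p → p ≤ 3 →
            ∀ (u₀ : H1) (u₁ : L2), DataCondition (multiplier h) (damping b) u₀ u₁ →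
              BlowsUpInFiniteTime (damping b) p u₀ u₁ := by
  have hk1 : 0 < k - 1 := by linarith
  have hk0 : 0 < k := by linarith
  have h1 : 0 < 1 + 2 / (k - 1) := by positivity
  have h2 : 0 < k * (k - 1) := by positivity
  -- The first entry makes the source map a contraction. The second makes 4δ/(k(k-1)), the constant
  -- in the bound for h, at most θ.
  refine ⟨min (1 / 4 / (1 + 2 / (k - 1))) (θ * (k * (k - 1)) / 4),
    lt_min (by positivity) (by have := hθ.1; positivity), fun δ hδ b hb hd => ⟨?_, ?_⟩⟩
  · refine exists_isCorrector hk ?_ ?_ hb hd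
    · rw [← le_div_iff₀ h1]
      exact hδ.2.le.trans (min_le_left _ _)
    · rw [div_le_iff₀ h2]
      linarith [hδ.2.trans_le (min_le_right (1 / 4 / (1 + 2 / (k - 1))) (θ * (k * (k - 1)) / 4))]
  · intro h hh p hp hp3 u₀ u₁ hdata
    have ha := boundedDamping_damping hk0 hb hd
    obtain ⟨B, hg⟩ := hh.isMultiplier hk hθ.2 hb hd
    exact blowsUpInFiniteTime_of_no_global ha hp u₀ u₁ fun u ut =>
      not_isSolution_top hp hp3 ha.cnOn hg (by linarith [hθ.2]) hdata
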